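/- Let $N\in\mathbb N$, let $\Omega\subseteq\mathbb R^N$ be an open set (no boundedness, connectedness or boundary regularity is assumed), let $1<p<\infty$, let $\alpha\in C(\overline\Omega)$ be real-valued and non-negative, and put $\Delta:=\{x\in\overline\Omega:\alpha(x)=0\}$. All functions are real-valued. For $\Gamma\subseteq\partial\Omega$ let $$W^{1,p}_\Gamma(\Omega):=\overline{\{w\in C^\infty(\Omega)\cap W^{1,p}(\Omega):\ \mathrm{supp}(w)\cap\Gamma=\emptyset\}}^{\,W^{1,p}(\Omega)},$$ where $\mathrm{supp}(w)$ is the closure in $\mathbb R^N$ of $\{x\in\Omega: w(x)\neq0\}$. Let $C^\infty_\Delta(\Omega)$ be the set of functions $f:\Omega\to\mathbb R$ such that $f$ is $C^\infty$ on $\Omega\setminus\Delta$, $f=0$ on $\Omega\cap\Delta$, and for every $\epsilon>0$ there is a compact set $\Lambda_\epsilon\subseteq\overline\Omega\setminus\Delta$ with $|f(x)|\le\epsilon$ for all $x\in(\Omega\setminus\Delta)\setminus\Lambda_\epsilon$. Write $f\in C^\infty(\Omega\setminus\Delta)$ if the restriction of $f:\Omega\to\mathbb R$ to $\Omega\setminus\Delta$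 is $C^\infty$. An element of $L^p(\Omega)$ or $W^{1,p}_\Gamma(\Omega)$ belongs to one of these classes if it has a representative in it. Then: (i) for $X=L^p(\Omega)$ and $K=\{f\in X: |f(x)|\le\alpha(x)\text{ for a.e. }x\in\Omega\}$, $$\overline{K\cap C_c^\infty(\Omega)}^{\,X}=K;$$ (ii) for every $\Gamma\subseteq\partial\Omega$, with $X=W^{1,p}_\Gamma(\Omega)$ and $K=\{f\in X: |f(x)|\le\alpha(x)\text{ for a.e. }x\in\Omega\}$, $$\overline{K\cap C_\Delta^\infty(\Omega)}^{\,X}=K;$$ (iii) for every $\Gamma\subseteq\partial\Omega$, with $X=W^{1,p}_\Gamma(\Omega)$ and $K_\nabla=\{f\in X: |\nabla f(x)|\le\alpha(x)\text{ for a.e. }x\in\Omega\}$, where $\nabla f$ is the weak gradient and $|\cdot|$ the Euclidean norm, $$\overline{K_\nabla\cap C^\infty(\Omega\setminus\Delta)}^{\,X}=K_\nabla.$$ -/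

import Mathlib

open MeasureTheory Set
open scoped ENNReal ContDiff RealInnerProductSpace

noncomputable section

namespace ConvexDensity

/-- `ℝ^N` with the Euclidean norm. -/
abbrev E (N : ℕ) := EuclideanSpace ℝ (Fin N)

/-- Functions on `Ω ⊆ ℝ^N` are represented by functions on `ℝ^N`; only the values on `Ω` matter.
`μ Ω` is Lebesgue measure on `Ω`. -/
abbrev μ {N : ℕ} (Ω : Set (E N)) : Measure (E N) := volume.restrict Ω

/-- `L^p(Ω)`, real-valued. -/
abbrev LpReal {N : ℕ} (Ω : Set (E N)) (p : ℝ≥0∞) := Lp ℝ p (μ Ω)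

/-- `L^p(Ω)^N`. -/
abbrev LpVec {N : ℕ} (Ω : Set (E N)) (p : ℝ≥0∞) := Lp (E N) p (μ Ω)

/-- `φ ∈ C_c^∞(Ω)`, extended by zero to `ℝ^N`. -/
structure IsCcInfty {N : ℕ} (Ω : Set (E N)) (φ : E N → ℝ) : Prop where
  contDiff : ContDiff ℝ ∞ φ
  hasCompactSupport : HasCompactSupport φ
  tsupport_subset : tsupport φ ⊆ Ω

/-- `v` is the weak gradient of `u` in `Ω`:
`∫_Ω u ∂_y φ dx = - ∫_Ω φ ⟨v, y⟩ dx` for every test function `φ` and every direction `y`. -/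
def IsWeakGradient {N : ℕ} (Ω : Set (E N)) (u : E N → ℝ) (v : E N → E N) : Prop :=
  ∀ φ : E N → ℝ, IsCcInfty Ω φ → ∀ y : E N,
    ∫ x in Ω, u x * fderiv ℝ φ x y = - ∫ x in Ω, φ x * ⟪v x, y⟫

lemma integrable_mul_fderiv {N : ℕ} {Ω : Set (E N)} {p : ℝ≥0∞} [Fact (1 ≤ p)] {φ : E N → ℝ}
    (hφ : IsCcInfty Ω φ) {u : E N → ℝ} (hu : MemLp u p (μ Ω)) (y : E N) :
    Integrable (fun x => u x * fderiv ℝ φ x y) (μ Ω) := by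
  have h1 : LocallyIntegrable u (μ Ω) := hu.locallyIntegrable Fact.out
  have hc : Continuous (fun x => fderiv ℝ φ x y) :=
    (hφ.contDiff.continuous_fderiv (by simp)).clm_apply continuous_const
  have hs : HasCompactSupport (fun x => fderiv ℝ φ x y) :=
    hφ.hasCompactSupport.fderiv_apply ℝ y
  simpa only [smul_eq_mul, mul_comm] using
    h1.integrable_smul_left_of_hasCompactSupport hc hs

lemma integrable_mul_inner {N : ℕ} {Ω : Set (E N)} {p : ℝ≥0∞} [Fact (1 ≤ p)] {φ : E N → ℝ}
    (hφ : IsCcInfty Ω φ) {v : E N → E N} (hv : MemLp v p (μ Ω)) (y : E N) :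
    Integrable (fun x => φ x * ⟪v x, y⟫) (μ Ω) := by
  have h1 : LocallyIntegrable (fun x => ⟪v x, y⟫) (μ Ω) :=
    (hv.inner_const y).locallyIntegrable Fact.out
  exact h1.integrable_smul_left_of_hasCompactSupport hφ.contDiff.continuous hφ.hasCompactSupport

/-- The Sobolev space `W^{1,p}(Ω)`: pairs `(u, ∇u)` with `u ∈ L^p(Ω)` and weak gradient
`∇u ∈ L^p(Ω)^N` (which is determined by `u`). The norm `max (‖u‖_p) (‖∇u‖_p)` inherited from the
product is equivalent to the usual one. -/
def W1p {N : ℕ} (Ω : Set (E N)) (p : ℝ≥0∞) [Fact (1 ≤ p)] :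
    Submodule ℝ (LpReal Ω p × LpVec Ω p) where
  carrier := {q | IsWeakGradient Ω q.1 q.2}
  zero_mem' := by
    intro φ _ y
    have h1 : ∀ᵐ x ∂(μ Ω), (0 : LpReal Ω p) x * fderiv ℝ φ x y = 0 := by
      filter_upwards [Lp.coeFn_zero ℝ p (μ Ω)] with x hx
      rw [hx, Pi.zero_apply, zero_mul]
    have h2 : ∀ᵐ x ∂(μ Ω), φ x * ⟪(0 : LpVec Ω p) x, y⟫ = 0 := by
      filter_upwards [Lp.coeFn_zero (E N) p (μ Ω)] with x hx
      rw [hx, Pi.zero_apply, inner_zero_left, mul_zero]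
    have e1 := integral_congr_ae h1
    have e2 := integral_congr_ae h2
    simp only [integral_zero] at e1 e2
    exact e1.trans (by rw [← neg_zero, ← e2]; rfl)
  add_mem' := by
    intro a b ha hb φ hφ y
    have ia := integrable_mul_fderiv hφ (Lp.memLp a.1) y
    have ib := integrable_mul_fderiv hφ (Lp.memLp b.1) y
    have ja := integrable_mul_inner hφ (Lp.memLp a.2) y
    have jb := integrable_mul_inner hφ (Lp.memLp b.2) y
    have e1 : ∫ x in Ω, (a + b).1 x * fderiv ℝ φ x y
        = ∫ x in Ω, (a.1 x * fderiv ℝ φ x y + b.1 x * fderiv ℝ φ x y) := by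
      refine integral_congr_ae ?_
      filter_upwards [Lp.coeFn_add a.1 b.1] with x hx
      rw [Prod.fst_add, hx, Pi.add_apply, add_mul]
    have e2 : ∫ x in Ω, φ x * ⟪(a + b).2 x, y⟫
        = ∫ x in Ω, (φ x * ⟪a.2 x, y⟫ + φ x * ⟪b.2 x, y⟫) := by
      refine integral_congr_ae ?_
      filter_upwards [Lp.coeFn_add a.2 b.2] with x hx
      rw [Prod.snd_add, hx, Pi.add_apply, inner_add_left, mul_add]
    rw [e1, e2, integral_add ia ib, integral_add ja jb, ha φ hφ y, hb φ hφ y]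
    ring
  smul_mem' := by
    intro c a ha φ hφ y
    have e1 : ∫ x in Ω, (c • a).1 x * fderiv ℝ φ x y
        = ∫ x in Ω, c * (a.1 x * fderiv ℝ φ x y) := by
      refine integral_congr_ae ?_
      filter_upwards [Lp.coeFn_smul c a.1] with x hx
      rw [Prod.smul_fst, hx, Pi.smul_apply, smul_eq_mul, mul_assoc]
    have e2 : ∫ x in Ω, φ x * ⟪(c • a).2 x, y⟫
        = ∫ x in Ω, c * (φ x * ⟪a.2 x, y⟫) := by
      refine integral_congr_ae ?_
      filter_upwards [Lp.coeFn_smul c a.2] with x hx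
      rw [Prod.smul_snd, hx, Pi.smul_apply, real_inner_smul_left]
      ring
    rw [e1, e2, integral_const_mul, integral_const_mul, ha φ hφ y]
    ring

/-- The elements of `W^{1,p}(Ω)` that are represented by some `w ∈ C^∞(Ω)` with
`supp w ∩ Γ = ∅`, the support being the closure in `ℝ^N` of `{x ∈ Ω | w x ≠ 0}`. -/
def smoothOff {N : ℕ} (Ω Γ : Set (E N)) (p : ℝ≥0∞) [Fact (1 ≤ p)] :
    Submodule ℝ (W1p Ω p) where
  carrier := {q | ∃ w : E N → ℝ, ContDiffOn ℝ ∞ w Ω ∧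
    closure {x ∈ Ω | w x ≠ 0} ∩ Γ = ∅ ∧ q.1.1 =ᵐ[μ Ω] w}
  zero_mem' := by
    refine ⟨fun _ => 0, contDiffOn_const, by simp, ?_⟩
    exact Lp.coeFn_zero ℝ p (μ Ω)
  add_mem' := by
    rintro a b ⟨f, hf, hfΓ, haf⟩ ⟨g, hg, hgΓ, hbg⟩
    refine ⟨fun x => f x + g x, hf.add hg, ?_, ?_⟩
    · have hsub : {x ∈ Ω | f x + g x ≠ 0} ⊆ {x ∈ Ω | f x ≠ 0} ∪ {x ∈ Ω | g x ≠ 0} := by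
        rintro x ⟨hx, hne⟩
        by_cases h : f x = 0
        · exact Or.inr ⟨hx, fun h' => hne (by rw [h, h', add_zero])⟩
        · exact Or.inl ⟨hx, h⟩
      have hcl := closure_mono hsub
      rw [closure_union] at hcl
      rw [← subset_empty_iff]
      rintro z ⟨hz, hzΓ⟩
      rcases hcl hz with h | h
      · exact hfΓ.subset ⟨h, hzΓ⟩
      · exact hgΓ.subset ⟨h, hzΓ⟩
    · filter_upwards [Lp.coeFn_add a.1.1 b.1.1, haf, hbg] with x h h1 h2
      exact h.trans (by rw [Pi.add_apply, h1, h2])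
  smul_mem' := by
    rintro c a ⟨f, hf, hfΓ, haf⟩
    refine ⟨fun x => c * f x, contDiffOn_const.mul hf, ?_, ?_⟩
    · have hsub : {x ∈ Ω | c * f x ≠ 0} ⊆ {x ∈ Ω | f x ≠ 0} := by
        rintro x ⟨hx, hne⟩
        exact ⟨hx, right_ne_zero_of_mul hne⟩
      rw [← subset_empty_iff, ← hfΓ]
      exact inter_subset_inter_left _ (closure_mono hsub)
    · filter_upwards [Lp.coeFn_smul c a.1.1, haf] with x h h1
      exact h.trans (by rw [Pi.smul_apply, h1, smul_eq_mul])

/-- `W^{1,p}_Γ(Ω)`: the closure of `smoothOff Ω Γ p` in `W^{1,p}(Ω)`. -/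
def W1pOff {N : ℕ} (Ω Γ : Set (E N)) (p : ℝ≥0∞) [Fact (1 ≤ p)] : Submodule ℝ (W1p Ω p) :=
  (smoothOff Ω Γ p).topologicalClosure

/-- The function underlying an element of `W^{1,p}_Γ(Ω)`. -/
abbrev W1pOff.fn {N : ℕ} {Ω Γ : Set (E N)} {p : ℝ≥0∞} [Fact (1 ≤ p)]
    (u : W1pOff Ω Γ p) : E N → ℝ := u.1.1.1

/-- The weak gradient of an element of `W^{1,p}_Γ(Ω)`. -/
abbrev W1pOff.grad {N : ℕ} {Ω Γ : Set (E N)} {p : ℝ≥0∞} [Fact (1 ≤ p)]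
    (u : W1pOff Ω Γ p) : E N → E N := u.1.1.2

/-- `g ∈ C_Λ^∞(Ω)`: `g` is smooth on `Ω ∖ Λ`, vanishes on `Ω ∩ Λ`, and for every `ε > 0` one has
`|g| ≤ ε` on `Ω ∖ Λ` outside some compact subset of `closure Ω ∖ Λ`. For bounded `Ω` the last
condition says that `g x → 0` as `x ∈ Ω` approaches `Λ`. -/
structure IsCInftyVanishing {N : ℕ} (Ω Λ : Set (E N)) (g : E N → ℝ) : Prop where
  contDiffOn : ContDiffOn ℝ ∞ g (Ω \ Λ)
  eq_zero : ∀ x ∈ Ω ∩ Λ, g x = 0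
  small : ∀ ε > 0, ∃ C : Set (E N), IsCompact C ∧ C ⊆ closure Ω \ Λ ∧
    ∀ x ∈ (Ω \ Λ) \ C, |g x| ≤ ε

/-- The zero set `Δ ⊆ closure Ω` of the bound `α`. -/
def zeroSet {N : ℕ} (Ω : Set (E N)) (α : E N → ℝ) : Set (E N) := {x ∈ closure Ω | α x = 0}

/-- `K = {f ∈ L^p(Ω) : |f| ≤ α a.e. in Ω}`. -/
def KLp {N : ℕ} (Ω : Set (E N)) (p : ℝ≥0∞) (α : E N → ℝ) : Set (LpReal Ω p) :=
  {u | ∀ᵐ x ∂(μ Ω), |u x| ≤ α x}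

/-- `K = {f ∈ W^{1,p}_Γ(Ω) : |f| ≤ α a.e. in Ω}`. -/
def KSob {N : ℕ} (Ω Γ : Set (E N)) (p : ℝ≥0∞) [Fact (1 ≤ p)] (α : E N → ℝ) :
    Set (W1pOff Ω Γ p) :=
  {u | ∀ᵐ x ∂(μ Ω), |W1pOff.fn u x| ≤ α x}

/-- `K_∇ = {f ∈ W^{1,p}_Γ(Ω) : |∇f| ≤ α a.e. in Ω}`, with the Euclidean norm of the gradient. -/
def KGrad {N : ℕ} (Ω Γ : Set (E N)) (p : ℝ≥0∞) [Fact (1 ≤ p)] (α : E N → ℝ) :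
    Set (W1pOff Ω Γ p) :=
  {u | ∀ᵐ x ∂(μ Ω), ‖W1pOff.grad u x‖ ≤ α x}

/-- The elements of `L^p(Ω)` with a representative in `C_c^∞(Ω)`. -/
def CcInftyLp {N : ℕ} (Ω : Set (E N)) (p : ℝ≥0∞) : Set (LpReal Ω p) :=
  {u | ∃ g : E N → ℝ, IsCcInfty Ω g ∧ u =ᵐ[μ Ω] g}

/-- The elements of `W^{1,p}_Γ(Ω)` with a representative in `C_Λ^∞(Ω)`. -/
def CInftyVanishingSob {N : ℕ} (Ω Γ Λ : Set (E N)) (p : ℝ≥0∞) [Fact (1 ≤ p)] :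
    Set (W1pOff Ω Γ p) :=
  {u | ∃ g : E N → ℝ, IsCInftyVanishing Ω Λ g ∧ W1pOff.fn u =ᵐ[μ Ω] g}

/-- The elements of `W^{1,p}_Γ(Ω)` with a representative whose restriction to `Ω ∖ Λ` is smooth. -/
def CInftyOffSob {N : ℕ} (Ω Γ Λ : Set (E N)) (p : ℝ≥0∞) [Fact (1 ≤ p)] :
    Set (W1pOff Ω Γ p) :=
  {u | ∃ g : E N → ℝ, ContDiffOn ℝ ∞ g (Ω \ Λ) ∧ W1pOff.fn u =ᵐ[μ Ω] g}

end ConvexDensity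

end

/-! The three constraint sets are closed, because convergence in L^p gives a.e. convergence along a
subsequence. So only the approximation of a given element matters. The bound α is continuous and
positive on the open set U = Ω ∖ Δ, and a.e. on Ω ∩ Δ the constrained quantity is zero.

For the Sobolev cases a Meyers–Serrin smoothing is carried out in U instead of Ω
(`W1p.exists_smoothing`). With a partition of unity ψ_j of U, add to q the corrections ρ_j ∗ (ψ_j q)
− ψ_j q, where ρ_j is a mollifier whose scale depends on j. Each correction is a limit of test
functions, so it respects every choice of Γ ⊆ ∂Ω. Completeness sums the corrections. They vanish off
U, and on U they turn q into a locally finite sum of smooth functions.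

If |q| ≤ α, then |ρ_j ∗ (ψ_j q)| ≤ ρ_j ∗ (ψ_j α). The function ψ_j α is continuous with compact
support in U, where α is locally bounded below by positive constants, so a small scale gives at most
ψ_j α + 2^(-j-1) δ α. Summation gives (1 + δ) α, and division by 1 + δ restores the constraint at a
small cost in norm.

For a gradient bound the terms ρ_j ∗ (q ∇ψ_j) have to be controlled too. Since ∇q is locally bounded
in U, q has a continuous representative u there, so ρ_j ∗ (u ∇ψ_j) is close to u ∇ψ_j uniformly
relative to α. Moreover Σ u ∇ψ_j = 0, so these terms cancel up to a small multiple of α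
(`W1p.exists_smoothing_grad_le`).

Decay towards Δ and infinity in (ii) comes from two further operations that decrease |q|: composing
with a smooth function that vanishes near 0, and multiplying by a cutoff at infinity. Afterwards the
function vanishes outside a compact set on which α ≥ c > 0. In (i) no gradient is involved: multiply
by a partial sum of the partition and mollify once. -/

noncomputable section

namespace ConvexDensity

open Filter Topology Metric
open scoped Convolution Manifold

/-! ### Mollification: pointwise bounds and convergence. -/

section Mollification

variable {N : ℕ} {F : Type*} [NormedAddCommGroup F] [NormedSpace ℝ F]

/-- A bump function at the origin supported in the ball of radius `1 / (n + 1)`. -/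
def mollBump (N n : ℕ) : ContDiffBump (0 : E N) where
  rIn := 1 / (2 * ((n : ℝ) + 1))
  rOut := 1 / ((n : ℝ) + 1)
  rIn_pos := by positivity
  rIn_lt_rOut := by
    apply one_div_lt_one_div_of_lt <;> linarith [(Nat.cast_nonneg n : (0 : ℝ) ≤ n)]

lemma tendsto_mollBump_rOut (N : ℕ) : Tendsto (fun n => (mollBump N n).rOut) atTop (𝓝 0) :=
  tendsto_one_div_add_atTop_nhds_zero_nat

/-- The mollifying kernel of radius `1 / (n + 1)`. -/
def kernel (N n : ℕ) : E N → ℝ := (mollBump N n).normed volume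

/-- Mollification of `f` at scale `1 / (n + 1)`. -/
def moll (n : ℕ) (f : E N → F) : E N → F :=
  (kernel N n) ⋆[ContinuousLinearMap.lsmul ℝ ℝ, volume] f

lemma contDiff_kernel (n : ℕ) : ContDiff ℝ ∞ (kernel N n) := (mollBump N n).contDiff_normed

lemma continuous_kernel (n : ℕ) : Continuous (kernel N n) := (contDiff_kernel n).continuous

lemma hasCompactSupport_kernel (n : ℕ) : HasCompactSupport (kernel N n) :=
  (mollBump N n).hasCompactSupport_normed

lemma kernel_nonneg (n : ℕ) (x : E N) : 0 ≤ kernel N n x := (mollBump N n).nonneg_normed x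

lemma tsupport_kernel (n : ℕ) : tsupport (kernel N n) = closedBall 0 (1 / ((n : ℝ) + 1)) :=
  (mollBump N n).tsupport_normed_eq

lemma integral_kernel (n : ℕ) : ∫ t, kernel N n t = 1 := (mollBump N n).integral_normed

lemma integrable_kernel (n : ℕ) : Integrable (kernel N n) volume :=
  (mollBump N n).integrable_normed

lemma lintegral_kernel (n : ℕ) : ∫⁻ t, ENNReal.ofReal (kernel N n t) = 1 := by
  rw [← ofReal_integral_eq_lintegral_ofReal (integrable_kernel n)
    (Eventually.of_forall (kernel_nonneg n)), integral_kernel, ENNReal.ofReal_one]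

lemma support_kernel (n : ℕ) :
    Function.support (kernel N n) = ball 0 (1 / ((n : ℝ) + 1)) :=
  (mollBump N n).support_normed_eq

lemma moll_apply (n : ℕ) (f : E N → F) (x : E N) :
    moll n f x = ∫ z, kernel N n (x - z) • f z :=
  convolution_eq_swap _

lemma moll_apply' (n : ℕ) (f : E N → F) (x : E N) :
    moll n f x = ∫ t, kernel N n t • f (x - t) :=
  rfl

lemma moll_congr_ae {f g : E N → F} (n : ℕ) (h : f =ᵐ[volume] g) : moll n f = moll n g := by
  funext x
  rw [moll_apply, moll_apply]
  refine integral_congr_ae ?_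
  filter_upwards [h] with z hz
  rw [hz]

lemma integrable_kernel_smul {f : E N → F} (n : ℕ) (hf : LocallyIntegrable f volume) (x : E N) :
    Integrable (fun z => kernel N n (x - z) • f z) volume := by
  refine hf.integrable_smul_left_of_hasCompactSupport
    ((continuous_kernel n).comp (continuous_const.sub continuous_id)) ?_
  exact (hasCompactSupport_kernel n).comp_homeomorph (Homeomorph.subLeft x)

lemma contDiff_moll {f : E N → F} (n : ℕ) (hf : LocallyIntegrable f volume) :
    ContDiff ℝ ∞ (moll n f) :=
  (hasCompactSupport_kernel n).contDiff_convolution_left _ (contDiff_kernel n) hf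

lemma moll_eq_zero {f : E N → F} {n : ℕ} {x : E N}
    (h : ∀ z ∈ ball x (1 / ((n : ℝ) + 1)), f z = 0) : moll n f x = 0 := by
  rw [moll_apply]
  refine integral_eq_zero_of_ae (Eventually.of_forall fun z => ?_)
  by_cases hz : z ∈ ball x (1 / ((n : ℝ) + 1))
  · simp [h z hz]
  · have : x - z ∉ Function.support (kernel N n) := by
      rw [support_kernel, mem_ball_zero_iff]
      rwa [mem_ball', dist_eq_norm] at hz
    simp [Function.notMem_support.1 this]

lemma moll_add {f g : E N → F} (n : ℕ) (hf : LocallyIntegrable f volume)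
    (hg : LocallyIntegrable g volume) (x : E N) :
    moll n (fun z => f z + g z) x = moll n f x + moll n g x := by
  simp only [moll_apply, smul_add]
  exact integral_add (integrable_kernel_smul n hf x) (integrable_kernel_smul n hg x)

lemma moll_sub {f g : E N → F} (n : ℕ) (hf : LocallyIntegrable f volume)
    (hg : LocallyIntegrable g volume) (x : E N) :
    moll n (fun z => f z - g z) x = moll n f x - moll n g x := by
  simp only [moll_apply, smul_sub]
  exact integral_sub (integrable_kernel_smul n hf x) (integrable_kernel_smul n hg x)

/-- The kernel is a nonnegative weight, so a pointwise bound in any norm passes to the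
mollification. This serves both the function and the Euclidean norm of its gradient. -/
lemma norm_moll_le {f : E N → F} {b : E N → ℝ} (n : ℕ) (hb : LocallyIntegrable b volume)
    (h : ∀ᵐ z ∂(volume : Measure (E N)), ‖f z‖ ≤ b z) (x : E N) : ‖moll n f x‖ ≤ moll n b x := by
  rw [moll_apply, moll_apply]
  refine norm_integral_le_of_norm_le (integrable_kernel_smul n hb x) ?_
  filter_upwards [h] with z hz
  rw [norm_smul, Real.norm_of_nonneg (kernel_nonneg n _), smul_eq_mul]
  exact mul_le_mul_of_nonneg_left hz (kernel_nonneg n _)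

lemma norm_moll_le_of_ball {f : E N → F} {n : ℕ} {x : E N} {M : ℝ}
    (h : ∀ᵐ z ∂(volume : Measure (E N)), z ∈ ball x (1 / ((n : ℝ) + 1)) → ‖f z‖ ≤ M) :
    ‖moll n f x‖ ≤ M := by
  rw [moll_apply]
  have h1 : ∫ z, kernel N n (x - z) = 1 := by
    rw [integral_sub_left_eq_self (kernel N n) volume x, integral_kernel]
  have hi : Integrable (fun z => kernel N n (x - z)) volume :=
    (integrable_kernel n).comp_sub_left x
  calc ‖∫ z, kernel N n (x - z) • f z‖ ≤ ∫ z, kernel N n (x - z) * M := by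
        refine norm_integral_le_of_norm_le (hi.mul_const M) ?_
        filter_upwards [h] with z hz
        rw [norm_smul, Real.norm_of_nonneg (kernel_nonneg n _)]
        by_cases hzb : z ∈ ball x (1 / ((n : ℝ) + 1))
        · exact mul_le_mul_of_nonneg_left (hz hzb) (kernel_nonneg n _)
        · have : x - z ∉ Function.support (kernel N n) := by
            rw [support_kernel, mem_ball_zero_iff]
            rwa [mem_ball', dist_eq_norm] at hzb
          simp [Function.notMem_support.1 this]
    _ = M := by rw [integral_mul_const, h1, one_mul]

lemma eventually_one_div_lt {δ : ℝ} (hδ : 0 < δ) :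
    ∀ᶠ n : ℕ in atTop, 1 / ((n : ℝ) + 1) < δ :=
  (tendsto_order.1 tendsto_one_div_add_atTop_nhds_zero_nat).2 δ hδ

/-- The support of a mollification shrinks to the support of the function. -/
lemma eventually_tsupport_moll_subset {f : E N → F} (hf : HasCompactSupport f)
    {V : Set (E N)} (hV : IsOpen V) (hfV : tsupport f ⊆ V) :
    ∃ K : Set (E N), IsCompact K ∧ K ⊆ V ∧ tsupport f ⊆ K ∧
      ∀ᶠ n : ℕ in atTop, tsupport (moll n f) ⊆ K := by
  obtain ⟨δ, hδ, hδV⟩ := IsCompact.exists_cthickening_subset_open hf hV hfV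
  refine ⟨cthickening δ (tsupport f), hf.isCompact.cthickening, hδV,
    self_subset_cthickening _, ?_⟩
  filter_upwards [eventually_one_div_lt hδ] with n hn
  refine closure_minimal (fun x hx => ?_) isClosed_cthickening
  by_contra hxc
  refine hx (moll_eq_zero fun z hz => ?_)
  by_contra hfz
  refine hxc (mem_cthickening_of_dist_le x z δ _ (subset_tsupport f hfz) ?_)
  rw [mem_ball'] at hz
  exact (hz.trans hn).le

lemma eventually_isCcInfty_moll {f : E N → ℝ} (hf : HasCompactSupport f)
    (hfi : LocallyIntegrable f volume) {V : Set (E N)} (hV : IsOpen V) (hfV : tsupport f ⊆ V) :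
    ∀ᶠ n : ℕ in atTop, IsCcInfty V (moll n f) := by
  obtain ⟨K, hK, hKV, -, hev⟩ := eventually_tsupport_moll_subset hf hV hfV
  filter_upwards [hev] with n hn
  exact ⟨contDiff_moll n hfi, hK.of_isClosed_subset (isClosed_tsupport _) hn, hn.trans hKV⟩

lemma eventually_norm_moll_sub_le [CompleteSpace F] {h : E N → F} (hc : Continuous h)
    (hs : HasCompactSupport h) {ε : ℝ} (hε : 0 < ε) :
    ∀ᶠ n : ℕ in atTop, ∀ x, ‖moll n h x - h x‖ ≤ ε := by
  have huc := hs.uniformContinuous_of_continuous hc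
  obtain ⟨δ, hδ, hd⟩ := Metric.uniformContinuous_iff.1 huc ε hε
  filter_upwards [eventually_one_div_lt hδ] with n hn x
  rw [← dist_eq_norm]
  refine (mollBump N n).dist_normed_convolution_le hc.aestronglyMeasurable fun z hz => ?_
  exact (hd (lt_trans hz hn)).le

/-- Mollification of a continuous function with compact support in `V` converges uniformly
relative to every positive continuous weight on `V`. -/
lemma eventually_norm_moll_sub_le_weight [CompleteSpace F] {h : E N → F} (hc : Continuous h)
    (hs : HasCompactSupport h) {V : Set (E N)} (hV : IsOpen V) (hhV : tsupport h ⊆ V)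
    {β : E N → ℝ} (hβc : ContinuousOn β V) (hβ : ∀ x ∈ V, 0 < β x) :
    ∀ᶠ n : ℕ in atTop, ∀ x ∈ V, ‖moll n h x - h x‖ ≤ β x := by
  obtain ⟨K, hK, hKV, hhK, hev⟩ := eventually_tsupport_moll_subset hs hV hhV
  -- On the compact K that holds all the supports, β has a positive minimum, so plain uniform
  -- convergence is enough. Off K both functions vanish.
  obtain ⟨c, hc0, hcK⟩ : ∃ c > 0, ∀ x ∈ K, c ≤ β x := by
    rcases K.eq_empty_or_nonempty with rfl | hne
    · exact ⟨1, one_pos, by simp⟩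
    · obtain ⟨x₀, hx₀, hmin⟩ := hK.exists_isMinOn hne (hβc.mono hKV)
      exact ⟨β x₀, hβ x₀ (hKV hx₀), fun x hx => hmin hx⟩
  filter_upwards [hev, eventually_norm_moll_sub_le hc hs hc0] with n hn hn' x hx
  by_cases hxK : x ∈ K
  · exact (hn' x).trans (hcK x hxK)
  · rw [image_eq_zero_of_notMem_tsupport fun h' => hxK (hn h'),
      image_eq_zero_of_notMem_tsupport fun h' => hxK (hhK h'), sub_zero, norm_zero]
    exact (hβ x hx).le

/-- Jensen's inequality for the probability measure with density `kernel N n`, in the form of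
monotonicity of L^r norms. Integrating in x then gives the L^p contraction by Tonelli. -/
lemma enorm_moll_rpow_le {f : E N → F} (hf : StronglyMeasurable f) (n : ℕ) {r : ℝ} (hr : 1 ≤ r)
    (x : E N) :
    ‖moll n f x‖ₑ ^ r ≤ ∫⁻ t, ENNReal.ofReal (kernel N n t) * ‖f (x - t)‖ₑ ^ r := by
  have hkm : Measurable fun t => ENNReal.ofReal (kernel N n t) :=
    (continuous_kernel n).measurable.ennreal_ofReal
  set ν : Measure (E N) := volume.withDensity fun t => ENNReal.ofReal (kernel N n t) with hν
  have hprob : IsProbabilityMeasure ν := by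
    refine ⟨?_⟩
    rw [hν, withDensity_apply _ MeasurableSet.univ, Measure.restrict_univ, lintegral_kernel]
  have hm : Measurable fun t => ‖f (x - t)‖ₑ :=
    (hf.comp_measurable (measurable_const.sub measurable_id)).enorm
  have h1 : ‖moll n f x‖ₑ ≤ ∫⁻ t, ‖f (x - t)‖ₑ ∂ν := by
    rw [moll_apply', hν, lintegral_withDensity_eq_lintegral_mul _ hkm hm]
    refine (enorm_integral_le_lintegral_enorm _).trans (lintegral_mono fun t => ?_)
    rw [enorm_smul, Real.enorm_of_nonneg (kernel_nonneg n t)]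
    exact le_rfl
  have hjen : (∫⁻ t, ‖f (x - t)‖ₑ ∂ν) ^ r ≤ ∫⁻ t, ‖f (x - t)‖ₑ ^ r ∂ν := by
    have := eLpNorm_le_eLpNorm_of_exponent_le (μ := ν) (p := 1) (q := ENNReal.ofReal r)
      (f := fun t => f (x - t)) (by simpa using ENNReal.ofReal_le_ofReal hr)
      (hf.comp_measurable (measurable_const.sub measurable_id)).aestronglyMeasurable
    have hr0 : 0 < r := by linarith
    rw [eLpNorm_one_eq_lintegral_enorm, eLpNorm_eq_lintegral_rpow_enorm_toReal
      (by simpa using hr0) ENNReal.ofReal_ne_top, ENNReal.toReal_ofReal hr0.le] at this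
    calc _ ≤ ((∫⁻ t, ‖f (x - t)‖ₑ ^ r ∂ν) ^ (1 / r)) ^ r := ENNReal.rpow_le_rpow this hr0.le
      _ = _ := by rw [← ENNReal.rpow_mul, one_div_mul_cancel hr0.ne', ENNReal.rpow_one]
  calc ‖moll n f x‖ₑ ^ r ≤ (∫⁻ t, ‖f (x - t)‖ₑ ∂ν) ^ r :=
        ENNReal.rpow_le_rpow h1 (by linarith)
    _ ≤ _ := hjen
    _ = _ := by
      rw [hν, lintegral_withDensity_eq_lintegral_mul _ hkm (hm.pow_const r)]
      rfl

/-- Mollification does not increase the `L^p` norm. -/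
lemma eLpNorm_moll_le {f : E N → F} (hf : AEStronglyMeasurable f volume) (n : ℕ) {p : ℝ≥0∞}
    (hp1 : 1 ≤ p) (hp : p ≠ ⊤) : eLpNorm (moll n f) p volume ≤ eLpNorm f p volume := by
  wlog hfm : StronglyMeasurable f generalizing f
  · rw [moll_congr_ae n hf.ae_eq_mk, eLpNorm_congr_ae hf.ae_eq_mk]
    exact this hf.stronglyMeasurable_mk.aestronglyMeasurable hf.stronglyMeasurable_mk
  have hp0 : p ≠ 0 := (zero_lt_one.trans_le hp1).ne'
  have hr : 1 ≤ p.toReal := by simpa using ENNReal.toReal_mono hp hp1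
  rw [eLpNorm_eq_lintegral_rpow_enorm_toReal hp0 hp, eLpNorm_eq_lintegral_rpow_enorm_toReal hp0 hp]
  refine ENNReal.rpow_le_rpow ?_ (by positivity)
  have hkm : Measurable fun t => ENNReal.ofReal (kernel N n t) :=
    (continuous_kernel n).measurable.ennreal_ofReal
  calc ∫⁻ x, ‖moll n f x‖ₑ ^ p.toReal
      ≤ ∫⁻ x, ∫⁻ t, ENNReal.ofReal (kernel N n t) * ‖f (x - t)‖ₑ ^ p.toReal :=
        lintegral_mono fun x => enorm_moll_rpow_le hfm n hr x
    _ = ∫⁻ t, ∫⁻ x, ENNReal.ofReal (kernel N n t) * ‖f (x - t)‖ₑ ^ p.toReal := by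
        refine lintegral_lintegral_swap ?_
        refine Measurable.aemeasurable ?_
        refine (hkm.comp measurable_snd).mul (Measurable.pow_const ?_ _)
        exact (hfm.comp_measurable (measurable_fst.sub measurable_snd)).enorm
    _ = ∫⁻ t, ENNReal.ofReal (kernel N n t) * ∫⁻ x, ‖f x‖ₑ ^ p.toReal := by
        refine lintegral_congr fun t => ?_
        have hm : Measurable fun x => ‖f (x - t)‖ₑ ^ p.toReal :=
          (hfm.comp_measurable (measurable_id.sub measurable_const)).enorm.pow_const _
        rw [lintegral_const_mul _ hm, lintegral_sub_right_eq_self (fun x => ‖f x‖ₑ ^ p.toReal) t]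
    _ = ∫⁻ x, ‖f x‖ₑ ^ p.toReal := by
        rw [lintegral_mul_const _ hkm, lintegral_kernel, one_mul]

/-- Mollifications converge in `L^p`. -/
lemma tendsto_eLpNorm_moll_sub [CompleteSpace F] {f : E N → F} {p : ℝ≥0∞} (hp1 : 1 ≤ p)
    (hp : p ≠ ⊤) (hf : MemLp f p volume) :
    Tendsto (fun n => eLpNorm (moll n f - f) p volume) atTop (𝓝 0) := by
  rw [ENNReal.tendsto_atTop_zero]
  intro ε hε
  have hε3 : ε / 3 ≠ 0 := by simp [hε.ne']
  obtain ⟨g, hgs, hfg, hgc, hgm⟩ := hf.exists_hasCompactSupport_eLpNorm_sub_le hp hε3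
  have hp0 : p ≠ 0 := (zero_lt_one.trans_le hp1).ne'
  obtain ⟨K, hK, -, hgK, hev⟩ := eventually_tsupport_moll_subset hgs isOpen_univ (subset_univ _)
  -- For continuous g of compact support the convergence is uniform and takes place inside a fixed
  -- compact K, so the L^p norm is at most |K|^(1/p) c.
  have key : ∀ᶠ n : ℕ in atTop, eLpNorm (moll n g - g) p volume ≤ ε / 3 := by
    have hvol : volume K ^ p.toReal⁻¹ ≠ ⊤ :=
      ENNReal.rpow_ne_top_of_nonneg (by positivity) hK.measure_lt_top.ne
    obtain ⟨c, hc0, hc⟩ : ∃ c : ℝ, 0 < c ∧ volume K ^ p.toReal⁻¹ * ENNReal.ofReal c ≤ ε / 3 := by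
      have : Tendsto (fun c : ℝ => volume K ^ p.toReal⁻¹ * ENNReal.ofReal c) (𝓝[>] 0) (𝓝 0) := by
        have h0 : Tendsto (fun c : ℝ => ENNReal.ofReal c) (𝓝[>] 0) (𝓝 0) := by
          have := (ENNReal.continuous_ofReal.tendsto 0)
          rw [ENNReal.ofReal_zero] at this
          exact this.mono_left nhdsWithin_le_nhds
        simpa using ENNReal.Tendsto.const_mul h0 (Or.inr hvol)
      have h1 := this.eventually (ge_mem_nhds (pos_iff_ne_zero.2 hε3))
      obtain ⟨c, hc, hc0⟩ := (h1.and self_mem_nhdsWithin).exists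
      exact ⟨c, hc0, hc⟩
    filter_upwards [hev, eventually_norm_moll_sub_le hgc hgs hc0] with n hn hn'
    have hind : moll n g - g = K.indicator (moll n g - g) := by
      symm
      rw [indicator_eq_self]
      intro x hx
      by_contra hxK
      refine hx ?_
      rw [Pi.sub_apply, image_eq_zero_of_notMem_tsupport fun h' => hxK (hn h'),
        image_eq_zero_of_notMem_tsupport fun h' => hxK (hgK h'), sub_zero]
    rw [hind, eLpNorm_indicator_eq_eLpNorm_restrict hK.measurableSet]
    refine (eLpNorm_le_of_ae_bound (C := c) (Eventually.of_forall hn')).trans ?_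
    simpa using hc
  obtain ⟨n₀, hn₀⟩ := eventually_atTop.1 key
  refine ⟨n₀, fun n hn => ?_⟩
  have hfl := hf.locallyIntegrable hp1
  have hgl := hgm.locallyIntegrable hp1
  have hdec : moll n f - f = moll n (f - g) + ((moll n g - g) + (g - f)) := by
    funext x
    have : moll n (f - g) x = moll n f x - moll n g x := moll_sub n hfl hgl x
    simp only [Pi.sub_apply, Pi.add_apply, this]
    abel
  have hm1 := (hf.sub hgm).aestronglyMeasurable
  have hc1 : Continuous (moll n (f - g)) := (contDiff_moll n (hfl.sub hgl)).continuous
  have hc2 : Continuous (moll n g) := (contDiff_moll n hgl).continuous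
  have hm2 : AEStronglyMeasurable (moll n g - g) volume :=
    (hc2.sub hgc).aestronglyMeasurable
  have hm3 : AEStronglyMeasurable (g - f) volume := (hgm.sub hf).aestronglyMeasurable
  rw [hdec]
  calc _ ≤ eLpNorm (moll n (f - g)) p volume + eLpNorm ((moll n g - g) + (g - f)) p volume :=
        eLpNorm_add_le hc1.aestronglyMeasurable (hm2.add hm3) hp1
    _ ≤ eLpNorm (f - g) p volume + (eLpNorm (moll n g - g) p volume + eLpNorm (g - f) p volume) :=
        add_le_add (eLpNorm_moll_le hm1 n hp1 hp) (eLpNorm_add_le hm2 hm3 hp1)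
    _ ≤ ε / 3 + (ε / 3 + ε / 3) := by
        refine add_le_add hfg (add_le_add (hn₀ n hn) ?_)
        rw [eLpNorm_sub_comm]; exact hfg
    _ = ε := by rw [← add_assoc, ENNReal.add_thirds]

lemma ae_tendsto_moll [CompleteSpace F] {f : E N → F} (hf : LocallyIntegrable f volume) :
    ∀ᵐ x ∂(volume : Measure (E N)), Tendsto (fun n => moll n f x) atTop (𝓝 (f x)) := by
  refine ContDiffBump.ae_convolution_tendsto_right_of_locallyIntegrable
    (φ := fun n => mollBump N n) (K := 2) (tendsto_mollBump_rOut N)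
    (Eventually.of_forall fun n => ?_) hf
  -- Lebesgue differentiation needs outer and inner radii of comparable size; here the ratio is
  -- exactly 2.
  change 1 / ((n : ℝ) + 1) ≤ 2 * (1 / (2 * ((n : ℝ) + 1)))
  have : (0 : ℝ) < (n : ℝ) + 1 := by positivity
  field_simp
  exact le_rfl

end Mollification

/-! ### Weak gradients: uniqueness, product rule, mollification, closedness. -/

section WeakGradient

variable {N : ℕ} {Ω : Set (E N)}

lemma continuous_gradient {ψ : E N → ℝ} (hψ : ContDiff ℝ ∞ ψ) : Continuous (gradient ψ) :=
  (InnerProductSpace.toDual ℝ (E N)).symm.continuous.comp (hψ.continuous_fderiv (by simp))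

lemma support_gradient_subset (ψ : E N → ℝ) : Function.support (gradient ψ) ⊆ tsupport ψ := by
  intro x hx
  refine support_fderiv_subset ℝ (f := ψ) ?_
  intro h
  refine hx ?_
  rw [gradient, h, map_zero]

lemma tsupport_gradient_subset (ψ : E N → ℝ) : tsupport (gradient ψ) ⊆ tsupport ψ :=
  closure_minimal (support_gradient_subset ψ) (isClosed_tsupport ψ)

lemma hasCompactSupport_gradient {ψ : E N → ℝ} (hψ : HasCompactSupport ψ) :
    HasCompactSupport (gradient ψ) :=
  hψ.mono' (support_gradient_subset ψ)

lemma integral_inner_right_const {m : Measure (E N)} {f : E N → E N} (hf : Integrable f m)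
    (y : E N) : ∫ x, ⟪f x, y⟫ ∂m = ⟪∫ x, f x ∂m, y⟫ := by
  rw [real_inner_comm, ← integral_inner hf y]
  simp only [real_inner_comm]

lemma IsWeakGradient.congr {u u' : E N → ℝ} {v v' : E N → E N} (h : IsWeakGradient Ω u v)
    (hu : u =ᵐ[μ Ω] u') (hv : v =ᵐ[μ Ω] v') : IsWeakGradient Ω u' v' := by
  intro φ hφ y
  have e1 : ∫ x in Ω, u' x * fderiv ℝ φ x y = ∫ x in Ω, u x * fderiv ℝ φ x y := by
    refine integral_congr_ae ?_
    filter_upwards [hu] with x hx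
    rw [hx]
  have e2 : ∫ x in Ω, φ x * ⟪v' x, y⟫ = ∫ x in Ω, φ x * ⟪v x, y⟫ := by
    refine integral_congr_ae ?_
    filter_upwards [hv] with x hx
    rw [hx]
  rw [e1, e2, h φ hφ y]

lemma setIntegral_eq_of_tsupport_subset {φ f : E N → ℝ} (hφ : tsupport φ ⊆ Ω)
    (hf : ∀ x, x ∉ tsupport φ → f x = 0) : ∫ x in Ω, f x = ∫ x, f x :=
  setIntegral_eq_integral_of_forall_compl_eq_zero fun x hx => hf x fun h => hx (hφ h)

lemma integrable_cc_smul {F : Type*} [NormedAddCommGroup F] [NormedSpace ℝ F]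
    {p : ℝ≥0∞} (hp : 1 ≤ p) {c : E N → ℝ} (hc : Continuous c) (hs : HasCompactSupport c)
    {u : E N → F} (hu : MemLp u p (μ Ω)) : Integrable (fun x => c x • u x) (μ Ω) :=
  (hu.locallyIntegrable hp).integrable_smul_left_of_hasCompactSupport hc hs

lemma integrable_cc_inner_of_locallyIntegrableOn {φ : E N → ℝ} (hφ : IsCcInfty Ω φ)
    {v : E N → E N} (hv : LocallyIntegrableOn v Ω volume) (y : E N) :
    Integrable (fun x => φ x * ⟪v x, y⟫) volume := by
  have hK : IsCompact (tsupport φ) := hφ.hasCompactSupport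
  have h1 : IntegrableOn (fun x => φ x • v x) (tsupport φ) volume :=
    (hv.integrableOn_compact_subset hφ.tsupport_subset hK).continuousOn_smul
      hφ.contDiff.continuous.continuousOn hK
  have h2 : Integrable (fun x => φ x • v x) volume :=
    (integrableOn_iff_integrable_of_support_subset fun x hx => by
      by_contra h
      refine hx ?_
      change φ x • v x = 0
      rw [image_eq_zero_of_notMem_tsupport h, zero_smul]).1 h1
  simpa only [real_inner_smul_left] using h2.inner_const (𝕜 := ℝ) y

lemma locallyIntegrableOn_of_memLp {F : Type*} [NormedAddCommGroup F] {p : ℝ≥0∞}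
    (hp : 1 ≤ p) {v : E N → F} (hv : MemLp v p (μ Ω)) : LocallyIntegrableOn v Ω volume :=
  locallyIntegrableOn_of_locallyIntegrable_restrict (hv.locallyIntegrable hp)

/-- Weak gradients are unique. -/
lemma IsWeakGradient.ae_unique (hΩ : IsOpen Ω) {u : E N → ℝ} {v v' : E N → E N}
    (hv : LocallyIntegrableOn v Ω volume) (hv' : LocallyIntegrableOn v' Ω volume)
    (h : IsWeakGradient Ω u v) (h' : IsWeakGradient Ω u v') : v =ᵐ[μ Ω] v' := by
  have key : ∀ y : E N, ∀ᵐ x ∂(μ Ω), ⟪y, v x - v' x⟫ = 0 := by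
    intro y
    have hloc : LocallyIntegrableOn (fun x => ⟪v x - v' x, y⟫) Ω volume := fun x hx => by
      obtain ⟨s, hs, hi⟩ := (hv.sub hv') x hx
      exact ⟨s, hs, hi.inner_const (𝕜 := ℝ) y⟩
    -- The fundamental lemma of the calculus of variations, applied to one component of v − v' at a
    -- time.
    have := hΩ.ae_eq_zero_of_integral_contDiff_smul_eq_zero hloc fun φ hφ hφc hφΩ => by
      have hcc : IsCcInfty Ω φ := ⟨hφ, hφc, hφΩ⟩
      have i1 := (integrable_cc_inner_of_locallyIntegrableOn hcc hv y).restrict (s := Ω)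
      have i2 := (integrable_cc_inner_of_locallyIntegrableOn hcc hv' y).restrict (s := Ω)
      rw [← setIntegral_eq_of_tsupport_subset hφΩ fun x hx => by
        rw [image_eq_zero_of_notMem_tsupport hx, zero_smul]]
      have : ∀ x, φ x • ⟪v x - v' x, y⟫ = φ x * ⟪v x, y⟫ - φ x * ⟪v' x, y⟫ := fun x => by
        rw [inner_sub_left, smul_eq_mul, mul_sub]
      simp only [this]
      rw [integral_sub i1 i2]
      have e1 := h φ hcc y
      have e2 := h' φ hcc y
      linarith
    rw [ae_restrict_iff' hΩ.measurableSet]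
    filter_upwards [this] with x hx hxΩ
    rw [real_inner_comm]
    exact hx hxΩ
  have := ae_eq_zero_of_forall_inner (𝕜 := ℝ) (f := fun x => v x - v' x) key
  filter_upwards [this] with x hx
  exact sub_eq_zero.1 hx

/-- The classical gradient of a smooth function is a weak gradient. -/
lemma isWeakGradient_of_contDiffOn (hΩ : IsOpen Ω) {w : E N → ℝ} (hw : ContDiffOn ℝ ∞ w Ω) :
    IsWeakGradient Ω w (gradient w) := by
  intro φ hφ y
  have hdiff : ∀ x ∈ Ω, DifferentiableAt ℝ w x := fun x hx =>
    (hw.contDiffAt (hΩ.mem_nhds hx)).differentiableAt (by simp)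
  have hwc : ContinuousOn w (tsupport φ) := hw.continuousOn.mono hφ.tsupport_subset
  have hdc : ContinuousOn (fun x => fderiv ℝ w x y) (tsupport φ) :=
    ((hw.continuousOn_fderiv_of_isOpen hΩ (by simp)).mono hφ.tsupport_subset).clm_apply
      continuousOn_const
  have hφc : Continuous φ := hφ.contDiff.continuous
  have hφd : Continuous (fun x => fderiv ℝ φ x y) :=
    (hφ.contDiff.continuous_fderiv (by simp)).clm_apply continuous_const
  have hφd0 : ∀ x, x ∉ tsupport φ → fderiv ℝ φ x y = 0 := fun x hx => by
    rw [show fderiv ℝ φ x = 0 from Function.notMem_support.1 fun h =>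
      hx (support_fderiv_subset ℝ h)]
    rfl
  have hφ0 : ∀ x, x ∉ tsupport φ → φ x = 0 := fun x hx => image_eq_zero_of_notMem_tsupport hx
  have hK : IsCompact (tsupport φ) := hφ.hasCompactSupport
  have int : ∀ f : E N → ℝ, ContinuousOn f (tsupport φ) → (∀ x, x ∉ tsupport φ → f x = 0) →
      Integrable f volume := fun f hf hf0 =>
    (integrableOn_iff_integrable_of_support_subset fun x hx => by
      by_contra h; exact hx (hf0 x h)).1 (hf.integrableOn_compact hK)
  rw [setIntegral_eq_of_tsupport_subset hφ.tsupport_subset fun x hx => by rw [hφd0 x hx, mul_zero],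
    setIntegral_eq_of_tsupport_subset hφ.tsupport_subset fun x hx => by rw [hφ0 x hx, zero_mul]]
  simp only [inner_gradient_left]
  -- Integration by parts over the whole space: w has to be differentiable only on the support of φ,
  -- so it needs no smooth extension beyond Ω.
  rw [integral_mul_fderiv_eq_neg_fderiv_mul_of_integrable]
  · simp only [mul_comm]
  · exact int _ (hdc.mul hφc.continuousOn) fun x hx => by rw [hφ0 x hx, mul_zero]
  · exact int _ (hwc.mul hφd.continuousOn) fun x hx => by rw [hφd0 x hx, mul_zero]
  · exact int _ (hwc.mul hφc.continuousOn) fun x hx => by rw [hφ0 x hx, mul_zero]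
  · exact fun x hx => hdiff x (hφ.tsupport_subset hx)
  · exact fun x _ => hφ.contDiff.contDiffAt.differentiableAt (by simp)

/-- The product rule, tested against `φ` with `supp φ ∩ supp ψ ⊆ Ω`. -/
lemma IsWeakGradient.integral_mul {p : ℝ≥0∞} (hp : 1 ≤ p) {u : E N → ℝ}
    {v : E N → E N} (hu : MemLp u p (μ Ω)) (hv : MemLp v p (μ Ω)) (h : IsWeakGradient Ω u v)
    {ψ φ : E N → ℝ} (hψ : ContDiff ℝ ∞ ψ) (hφ : ContDiff ℝ ∞ φ) (hφc : HasCompactSupport φ)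
    (hsub : tsupport φ ∩ tsupport ψ ⊆ Ω) (y : E N) :
    ∫ x in Ω, (ψ x * u x) * fderiv ℝ φ x y
      = - ∫ x in Ω, φ x * ⟪ψ x • v x + u x • gradient ψ x, y⟫ := by
  have hprod : IsCcInfty Ω (fun x => φ x * ψ x) :=
    ⟨hφ.mul hψ, hφc.mul_right, (subset_inter (tsupport_mul_subset_left (f := φ) (g := ψ))
      (tsupport_mul_subset_right (f := φ) (g := ψ))).trans hsub⟩
  have hd : ∀ x, fderiv ℝ (fun x => φ x * ψ x) x y
      = φ x * fderiv ℝ ψ x y + ψ x * fderiv ℝ φ x y := fun x => by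
    rw [fderiv_fun_mul (hφ.contDiffAt.differentiableAt (by simp))
      (hψ.contDiffAt.differentiableAt (by simp))]
    simp
  -- The product φψ is itself a test function of Ω; the Leibniz rule for its derivative separates
  -- the two terms of the claim.
  have key := h _ hprod y
  simp only [hd, mul_add] at key
  have hφd : Continuous (fun x => fderiv ℝ φ x y) :=
    (hφ.continuous_fderiv (by simp)).clm_apply continuous_const
  have hψd : Continuous (fun x => fderiv ℝ ψ x y) :=
    (hψ.continuous_fderiv (by simp)).clm_apply continuous_const
  have i1 : Integrable (fun x => u x * (φ x * fderiv ℝ ψ x y)) (μ Ω) := by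
    simpa [mul_comm] using integrable_cc_smul hp (hφ.continuous.mul hψd) hφc.mul_right hu
  have i2 : Integrable (fun x => u x * (ψ x * fderiv ℝ φ x y)) (μ Ω) := by
    simpa [mul_comm] using integrable_cc_smul hp (hψ.continuous.mul hφd)
      (hφc.fderiv_apply ℝ y).mul_left hu
  have i3 : Integrable (fun x => φ x * ψ x * ⟪v x, y⟫) (μ Ω) :=
    integrable_cc_smul hp (hφ.continuous.mul hψ.continuous) hφc.mul_right (hv.inner_const y)
  rw [integral_add i1 i2] at key
  have e1 : ∀ x, (ψ x * u x) * fderiv ℝ φ x y = u x * (ψ x * fderiv ℝ φ x y) := fun x => by ring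
  have e2 : ∀ x, φ x * ⟪ψ x • v x + u x • gradient ψ x, y⟫
      = φ x * ψ x * ⟪v x, y⟫ + u x * (φ x * fderiv ℝ ψ x y) := fun x => by
    rw [inner_add_left, real_inner_smul_left, real_inner_smul_left, inner_gradient_left]
    ring
  simp only [e1, e2]
  rw [integral_add i3 i1]
  linarith

lemma IsWeakGradient.mul_smooth {p : ℝ≥0∞} (hp : 1 ≤ p) {u : E N → ℝ}
    {v : E N → E N} (hu : MemLp u p (μ Ω)) (hv : MemLp v p (μ Ω)) (h : IsWeakGradient Ω u v)
    {ψ : E N → ℝ} (hψ : ContDiff ℝ ∞ ψ) :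
    IsWeakGradient Ω (fun x => ψ x * u x) (fun x => ψ x • v x + u x • gradient ψ x) :=
  fun _ hφ y => h.integral_mul hp hu hv hψ hφ.contDiff hφ.hasCompactSupport
    (inter_subset_left.trans hφ.tsupport_subset) y

/-- The product with a test function of `Ω` has a weak gradient in the whole space. -/
lemma IsWeakGradient.mul_cc {p : ℝ≥0∞} (hp : 1 ≤ p) {u : E N → ℝ}
    {v : E N → E N} (hu : MemLp u p (μ Ω)) (hv : MemLp v p (μ Ω)) (h : IsWeakGradient Ω u v)
    {ψ : E N → ℝ} (hψ : IsCcInfty Ω ψ) :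
    IsWeakGradient univ (fun x => ψ x * u x) (fun x => ψ x • v x + u x • gradient ψ x) := by
  intro φ hφ y
  have := h.integral_mul hp hu hv hψ.contDiff hφ.contDiff hφ.hasCompactSupport
    (inter_subset_right.trans hψ.tsupport_subset) y
  rw [setIntegral_eq_of_tsupport_subset hψ.tsupport_subset fun x hx => by
      rw [image_eq_zero_of_notMem_tsupport hx, zero_mul, zero_mul],
    setIntegral_eq_of_tsupport_subset hψ.tsupport_subset fun x hx => by
      rw [image_eq_zero_of_notMem_tsupport hx, zero_smul, zero_add, Function.notMem_support.1
        fun h => hx (support_gradient_subset ψ h), smul_zero, inner_zero_left, mul_zero]] at this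
  simpa only [Measure.restrict_univ] using this

/-- The gradient of a mollification is the mollification of the weak gradient, at points whose
distance to the complement exceeds the scale. -/
lemma IsWeakGradient.hasGradientAt_moll (hΩ : MeasurableSet Ω) {p : ℝ≥0∞} (hp : 1 ≤ p)
    {u : E N → ℝ} {v : E N → E N} (hu : MemLp u p (μ Ω)) (hv : MemLp v p (μ Ω))
    (h : IsWeakGradient Ω u v) {n : ℕ} {x : E N}
    (hx : closedBall x (1 / ((n : ℝ) + 1)) ⊆ Ω) :
    HasGradientAt (moll n (Ω.indicator u)) (moll n (Ω.indicator v) x) x := by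
  have hul : LocallyIntegrable (Ω.indicator u) volume :=
    ((memLp_indicator_iff_restrict hΩ).2 hu).locallyIntegrable hp
  have hvl : LocallyIntegrable (Ω.indicator v) volume :=
    ((memLp_indicator_iff_restrict hΩ).2 hv).locallyIntegrable hp
  have hd := (hasCompactSupport_kernel n).hasFDerivAt_convolution_left
    (ContinuousLinearMap.lsmul ℝ ℝ) ((contDiff_kernel (N := N) n).of_le (by simp)) hul x
  rw [hasGradientAt_iff_hasFDerivAt]
  refine hd.congr_fderiv ?_
  ext y
  set D := ContinuousLinearMap.precompL (E N)
    (ContinuousLinearMap.lsmul ℝ ℝ : ℝ →L[ℝ] ℝ →L[ℝ] ℝ) with hD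
  have hDy : ∀ (a : E N →L[ℝ] ℝ) (b : ℝ), D a b y = a y * b := fun a b => rfl
  have hex : ConvolutionExistsAt (fderiv ℝ (kernel N n)) (Ω.indicator u) x D volume :=
    ((hasCompactSupport_kernel n).fderiv ℝ).convolutionExists_left D
      ((contDiff_kernel n).continuous_fderiv (by simp)) hul x
  rw [convolution_eq_swap, ContinuousLinearMap.integral_apply hex.integrable_swap]
  simp only [hDy, InnerProductSpace.toDual_apply_apply]
  rw [moll_apply, ← integral_inner_right_const (integrable_kernel_smul n hvl x) y]
  -- The reflected and translated kernel is the test function. Its support is the closed ball about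
  -- x, which lies in Ω by `hx`; the reflection supplies the minus sign that cancels the one in
  -- `IsWeakGradient`.
  set φ : E N → ℝ := fun z => kernel N n (x - z) with hφdef
  have hφ : IsCcInfty Ω φ := by
    refine ⟨(contDiff_kernel n).comp (contDiff_const.sub contDiff_id),
      (hasCompactSupport_kernel n).comp_homeomorph (Homeomorph.subLeft x), ?_⟩
    refine (closure_minimal (fun z hz => ?_) isClosed_closedBall).trans hx
    have : x - z ∈ tsupport (kernel N n) := subset_tsupport _ hz
    rw [tsupport_kernel, mem_closedBall_zero_iff] at this
    rwa [mem_closedBall', dist_eq_norm]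
  have hφd : ∀ z, fderiv ℝ φ z y = - fderiv ℝ (kernel N n) (x - z) y := fun z => by
    have h1 : HasFDerivAt (kernel N n) (fderiv ℝ (kernel N n) (x - z)) (x - z) :=
      ((contDiff_kernel n).contDiffAt.differentiableAt (by simp)).hasFDerivAt
    have h2 : HasFDerivAt (fun z : E N => x - z) (-ContinuousLinearMap.id ℝ (E N)) z :=
      (hasFDerivAt_id z).const_sub x
    have h3 : HasFDerivAt φ _ z := h1.comp z h2
    rw [h3.fderiv]
    simp
  have key := h φ hφ y
  rw [← integral_indicator hΩ, ← integral_indicator hΩ] at key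
  have e1 : ∀ z, fderiv ℝ (kernel N n) (x - z) y * Ω.indicator u z
      = - Ω.indicator (fun z => u z * fderiv ℝ φ z y) z := fun z => by
    by_cases hz : z ∈ Ω
    · rw [indicator_of_mem hz, indicator_of_mem hz, hφd]; ring
    · rw [indicator_of_notMem hz, indicator_of_notMem hz]; simp
  have e2 : ∀ z, ⟪kernel N n (x - z) • Ω.indicator v z, y⟫
      = Ω.indicator (fun z => φ z * ⟪v z, y⟫) z := fun z => by
    by_cases hz : z ∈ Ω
    · rw [indicator_of_mem hz, indicator_of_mem hz, real_inner_smul_left]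
    · rw [indicator_of_notMem hz, indicator_of_notMem hz]; simp
  simp only [e1, e2]
  rw [integral_neg, key, neg_neg]

/-- By Hölder, c acts on L^p as an element of the dual exponent. Both sides of the weak gradient
identity are of this type. -/
lemma continuous_integral_cc_mul {F : Type*} [NormedAddCommGroup F] [NormedSpace ℝ F]
    [CompleteSpace F] {p : ℝ≥0∞} [hp : Fact (1 ≤ p)] {c : E N → ℝ} (hc : Continuous c)
    (hs : HasCompactSupport c) :
    Continuous (fun u : Lp F p (μ Ω) => ∫ x in Ω, c x • u x) := by
  have : ENNReal.HolderConjugate p (ENNReal.conjExponent p) :=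
    ENNReal.HolderConjugate.conjExponent hp.out
  have : ENNReal.HolderConjugate (ENNReal.conjExponent p) p := this.symm
  have : Fact (1 ≤ ENNReal.conjExponent p) :=
    ⟨ENNReal.HolderConjugate.one_le (ENNReal.conjExponent p) p⟩
  have hm : MemLp c (ENNReal.conjExponent p) (μ Ω) := hc.memLp_of_hasCompactSupport hs
  have hcont := ((ContinuousLinearMap.lsmul ℝ ℝ : ℝ →L[ℝ] F →L[ℝ] F).lpPairing
    (μ Ω) (ENNReal.conjExponent p) p (hm.toLp c)).continuous
  convert hcont using 2 with u
  rw [ContinuousLinearMap.lpPairing_eq_integral]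
  refine integral_congr_ae ?_
  filter_upwards [hm.coeFn_toLp] with x hx
  rw [hx]
  rfl

/-- For fixed φ and y the weak gradient identity equates two continuous functionals of the pair, and
W^{1,p} is the intersection of these closed conditions. -/
lemma isClosed_W1p {p : ℝ≥0∞} [Fact (1 ≤ p)] :
    IsClosed (W1p Ω p : Set (LpReal Ω p × LpVec Ω p)) := by
  have : (W1p Ω p : Set (LpReal Ω p × LpVec Ω p)) = ⋂ (φ : E N → ℝ) (_ : IsCcInfty Ω φ) (y : E N),
      {q | ∫ x in Ω, fderiv ℝ φ x y • q.1 x = - ⟪∫ x in Ω, φ x • q.2 x, y⟫} := by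
    ext q
    simp only [mem_iInter, mem_ofPred_eq]
    refine forall_congr' fun φ => forall_congr' fun hφ => forall_congr' fun y => ?_
    have : ⟪∫ x in Ω, φ x • q.2 x, y⟫ = ∫ x in Ω, φ x * ⟪q.2 x, y⟫ := by
      rw [← integral_inner_right_const (integrable_cc_smul Fact.out hφ.contDiff.continuous
        hφ.hasCompactSupport (Lp.memLp q.2))]
      simp only [real_inner_smul_left]
    rw [this]
    simp only [smul_eq_mul, mul_comm]
  rw [this]
  refine isClosed_iInter fun φ => isClosed_iInter fun hφ => isClosed_iInter fun y => ?_
  have c1 := continuous_integral_cc_mul (F := ℝ) (Ω := Ω) (p := p)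
    ((hφ.contDiff.continuous_fderiv (by simp)).clm_apply continuous_const)
    (hφ.hasCompactSupport.fderiv_apply ℝ y)
  have c2 := continuous_integral_cc_mul (F := E N) (Ω := Ω) (p := p)
    hφ.contDiff.continuous hφ.hasCompactSupport
  exact isClosed_eq (c1.comp continuous_fst) ((c2.comp continuous_snd).inner continuous_const).neg

/-- Needed to sum the series of corrections in `W1p.exists_smoothing`. -/
instance {p : ℝ≥0∞} [Fact (1 ≤ p)] : CompleteSpace (W1p Ω p) :=
  isClosed_W1p.completeSpace_coe

end WeakGradient

/-! ### Integrability of products and of functions supported in Ω. -/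

section LpTools

variable {N : ℕ} {Ω : Set (E N)} {p : ℝ≥0∞}

lemma memLp_bdd_smul {F : Type*} [NormedAddCommGroup F] [NormedSpace ℝ F] {m : Measure (E N)}
    {c : E N → ℝ} (hc : Continuous c) (hb : ∃ C, ∀ x, ‖c x‖ ≤ C) {f : E N → F} (hf : MemLp f p m) :
    MemLp (fun x => c x • f x) p m := by
  obtain ⟨C, hC⟩ := hb
  refine hf.of_le_mul (c := C) (hc.aestronglyMeasurable.smul hf.aestronglyMeasurable)
    (Eventually.of_forall fun x => ?_)
  rw [norm_smul]
  exact mul_le_mul_of_nonneg_right (hC x) (norm_nonneg _)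

lemma memLp_smul_bdd {F : Type*} [NormedAddCommGroup F] [NormedSpace ℝ F] {m : Measure (E N)}
    {c : E N → F} (hc : Continuous c) (hb : ∃ C, ∀ x, ‖c x‖ ≤ C) {f : E N → ℝ} (hf : MemLp f p m) :
    MemLp (fun x => f x • c x) p m := by
  obtain ⟨C, hC⟩ := hb
  refine hf.of_le_mul (c := C) (hf.aestronglyMeasurable.smul hc.aestronglyMeasurable)
    (Eventually.of_forall fun x => ?_)
  rw [norm_smul, mul_comm]
  exact mul_le_mul_of_nonneg_right (hC x) (norm_nonneg _)

lemma IsCcInfty.bdd {ψ : E N → ℝ} (hψ : IsCcInfty Ω ψ) : ∃ C, ∀ x, ‖ψ x‖ ≤ C :=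
  hψ.hasCompactSupport.exists_bound_of_continuous hψ.contDiff.continuous

lemma IsCcInfty.bdd_gradient {ψ : E N → ℝ} (hψ : IsCcInfty Ω ψ) : ∃ C, ∀ x, ‖gradient ψ x‖ ≤ C :=
  (hasCompactSupport_gradient hψ.hasCompactSupport).exists_bound_of_continuous
    (continuous_gradient hψ.contDiff)

lemma IsCcInfty.mono {U : Set (E N)} {ψ : E N → ℝ} (hψ : IsCcInfty U ψ) (h : U ⊆ Ω) :
    IsCcInfty Ω ψ :=
  ⟨hψ.contDiff, hψ.hasCompactSupport, hψ.tsupport_subset.trans h⟩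

lemma IsCcInfty.memLp {ψ : E N → ℝ} (hψ : IsCcInfty Ω ψ) {m : Measure (E N)}
    [IsFiniteMeasureOnCompacts m] : MemLp ψ p m :=
  hψ.contDiff.continuous.memLp_of_hasCompactSupport hψ.hasCompactSupport

lemma IsCcInfty.memLp_gradient {ψ : E N → ℝ} (hψ : IsCcInfty Ω ψ) {m : Measure (E N)}
    [IsFiniteMeasureOnCompacts m] : MemLp (gradient ψ) p m :=
  (continuous_gradient hψ.contDiff).memLp_of_hasCompactSupport
    (hasCompactSupport_gradient hψ.hasCompactSupport)

lemma tsupport_mul_fn_subset (ψ u : E N → ℝ) : tsupport (fun x => ψ x * u x) ⊆ tsupport ψ :=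
  tsupport_mul_subset_left (f := ψ) (g := u)

lemma memLp_volume_of_support_subset {F : Type*} [NormedAddCommGroup F] (hΩ : MeasurableSet Ω)
    {f : E N → F} (hf : MemLp f p (μ Ω)) (hs : ∀ x, x ∉ Ω → f x = 0) : MemLp f p volume := by
  have : Ω.indicator f = f := indicator_eq_self.2 fun x hx => by
    by_contra h; exact hx (hs x h)
  rw [← this, memLp_indicator_iff_restrict hΩ]
  exact hf

lemma tendsto_eLpNorm_restrict {F : Type*} [NormedAddCommGroup F] {m : Measure (E N)}
    {f : ℕ → E N → F} (h : Tendsto (fun n => eLpNorm (f n) p m) atTop (𝓝 0)) :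
    Tendsto (fun n => eLpNorm (f n) p (m.restrict Ω)) atTop (𝓝 0) :=
  tendsto_of_tendsto_of_tendsto_of_le_of_le tendsto_const_nhds h (fun _ => zero_le)
    fun _ => eLpNorm_mono_measure _ Measure.restrict_le_self

end LpTools

/-! ### The space W^{1,p}: elements, convergence, products with test functions. -/

section Sobolev

variable {N : ℕ} {Ω : Set (E N)} {p : ℝ≥0∞} [Fact (1 ≤ p)]

/-- The function underlying an element of `W^{1,p}(Ω)`. -/
abbrev W1p.fn (q : W1p Ω p) : E N → ℝ := q.1.1

/-- The weak gradient of an element of `W^{1,p}(Ω)`. -/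
abbrev W1p.grad (q : W1p Ω p) : E N → E N := q.1.2

lemma W1p.isWeakGradient (q : W1p Ω p) : IsWeakGradient Ω (W1p.fn q) (W1p.grad q) := q.2

lemma W1p.memLp_fn (q : W1p Ω p) : MemLp (W1p.fn q) p (μ Ω) := Lp.memLp q.1.1

lemma W1p.memLp_grad (q : W1p Ω p) : MemLp (W1p.grad q) p (μ Ω) := Lp.memLp q.1.2

/-- The element of `W^{1,p}(Ω)` given by a function and its weak gradient. -/
def W1p.mk {u : E N → ℝ} {v : E N → E N} (hu : MemLp u p (μ Ω)) (hv : MemLp v p (μ Ω))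
    (h : IsWeakGradient Ω u v) : W1p Ω p :=
  ⟨(hu.toLp u, hv.toLp v), h.congr hu.coeFn_toLp.symm hv.coeFn_toLp.symm⟩

lemma W1p.fn_mk {u : E N → ℝ} {v : E N → E N} (hu : MemLp u p (μ Ω)) (hv : MemLp v p (μ Ω))
    (h : IsWeakGradient Ω u v) : (W1p.fn (W1p.mk hu hv h)) =ᵐ[μ Ω] u := hu.coeFn_toLp

lemma W1p.grad_mk {u : E N → ℝ} {v : E N → E N} (hu : MemLp u p (μ Ω)) (hv : MemLp v p (μ Ω))
    (h : IsWeakGradient Ω u v) : (W1p.grad (W1p.mk hu hv h)) =ᵐ[μ Ω] v := hv.coeFn_toLp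

lemma W1p.ext {q q' : W1p Ω p} (h1 : W1p.fn q =ᵐ[μ Ω] W1p.fn q')
    (h2 : W1p.grad q =ᵐ[μ Ω] W1p.grad q') :
    q = q' :=
  Subtype.ext (Prod.ext (Lp.ext h1) (Lp.ext h2))

lemma W1p.ext_of_fn (hΩ : IsOpen Ω) {q q' : W1p Ω p} (h1 : W1p.fn q =ᵐ[μ Ω] W1p.fn q') : q = q' :=
  W1p.ext h1 <| IsWeakGradient.ae_unique hΩ
    (locallyIntegrableOn_of_memLp Fact.out (W1p.memLp_grad q))
    (locallyIntegrableOn_of_memLp Fact.out (W1p.memLp_grad q')) (W1p.isWeakGradient q)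
    ((W1p.isWeakGradient q').congr h1.symm EventuallyEq.rfl)

lemma W1p.tendsto_iff {ι : Type*} {l : Filter ι} {Q : ι → W1p Ω p} {q : W1p Ω p} :
    Tendsto Q l (𝓝 q) ↔ Tendsto (fun i => eLpNorm (W1p.fn (Q i) - W1p.fn q) p (μ Ω)) l (𝓝 0) ∧
      Tendsto (fun i => eLpNorm (W1p.grad (Q i) - W1p.grad q) p (μ Ω)) l (𝓝 0) := by
  rw [tendsto_subtype_rng, Prod.tendsto_iff, Lp.tendsto_Lp_iff_tendsto_eLpNorm',
    Lp.tendsto_Lp_iff_tendsto_eLpNorm']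

lemma W1p.tendsto_of_eLpNorm {ι : Type*} {l : Filter ι} {Q : ι → W1p Ω p} {q : W1p Ω p}
    {u : ι → E N → ℝ} {v : ι → E N → E N} {u₀ : E N → ℝ} {v₀ : E N → E N}
    (hu : ∀ i, (W1p.fn (Q i)) =ᵐ[μ Ω] u i) (hv : ∀ i, (W1p.grad (Q i)) =ᵐ[μ Ω] v i)
    (hu₀ : W1p.fn q =ᵐ[μ Ω] u₀) (hv₀ : W1p.grad q =ᵐ[μ Ω] v₀)
    (h1 : Tendsto (fun i => eLpNorm (u i - u₀) p (μ Ω)) l (𝓝 0))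
    (h2 : Tendsto (fun i => eLpNorm (v i - v₀) p (μ Ω)) l (𝓝 0)) :
    Tendsto Q l (𝓝 q) := by
  rw [W1p.tendsto_iff]
  exact ⟨h1.congr fun i => eLpNorm_congr_ae ((hu i).symm.sub hu₀.symm),
    h2.congr fun i => eLpNorm_congr_ae ((hv i).symm.sub hv₀.symm)⟩

/-- The product of an element of `W^{1,p}(Ω)` with a smooth function that is bounded together with
its gradient. -/
def W1p.mul (q : W1p Ω p) (ψ : E N → ℝ) (hψ : ContDiff ℝ ∞ ψ) (hb : ∃ C, ∀ x, ‖ψ x‖ ≤ C)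
    (hb' : ∃ C, ∀ x, ‖gradient ψ x‖ ≤ C) : W1p Ω p :=
  W1p.mk (u := fun x => ψ x * W1p.fn q x)
    (v := fun x => ψ x • W1p.grad q x + W1p.fn q x • gradient ψ x)
    (memLp_bdd_smul hψ.continuous hb (W1p.memLp_fn q))
    ((memLp_bdd_smul hψ.continuous hb (W1p.memLp_grad q)).add
      (memLp_smul_bdd (continuous_gradient hψ) hb' (W1p.memLp_fn q)))
    ((W1p.isWeakGradient q).mul_smooth Fact.out (W1p.memLp_fn q) (W1p.memLp_grad q) hψ)

variable (p) in
/-- Test functions as elements of `W^{1,p}(Ω)`. -/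
def W1p.ofCc (hΩ : IsOpen Ω) {ψ : E N → ℝ} (hψ : IsCcInfty Ω ψ) : W1p Ω p :=
  W1p.mk (u := ψ) (v := gradient ψ) hψ.memLp hψ.memLp_gradient
    (isWeakGradient_of_contDiffOn hΩ hψ.contDiff.contDiffOn)

lemma W1p.fn_ofCc (hΩ : IsOpen Ω) {ψ : E N → ℝ} (hψ : IsCcInfty Ω ψ) :
    W1p.fn (W1p.ofCc p hΩ hψ) =ᵐ[μ Ω] ψ :=
  W1p.fn_mk _ _ _

lemma W1p.grad_ofCc (hΩ : IsOpen Ω) {ψ : E N → ℝ} (hψ : IsCcInfty Ω ψ) :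
    W1p.grad (W1p.ofCc p hΩ hψ) =ᵐ[μ Ω] gradient ψ :=
  W1p.grad_mk _ _ _

/-- A compact subset of the open set Ω cannot meet the boundary, so test functions are admissible
whatever Γ is. -/
lemma W1p.ofCc_mem_smoothOff (hΩ : IsOpen Ω) {Γ : Set (E N)} (hΓ : Γ ⊆ frontier Ω) {ψ : E N → ℝ}
    (hψ : IsCcInfty Ω ψ) : W1p.ofCc p hΩ hψ ∈ smoothOff Ω Γ p := by
  refine ⟨ψ, hψ.contDiff.contDiffOn, ?_, W1p.fn_mk _ _ _⟩
  rw [← subset_empty_iff]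
  rintro x ⟨hx, hxΓ⟩
  have h1 : x ∈ Ω := hψ.tsupport_subset (closure_mono (fun z hz => hz.2) hx)
  have h2 := hΓ hxΓ
  rw [frontier, hΩ.interior_eq] at h2
  exact h2.2 h1

/-- The product of an element of `W^{1,p}(Ω)` with a test function. -/
def W1p.mulCc (q : W1p Ω p) {ψ : E N → ℝ} (hψ : IsCcInfty Ω ψ) : W1p Ω p :=
  (W1p.mul q) ψ hψ.contDiff hψ.bdd hψ.bdd_gradient

/-- The weak gradient of `ψ u`. -/
def W1p.prodGrad (q : W1p Ω p) (ψ : E N → ℝ) : E N → E N :=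
  fun x => ψ x • W1p.grad q x + W1p.fn q x • gradient ψ x

variable {U : Set (E N)}

lemma W1p.fn_mul (q : W1p Ω p) {ψ : E N → ℝ} (hψ : ContDiff ℝ ∞ ψ) (hb : ∃ C, ∀ x, ‖ψ x‖ ≤ C)
    (hb' : ∃ C, ∀ x, ‖gradient ψ x‖ ≤ C) :
    W1p.fn (W1p.mul q ψ hψ hb hb') =ᵐ[μ Ω] fun x => ψ x * W1p.fn q x :=
  W1p.fn_mk _ _ _

lemma W1p.grad_mul (q : W1p Ω p) {ψ : E N → ℝ} (hψ : ContDiff ℝ ∞ ψ) (hb : ∃ C, ∀ x, ‖ψ x‖ ≤ C)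
    (hb' : ∃ C, ∀ x, ‖gradient ψ x‖ ≤ C) :
    W1p.grad (W1p.mul q ψ hψ hb hb') =ᵐ[μ Ω] W1p.prodGrad q ψ :=
  W1p.grad_mk _ _ _

lemma W1p.fn_mulCc (q : W1p Ω p) {ψ : E N → ℝ} (hψ : IsCcInfty Ω ψ) :
    W1p.fn (W1p.mulCc q hψ) =ᵐ[μ Ω] fun x => ψ x * W1p.fn q x :=
  W1p.fn_mul q _ _ _

lemma W1p.grad_mulCc (q : W1p Ω p) {ψ : E N → ℝ} (hψ : IsCcInfty Ω ψ) :
    W1p.grad (W1p.mulCc q hψ) =ᵐ[μ Ω] W1p.prodGrad q ψ :=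
  W1p.grad_mul q _ _ _

lemma W1p.memLp_mulCc (q : W1p Ω p) (hΩ : IsOpen Ω) {ψ : E N → ℝ} (hψ : IsCcInfty Ω ψ) :
    MemLp (fun x => ψ x * W1p.fn q x) p volume :=
  memLp_volume_of_support_subset hΩ.measurableSet
    (memLp_bdd_smul hψ.contDiff.continuous hψ.bdd (W1p.memLp_fn q)) fun x hx => by
      rw [image_eq_zero_of_notMem_tsupport fun h => hx (hψ.tsupport_subset h), zero_mul]

lemma W1p.memLp_prodGrad (q : W1p Ω p) (hΩ : IsOpen Ω) {ψ : E N → ℝ} (hψ : IsCcInfty Ω ψ) :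
    MemLp ((W1p.prodGrad q) ψ) p volume :=
  memLp_volume_of_support_subset hΩ.measurableSet
    ((memLp_bdd_smul hψ.contDiff.continuous hψ.bdd (W1p.memLp_grad q)).add
      (memLp_smul_bdd (continuous_gradient hψ.contDiff) hψ.bdd_gradient (W1p.memLp_fn q)))
    fun x hx => by
      change ψ x • W1p.grad q x + W1p.fn q x • gradient ψ x = 0
      rw [image_eq_zero_of_notMem_tsupport fun h => hx (hψ.tsupport_subset h), zero_smul, zero_add,
        Function.notMem_support.1 fun h => hx (hψ.tsupport_subset (support_gradient_subset ψ h)),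
        smul_zero]

/-- Extended by zero, ψq is a Sobolev function on the whole space, so no condition on the distance
to the boundary of Ω is left. -/
lemma W1p.gradient_moll (q : W1p Ω p) (hΩ : IsOpen Ω) {ψ : E N → ℝ} (hψ : IsCcInfty Ω ψ) (n : ℕ) :
    gradient (moll n fun x => ψ x * W1p.fn q x) = moll n ((W1p.prodGrad q) ψ) := by
  funext x
  have h := (W1p.isWeakGradient q).mul_cc Fact.out (W1p.memLp_fn q) (W1p.memLp_grad q) hψ
  have := h.hasGradientAt_moll (n := n) (x := x) (p := p) MeasurableSet.univ Fact.out
    (by rw [μ, Measure.restrict_univ]; exact (W1p.memLp_mulCc q) hΩ hψ)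
    (by rw [μ, Measure.restrict_univ]; exact (W1p.memLp_prodGrad q) hΩ hψ) (subset_univ _)
  simp only [indicator_univ] at this
  exact this.gradient

lemma W1p.eventually_isCcInfty (q : W1p Ω p) (hΩ : IsOpen Ω) (hU : IsOpen U) (hUΩ : U ⊆ Ω)
    {ψ : E N → ℝ} (hψ : IsCcInfty U ψ) :
    ∀ᶠ n : ℕ in atTop, IsCcInfty U (moll n fun x => ψ x * W1p.fn q x) :=
  eventually_isCcInfty_moll hψ.hasCompactSupport.mul_right
    (((W1p.memLp_mulCc q) hΩ (hψ.mono hUΩ)).locallyIntegrable Fact.out) hU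
    ((tsupport_mul_fn_subset _ _).trans hψ.tsupport_subset)

/-- Localized elements are approximated by their mollifications. -/
lemma W1p.exists_moll_approx (q : W1p Ω p) (hp : p ≠ ⊤) (hΩ : IsOpen Ω) (hU : IsOpen U)
    (hUΩ : U ⊆ Ω) {ψ : E N → ℝ} (hψ : IsCcInfty U ψ) {ε : ℝ} (hε : 0 < ε) :
    ∀ᶠ n : ℕ in atTop, ∃ h : IsCcInfty U (moll n fun x => ψ x * W1p.fn q x),
      ‖W1p.ofCc p hΩ (h.mono hUΩ) - (W1p.mulCc q) (hψ.mono hUΩ)‖ < ε := by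
  have hψΩ := hψ.mono hUΩ
  have hev := (W1p.eventually_isCcInfty q) hΩ hU hUΩ hψ
  obtain ⟨n₀, hn₀⟩ := eventually_atTop.1 hev
  have h1 := tendsto_eLpNorm_restrict (Ω := Ω)
    (tendsto_eLpNorm_moll_sub Fact.out hp ((W1p.memLp_mulCc q) hΩ hψΩ))
  have h2 := tendsto_eLpNorm_restrict (Ω := Ω)
    (tendsto_eLpNorm_moll_sub Fact.out hp ((W1p.memLp_prodGrad q) hΩ hψΩ))
  -- The indices are shifted by n₀ because `W1p.ofCc` requires the support condition for every term
  -- of the sequence.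
  have ht : Tendsto (fun n => W1p.ofCc p hΩ ((hn₀ (n + n₀) (Nat.le_add_left _ _)).mono hUΩ)) atTop
      (𝓝 ((W1p.mulCc q) hψΩ)) := by
    refine W1p.tendsto_of_eLpNorm (fun n => W1p.fn_ofCc hΩ _) (fun n => W1p.grad_ofCc hΩ _)
      (W1p.fn_mulCc q hψΩ) (W1p.grad_mulCc q hψΩ) (h1.comp (tendsto_add_atTop_nat n₀)) ?_
    refine (h2.comp (tendsto_add_atTop_nat n₀)).congr fun n => ?_
    rw [Function.comp, (W1p.gradient_moll q) hΩ hψΩ]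
  obtain ⟨n₁, hn₁⟩ := eventually_atTop.1 (Metric.tendsto_nhds.1 ht ε hε)
  filter_upwards [eventually_ge_atTop (n₁ + n₀)] with n hn
  obtain ⟨k, rfl⟩ : ∃ k, n = k + n₀ := ⟨n - n₀, by omega⟩
  refine ⟨hn₀ _ (Nat.le_add_left _ _), ?_⟩
  rw [← dist_eq_norm]
  exact hn₁ k (by omega)

/-- Mollifications of ψq are test functions of Ω. Hence q itself need not lie in W^{1,p}_Γ. -/
lemma W1p.mulCc_mem_closure (q : W1p Ω p) (hp : p ≠ ⊤) (hΩ : IsOpen Ω) {Γ : Set (E N)}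
    (hΓ : Γ ⊆ frontier Ω) {ψ : E N → ℝ} (hψ : IsCcInfty Ω ψ) :
    (W1p.mulCc q) hψ ∈ W1pOff Ω Γ p := by
  change _ ∈ closure (smoothOff Ω Γ p : Set (W1p Ω p))
  rw [Metric.mem_closure_iff]
  intro ε hε
  obtain ⟨n, h, hn⟩ := ((W1p.exists_moll_approx q) hp hΩ hΩ subset_rfl hψ hε).exists
  refine ⟨_, W1p.ofCc_mem_smoothOff hΩ hΓ h, ?_⟩
  rwa [dist_comm, dist_eq_norm]

lemma W1p.ofCc_mem_W1pOff (hΩ : IsOpen Ω) {Γ : Set (E N)} (hΓ : Γ ⊆ frontier Ω) {ψ : E N → ℝ}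
    (hψ : IsCcInfty Ω ψ) : W1p.ofCc p hΩ hψ ∈ W1pOff Ω Γ p :=
  (smoothOff Ω Γ p).le_topologicalClosure (W1p.ofCc_mem_smoothOff hΩ hΓ hψ)

end Sobolev

/-! ### Partitions of unity subordinate to a compact exhaustion. -/

section Partition

variable {N : ℕ} {U : Set (E N)}

/-- `ψ` is a smooth partition of unity on `U`, subordinate to an exhaustion `K` of `U` by compact
sets. -/
structure IsPartition (U : Set (E N)) (K : ℕ → Set (E N)) (ψ : ℕ → E N → ℝ) : Prop where
  isClosed : ∀ n, IsClosed (K n)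
  subset_interior : ∀ n, K n ⊆ interior (K (n + 1))
  iUnion_eq : ⋃ n, K n = U
  -- Avoiding K (n − 1) is what makes the family locally finite. For n = 0 the truncated subtraction
  -- gives K 0, which `exists_isPartition` takes to be empty.
  isCcInfty : ∀ n, IsCcInfty (U \ K (n - 1)) (ψ n)
  isCcInfty_sum : ∀ n, IsCcInfty U (fun x => ∑ j ∈ Finset.range n, ψ j x)
  nonneg : ∀ n x, 0 ≤ ψ n x
  sum_le_one : ∀ n x, ∑ j ∈ Finset.range n, ψ j x ≤ 1
  sum_eq_one : ∀ n, ∀ x ∈ K n, ∀ᶠ y in 𝓝 x, ∑ j ∈ Finset.range n, ψ j y = 1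

lemma exists_compact_exhaustion (hU : IsOpen U) : ∃ K : ℕ → Set (E N), (∀ n, IsCompact (K n)) ∧
    (∀ n, K n ⊆ interior (K (n + 1))) ∧ ⋃ n, K n = U ∧ K 0 = ∅ := by
  -- The radius n − 1 is negative for n = 0, which makes K 0 empty. The extended distance to the
  -- complement is infinite when U is the whole space, so that case needs no separate treatment.
  refine ⟨fun n => closedBall 0 ((n : ℝ) - 1) ∩ {x | ((n : ℝ≥0∞))⁻¹ ≤ infEDist x Uᶜ}, fun n => ?_,
    fun n => ?_, ?_, ?_⟩
  · exact (isCompact_closedBall _ _).inter_right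
      (isClosed_le continuous_const continuous_infEDist)
  · refine (subset_inter ?_ ?_ : _ ⊆ ball (0 : E N) n ∩
      {x | ((n + 1 : ℕ) : ℝ≥0∞)⁻¹ < infEDist x Uᶜ}).trans (interior_maximal ?_ ?_)
    · exact inter_subset_left.trans (closedBall_subset_ball (by linarith))
    · rintro x ⟨-, hx⟩
      rw [mem_ofPred_eq] at hx ⊢
      refine lt_of_lt_of_le ?_ hx
      rw [ENNReal.inv_lt_inv]
      exact_mod_cast Nat.lt_succ_self n
    · refine inter_subset_inter (ball_subset_closedBall.trans (closedBall_subset_closedBall ?_))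
        fun x hx => ?_
      · push_cast
        linarith
      · rw [mem_ofPred_eq] at hx ⊢
        exact hx.le
    · exact isOpen_ball.inter (isOpen_lt continuous_const continuous_infEDist)
  · refine subset_antisymm (iUnion_subset fun n x hx => ?_) fun x hx => ?_
    · by_contra hxU
      have h0 : infEDist x Uᶜ = 0 := infEDist_zero_of_mem hxU
      have h1 := hx.2
      rw [mem_ofPred_eq, h0, nonpos_iff_eq_zero, ENNReal.inv_eq_zero] at h1
      exact ENNReal.natCast_ne_top n h1
    · have hpos : infEDist x Uᶜ ≠ 0 := fun h0 => by
        have := mem_closure_iff_infEDist_zero.2 h0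
        rw [hU.isClosed_compl.closure_eq] at this
        exact this hx
      obtain ⟨n, hn⟩ := ENNReal.exists_inv_nat_lt hpos
      obtain ⟨m, hm⟩ := exists_nat_ge (‖x‖ + 1)
      refine mem_iUnion.2 ⟨max n m, ?_, ?_⟩
      · rw [mem_closedBall_zero_iff]
        have : (m : ℝ) ≤ (max n m : ℕ) := by exact_mod_cast le_max_right n m
        linarith
      · refine le_trans ?_ hn.le
        rw [ENNReal.inv_le_inv]
        exact_mod_cast le_max_left n m
  · simp

/-- Take cutoffs χ n equal to one near K n and supported in K (n + 1), and set ψ n = χ (n + 1) − χ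
n. Partial sums telescope to χ n because χ 0 = 0, which is allowed since K 0 is empty. The
differences are nonnegative: χ (n + 1) = 1 on K (n + 1), and χ n = 0 elsewhere. -/
lemma exists_isPartition (hU : IsOpen U) :
    ∃ (K : ℕ → Set (E N)) (ψ : ℕ → E N → ℝ), IsPartition U K ψ := by
  obtain ⟨K, hKc, hKi, hKU, hK0⟩ := exists_compact_exhaustion hU
  have hKsucc : ∀ n, K n ⊆ K (n + 1) := fun n => (hKi n).trans interior_subset
  have hKsub : ∀ n, K n ⊆ U := fun n => hKU ▸ subset_iUnion K n
  have hex : ∀ n, ∃ f : E N → ℝ, ContDiff ℝ ∞ f ∧ (∀ x ∈ K n, ∀ᶠ y in 𝓝 x, f y = 1) ∧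
      (∀ x ∉ K (n + 1), f x = 0) ∧ (∀ x, f x ∈ Icc (0 : ℝ) 1) ∧ (n = 0 → ∀ x, f x = 0) := by
    intro n
    rcases Nat.eq_zero_or_pos n with rfl | hn
    · exact ⟨fun _ => 0, contDiff_const, by simp [hK0], fun _ _ => rfl, by simp, fun _ _ => rfl⟩
    · obtain ⟨f, h1, h2, h3⟩ := exists_contMDiffMap_one_nhds_of_subset_interior 𝓘(ℝ, E N)
        (n := ⊤) (hKc n).isClosed (hKi n)
      exact ⟨f, f.contMDiff.contDiff, eventually_nhdsSet_iff_forall.1 h1, h2, h3,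
        fun h => absurd h hn.ne'⟩
  choose χ hχs hχ1 hχ0 hχr hχz using hex
  have hχt : ∀ n, tsupport (χ n) ⊆ K (n + 1) := fun n =>
    closure_minimal (fun x hx => by
      by_contra h
      exact hx (hχ0 n x h)) (hKc _).isClosed
  have hχcc : ∀ n, IsCcInfty U (χ n) := fun n =>
    ⟨hχs n, (hKc (n + 1)).of_isClosed_subset (isClosed_tsupport _) (hχt n),
      (hχt n).trans (hKsub _)⟩
  have hsum : ∀ n x, ∑ j ∈ Finset.range n, (χ (j + 1) x - χ j x) = χ n x := fun n x => by
    rw [Finset.sum_range_sub (fun j => χ j x) n, hχz 0 rfl x, sub_zero]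
  refine ⟨K, fun n x => χ (n + 1) x - χ n x, fun n => (hKc n).isClosed, hKi, hKU, fun n => ?_,
    fun n => ?_, fun n x => ?_, fun n x => ?_, fun n x hx => ?_⟩
  · have hsub : tsupport (fun x => χ (n + 1) x - χ n x) ⊆ tsupport (χ (n + 1)) ∪ tsupport (χ n) :=
      tsupport_sub (χ (n + 1)) (χ n)
    refine ⟨(hχs _).sub (hχs _), ?_, fun x hx => ⟨?_, fun hxK => ?_⟩⟩
    · exact ((hχcc (n + 1)).hasCompactSupport.isCompact.union
        (hχcc n).hasCompactSupport.isCompact).of_isClosed_subset (isClosed_tsupport _) hsub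
    · exact (hsub hx).elim (fun h => (hχcc _).tsupport_subset h)
        (fun h => (hχcc _).tsupport_subset h)
    -- Near a point of K (n − 1) both cutoffs equal one, so their difference vanishes on a
    -- neighbourhood; for n = 0 there is no such point.
    · have hxi : x ∈ interior (K n) := by
        rcases Nat.eq_zero_or_pos n with rfl | hn
        · rw [Nat.zero_sub, hK0] at hxK
          exact hxK.elim
        · have := hKi (n - 1) hxK
          rwa [Nat.sub_add_cancel hn] at this
      refine notMem_tsupport_iff_eventuallyEq.2 ?_ hx
      filter_upwards [hχ1 (n + 1) x (hKsucc n (interior_subset hxi)),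
        hχ1 n x (interior_subset hxi)] with y h1 h2
      simp [h1, h2]
  · simp only [hsum]
    exact hχcc n
  · by_cases hx : x ∈ K (n + 1)
    · have h1 : χ (n + 1) x = 1 := (hχ1 (n + 1) x hx).self_of_nhds
      have h2 := (hχr n x).2
      change 0 ≤ χ (n + 1) x - χ n x
      linarith
    · rw [hχ0 n x hx, sub_zero]
      exact (hχr _ x).1
  · simp only [hsum]
    exact (hχr n x).2
  · simp only [hsum]
    exact hχ1 n x hx

variable {K : ℕ → Set (E N)} {ψ : ℕ → E N → ℝ}

lemma IsPartition.monotone (P : IsPartition U K ψ) : Monotone K :=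
  monotone_nat_of_le_succ fun n => (P.subset_interior n).trans interior_subset

lemma IsPartition.isCcInfty' (P : IsPartition U K ψ) (n : ℕ) : IsCcInfty U (ψ n) :=
  (P.isCcInfty n).mono sdiff_subset

lemma gradient_eq_zero_of_notMem {ψ : E N → ℝ} {x : E N} (h : x ∉ tsupport ψ) :
    gradient ψ x = 0 :=
  Function.notMem_support.1 fun h' => h (support_gradient_subset ψ h')

lemma gradient_finset_sum {ι : Type*} (s : Finset ι) {f : ι → E N → ℝ}
    (hf : ∀ i ∈ s, ContDiff ℝ ∞ (f i)) (x : E N) :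
    gradient (fun y => ∑ i ∈ s, f i y) x = ∑ i ∈ s, gradient (f i) x := by
  simp only [gradient]
  rw [fderiv_fun_sum fun i hi => (hf i hi).contDiffAt.differentiableAt (by simp), map_sum]

/-- The partial sum is constant near x; this is why `sum_eq_one` holds on a neighbourhood and not
merely at the point. -/
lemma IsPartition.sum_gradient (P : IsPartition U K ψ) {n : ℕ} {x : E N} (hx : x ∈ K n) :
    ∑ j ∈ Finset.range n, gradient (ψ j) x = 0 := by
  rw [← gradient_finset_sum _ fun i _ => (P.isCcInfty i).contDiff,
    Filter.EventuallyEq.gradient_eq (P.sum_eq_one n x hx)]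
  simp [gradient]

/-- Local finiteness. The function f is arbitrary so that this covers the mollified pieces as well
as the ψ j. -/
lemma IsPartition.notMem_tsupport (P : IsPartition U K ψ) {n j : ℕ} (hj : n + 1 ≤ j) {x : E N}
    (hx : x ∈ K n) {f : E N → ℝ} (hf : IsCcInfty (U \ K (j - 1)) f) : x ∉ tsupport f := fun h =>
  (hf.tsupport_subset h).2 (P.monotone (by omega) hx)

lemma IsPartition.exists_mem (P : IsPartition U K ψ) {x : E N} (hx : x ∈ U) : ∃ n, x ∈ K n := by
  rw [← P.iUnion_eq] at hx
  exact mem_iUnion.1 hx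

/-- The sum of a sequence of test functions adapted to a partition is smooth. -/
lemma IsPartition.contDiffOn_tsum (P : IsPartition U K ψ) {F : ℕ → E N → ℝ}
    (hF : ∀ j, IsCcInfty (U \ K (j - 1)) (F j)) : ContDiffOn ℝ ∞ (fun x => ∑' j, F j x) U := by
  intro x hx
  obtain ⟨n, hn⟩ := P.exists_mem hx
  refine ContDiffAt.contDiffWithinAt ?_
  -- The neighbourhood of x is only known to lie in K (n + 1), one step beyond K n; hence n + 2
  -- terms.
  have hev : (fun x => ∑' j, F j x) =ᶠ[𝓝 x] fun x => ∑ j ∈ Finset.range (n + 2), F j x := by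
    filter_upwards [mem_interior_iff_mem_nhds.1 (P.subset_interior n hn)] with y hy
    refine tsum_eq_sum fun j hj => ?_
    rw [Finset.mem_range, not_lt] at hj
    exact image_eq_zero_of_notMem_tsupport (P.notMem_tsupport hj hy (hF j))
  exact (ContDiff.sum fun j _ => (hF j).contDiff).contDiffAt.congr_of_eventuallyEq hev

end Partition

/-! ### Meyers–Serrin smoothing inside an open subset. -/

section Smoothing

variable {N : ℕ} {Ω U : Set (E N)} {p : ℝ≥0∞} [Fact (1 ≤ p)] {K : ℕ → Set (E N)}
  {ψ : ℕ → E N → ℝ}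

/-- Absolute convergence of the norms gives a.e. convergence of the full series, with no passage to
a subsequence, so the sum can be computed pointwise. -/
lemma W1p.ae_hasSum {e : ℕ → W1p Ω p} (he : Summable fun j => ‖e j‖) :
    ∀ᵐ x ∂(μ Ω), HasSum (fun j => W1p.fn (e j) x) (W1p.fn (∑' j, e j) x) ∧
      HasSum (fun j => W1p.grad (e j) x) (W1p.grad (∑' j, e j) x) := by
  have hs : HasSum (fun j => ((e j : W1p Ω p) : LpReal Ω p × LpVec Ω p))
      ((∑' j, e j : W1p Ω p) : LpReal Ω p × LpVec Ω p) :=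
    he.of_norm.hasSum.map (W1p Ω p).subtype continuous_subtype_val
  have h1 := hs.map (AddMonoidHom.fst (LpReal Ω p) (LpVec Ω p)) continuous_fst
  have h2 := hs.map (AddMonoidHom.snd (LpReal Ω p) (LpVec Ω p)) continuous_snd
  have n1 : ∑' j, ‖(e j).1.1‖ₑ ≠ ⊤ := tsum_enorm_ne_top_iff_summable_norm.2 <|
    he.of_nonneg_of_le (fun _ => norm_nonneg _) fun j => norm_fst_le (e j).1
  have n2 : ∑' j, ‖(e j).1.2‖ₑ ≠ ⊤ := tsum_enorm_ne_top_iff_summable_norm.2 <|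
    he.of_nonneg_of_le (fun _ => norm_nonneg _) fun j => norm_snd_le (e j).1
  filter_upwards [Lp.hasSum_coeFn_tsum n1, Lp.hasSum_coeFn_tsum n2] with x hx1 hx2
  have e1 : ∑' j, (e j).1.1 = (∑' j, e j : W1p Ω p).1.1 := h1.tsum_eq
  have e2 : ∑' j, (e j).1.2 = (∑' j, e j : W1p Ω p).1.2 := h2.tsum_eq
  rw [e1] at hx1
  rw [e2] at hx2
  exact ⟨hx1, hx2⟩

lemma W1p.fn_sub (q q' : W1p Ω p) :
    W1p.fn (q - q') =ᵐ[μ Ω] fun x => W1p.fn q x - W1p.fn q' x :=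
  Lp.coeFn_sub q.1.1 q'.1.1

lemma W1p.grad_sub (q q' : W1p Ω p) :
    W1p.grad (q - q') =ᵐ[μ Ω] fun x => W1p.grad q x - W1p.grad q' x :=
  Lp.coeFn_sub q.1.2 q'.1.2

lemma W1p.fn_add (q q' : W1p Ω p) :
    W1p.fn (q + q') =ᵐ[μ Ω] fun x => W1p.fn q x + W1p.fn q' x :=
  Lp.coeFn_add q.1.1 q'.1.1

lemma W1p.grad_add (q q' : W1p Ω p) :
    W1p.grad (q + q') =ᵐ[μ Ω] fun x => W1p.grad q x + W1p.grad q' x :=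
  Lp.coeFn_add q.1.2 q'.1.2

/-- Meyers–Serrin smoothing in an open subset `U`, with control of the individual scales. -/
theorem W1p.exists_smoothing (q : W1p Ω p) (hp : p ≠ ⊤) (hΩ : IsOpen Ω) (hU : IsOpen U)
    (hUΩ : U ⊆ Ω) {Γ : Set (E N)} (hΓ : Γ ⊆ frontier Ω) (P : IsPartition U K ψ)
    {η : ℝ} (hη : 0 < η) {C : ℕ → ℕ → Prop}
    (hC : ∀ j, ∀ᶠ n in atTop, C j n) :
    ∃ (r : ℕ → ℕ) (q' : W1p Ω p) (g : E N → ℝ), (∀ j, C j (r j)) ∧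
      q' - q ∈ W1pOff Ω Γ p ∧ ‖q' - q‖ ≤ η ∧ ContDiffOn ℝ ∞ g U ∧ W1p.fn q' =ᵐ[μ Ω] g ∧
      (∀ᵐ x ∂(μ Ω), x ∉ U → W1p.fn q' x = W1p.fn q x ∧ W1p.grad q' x = W1p.grad q x) ∧
      ∀ᵐ x ∂(μ Ω), x ∈ U → ∃ m,
        W1p.fn q' x = ∑ j ∈ Finset.range m, moll (r j) (fun z => ψ j z * W1p.fn q z) x ∧
        W1p.grad q' x = ∑ j ∈ Finset.range m, moll (r j) (W1p.prodGrad q (ψ j)) x ∧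
        ∑ j ∈ Finset.range m, ψ j x = 1 ∧ ∑ j ∈ Finset.range m, gradient (ψ j) x = 0 := by
  have hψ : ∀ j, IsCcInfty Ω (ψ j) := fun j => (P.isCcInfty' j).mono hUΩ
  have hV : ∀ j, U \ K (j - 1) ⊆ Ω := fun j => sdiff_subset.trans hUΩ
  -- Every sufficiently small scale meets both the caller's condition C j and the norm bound. The
  -- bounds η / 2 / 2^j add up to η.
  have hex : ∀ j, ∃ n, C j n ∧
      ∃ h : IsCcInfty (U \ K (j - 1)) (moll n fun x => ψ j x * W1p.fn q x),
        ‖W1p.ofCc p hΩ (h.mono (hV j)) - W1p.mulCc q ((P.isCcInfty j).mono (hV j))‖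
          < η / 2 / 2 ^ j := fun j =>
    ((hC j).and (W1p.exists_moll_approx q hp hΩ (hU.sdiff (P.isClosed _)) (hV j) (P.isCcInfty j)
      (by positivity))).exists
  choose r hrC hF hnorm using hex
  set F : ℕ → E N → ℝ := fun j => moll (r j) fun x => ψ j x * W1p.fn q x with hFdef
  set e : ℕ → W1p Ω p := fun j =>
    W1p.ofCc p hΩ ((hF j).mono (hV j)) - W1p.mulCc q (hψ j) with he
  have hsum : Summable fun j => ‖e j‖ :=
    (hasSum_geometric_two' η).summable.of_nonneg_of_le (fun _ => norm_nonneg _)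
      fun j => (hnorm j).le
  have hmem : ∀ j, e j ∈ W1pOff Ω Γ p := fun j =>
    sub_mem (W1p.ofCc_mem_W1pOff hΩ hΓ _) (W1p.mulCc_mem_closure q hp hΩ hΓ (hψ j))
  have hcl : IsClosed (W1pOff Ω Γ p : Set (W1p Ω p)) :=
    (smoothOff Ω Γ p).isClosed_topologicalClosure
  have hpt : ∀ᵐ x ∂(μ Ω), W1p.fn (q + ∑' j, e j) x = W1p.fn q x + W1p.fn (∑' j, e j) x ∧
      W1p.grad (q + ∑' j, e j) x = W1p.grad q x + W1p.grad (∑' j, e j) x ∧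
      HasSum (fun j => F j x - ψ j x * W1p.fn q x) (W1p.fn (∑' j, e j) x) ∧
      HasSum (fun j => gradient (F j) x - W1p.prodGrad q (ψ j) x) (W1p.grad (∑' j, e j) x) := by
    have h1 : ∀ᵐ x ∂(μ Ω), ∀ j, W1p.fn (e j) x = F j x - ψ j x * W1p.fn q x := by
      refine ae_all_iff.2 fun j => ?_
      filter_upwards [W1p.fn_sub (W1p.ofCc p hΩ ((hF j).mono (hV j))) (W1p.mulCc q (hψ j)),
        W1p.fn_ofCc (p := p) hΩ ((hF j).mono (hV j)), W1p.fn_mulCc q (hψ j)] with x a b c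
      rw [a, b, c]
    have h2 : ∀ᵐ x ∂(μ Ω), ∀ j, W1p.grad (e j) x
        = gradient (F j) x - W1p.prodGrad q (ψ j) x := by
      refine ae_all_iff.2 fun j => ?_
      filter_upwards [W1p.grad_sub (W1p.ofCc p hΩ ((hF j).mono (hV j))) (W1p.mulCc q (hψ j)),
        W1p.grad_ofCc (p := p) hΩ ((hF j).mono (hV j)), W1p.grad_mulCc q (hψ j)] with x a b c
      rw [a, b, c]
    filter_upwards [h1, h2, W1p.ae_hasSum hsum, W1p.fn_add q (∑' j, e j),
      W1p.grad_add q (∑' j, e j)] with x a b c d f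
    simp only [a, b] at c
    exact ⟨d, f, c.1, c.2⟩
  -- All supports lie in U, so off U each correction vanishes together with its gradient.
  have hout : ∀ᵐ x ∂(μ Ω), x ∉ U → W1p.fn (q + ∑' j, e j) x = W1p.fn q x ∧
      W1p.grad (q + ∑' j, e j) x = W1p.grad q x := by
    filter_upwards [hpt] with x ⟨h1, h2, h3, h4⟩ hx
    have hF0 : ∀ j, x ∉ tsupport (F j) := fun j h => hx ((hF j).tsupport_subset h).1
    have hψ0 : ∀ j, x ∉ tsupport (ψ j) := fun j h => hx ((P.isCcInfty j).tsupport_subset h).1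
    simp only [W1p.prodGrad, image_eq_zero_of_notMem_tsupport (hF0 _),
      image_eq_zero_of_notMem_tsupport (hψ0 _), gradient_eq_zero_of_notMem (hF0 _),
      gradient_eq_zero_of_notMem (hψ0 _), zero_mul, zero_smul, smul_zero, add_zero,
      sub_zero] at h3 h4
    rw [h1, h2, h3.unique hasSum_zero, h4.unique hasSum_zero, add_zero, add_zero]
    exact ⟨rfl, rfl⟩
  have hin : ∀ᵐ x ∂(μ Ω), x ∈ U → ∃ m,
        W1p.fn (q + ∑' j, e j) x = ∑ j ∈ Finset.range m, F j x ∧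
        W1p.grad (q + ∑' j, e j) x
          = ∑ j ∈ Finset.range m, moll (r j) (W1p.prodGrad q (ψ j)) x ∧
        ∑ j ∈ Finset.range m, ψ j x = 1 ∧ ∑ j ∈ Finset.range m, gradient (ψ j) x = 0 ∧
        ∀ j ∉ Finset.range m, F j x = 0 := by
    filter_upwards [hpt] with x ⟨h1, h2, h3, h4⟩ hx
    obtain ⟨n, hn⟩ := P.exists_mem hx
    -- Two indices are in play: terms from n + 1 on vanish because x ∈ K n, while the remaining n +
    -- 1 functions ψ j sum to one because x ∈ K (n + 1).
    have hn' : x ∈ K (n + 1) := P.monotone (Nat.le_succ n) hn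
    have hFn : ∀ j ∉ Finset.range (n + 1), x ∉ tsupport (F j) := fun j hj =>
      P.notMem_tsupport (by simpa using hj) hn (hF j)
    have hψn : ∀ j ∉ Finset.range (n + 1), x ∉ tsupport (ψ j) := fun j hj =>
      P.notMem_tsupport (by simpa using hj) hn (P.isCcInfty j)
    have hone := (P.sum_eq_one (n + 1) x hn').self_of_nhds
    have hgr := P.sum_gradient hn'
    refine ⟨n + 1, ?_, ?_, hone, hgr, fun j hj => image_eq_zero_of_notMem_tsupport (hFn j hj)⟩
    · have : HasSum (fun j => F j x - ψ j x * W1p.fn q x)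
          (∑ j ∈ Finset.range (n + 1), (F j x - ψ j x * W1p.fn q x)) :=
        hasSum_sum_of_ne_finset_zero fun j hj => by
          rw [image_eq_zero_of_notMem_tsupport (hFn j hj),
            image_eq_zero_of_notMem_tsupport (hψn j hj), zero_mul, sub_zero]
      rw [h1, h3.unique this, Finset.sum_sub_distrib, ← Finset.sum_mul, hone]
      ring
    · have : HasSum (fun j => gradient (F j) x - W1p.prodGrad q (ψ j) x)
          (∑ j ∈ Finset.range (n + 1), (gradient (F j) x - W1p.prodGrad q (ψ j) x)) :=
        hasSum_sum_of_ne_finset_zero fun j hj => by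
          rw [gradient_eq_zero_of_notMem (hFn j hj), W1p.prodGrad,
            image_eq_zero_of_notMem_tsupport (hψn j hj),
            gradient_eq_zero_of_notMem (hψn j hj), zero_smul, smul_zero, add_zero, sub_zero]
      rw [h2, h4.unique this, Finset.sum_sub_distrib]
      -- The terms q ∇ψ_j cancel and the ψ_j ∇q recombine to ∇q, so only the mollified gradients
      -- remain.
      have hpg : ∑ j ∈ Finset.range (n + 1), W1p.prodGrad q (ψ j) x = W1p.grad q x := by
        simp only [W1p.prodGrad]
        rw [Finset.sum_add_distrib, ← Finset.sum_smul, ← Finset.smul_sum, hone, hgr, one_smul,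
          smul_zero, add_zero]
      rw [hpg, add_sub_cancel]
      refine Finset.sum_congr rfl fun j _ => ?_
      exact congrFun (W1p.gradient_moll q hΩ (hψ j) (r j)) x
  classical
  refine ⟨r, q + ∑' j, e j, fun x => if x ∈ U then ∑' j, F j x else W1p.fn q x, hrC, ?_, ?_, ?_,
    ?_, hout, ?_⟩
  · rw [add_sub_cancel_left]
    have hs : HasSum e (∑' j, e j) := hsum.of_norm.hasSum
    exact hcl.mem_of_tendsto hs
      (Eventually.of_forall fun s => sum_mem fun j _ => hmem j)
  · rw [add_sub_cancel_left]
    refine (norm_tsum_le_tsum_norm hsum).trans ?_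
    refine (hsum.tsum_le_tsum (fun j => (hnorm j).le) (hasSum_geometric_two' η).summable).trans ?_
    exact (tsum_geometric_two' η).le
  · refine (P.contDiffOn_tsum hF).congr fun x hx => ?_
    rw [if_pos hx]
  · filter_upwards [hout, hin] with x h1 h2
    by_cases hx : x ∈ U
    · obtain ⟨m, hm, -, -, -, hz⟩ := h2 hx
      rw [if_pos hx, hm, tsum_eq_sum hz]
    · rw [if_neg hx, (h1 hx).1]
  · filter_upwards [hin] with x h hx
    obtain ⟨m, h1, h2, h3, h4, -⟩ := h hx
    exact ⟨m, h1, h2, h3, h4⟩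

end Smoothing

/-! ### A continuous representative when the gradient is locally bounded. -/

section ContinuousVersion

variable {N : ℕ} {Ω U : Set (E N)} {p : ℝ≥0∞} [Fact (1 ≤ p)]

lemma subset_closure_of_ae (hU : IsOpen U) {A : Set (E N)}
    (hA : ∀ᵐ x ∂(volume : Measure (E N)), x ∈ U → x ∈ A) : U ⊆ closure A := by
  intro x hx
  rw [_root_.mem_closure_iff]
  intro W hW hxW
  by_contra hne
  rw [not_nonempty_iff_eq_empty] at hne
  have hpos : 0 < volume (W ∩ U) := (hW.inter hU).measure_pos volume ⟨x, hxW, hx⟩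
  refine hpos.ne' (measure_mono_null (fun z hz => ?_) (ae_iff.1 hA))
  rw [mem_ofPred_eq]
  intro h
  have : z ∈ W ∩ A := ⟨hz.1, h hz.2⟩
  rw [hne] at this
  exact this

/-- A function that is locally uniformly continuous on `A` extends continuously to the part of the
closure of `A` that is covered. -/
lemma exists_continuousOn_extension {A : Set (E N)} (hUA : U ⊆ closure A) {f : E N → ℝ}
    (h : ∀ x ∈ U, ∃ W ∈ 𝓝 x, UniformContinuousOn f (A ∩ W)) :
    ∃ g : E N → ℝ, ContinuousOn g U ∧ ∀ x ∈ U ∩ A, g x = f x := by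
  have hlim : ∀ x ∈ U, ∃ y, Tendsto f (𝓝[A] x) (𝓝 y) := by
    intro x hx
    obtain ⟨W, hW, hu⟩ := h x hx
    have : (𝓝[A] x).NeBot := mem_closure_iff_nhdsWithin_neBot.1 (hUA hx)
    have hc : Cauchy (𝓝[A] x) := (cauchy_nhds (a := x)).mono nhdsWithin_le_nhds
    have := hc.map_of_le hu (le_principal_iff.2
      (inter_mem self_mem_nhdsWithin (mem_nhdsWithin_of_mem_nhds hW)))
    exact cauchy_map_iff_exists_tendsto.1 this
  refine ⟨extendFrom A f, continuousOn_extendFrom hUA hlim, fun x hx => ?_⟩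
  obtain ⟨y, hy⟩ := hlim x hx.1
  rw [extendFrom_eq (hUA hx.1) hy]
  exact tendsto_nhds_unique (hy.mono_left (pure_le_nhdsWithin hx.2)) (tendsto_pure_nhds f x)

/-- A Sobolev function with locally bounded gradient has a continuous representative. -/
lemma W1p.exists_continuousOn (q : W1p Ω p) (hΩ : IsOpen Ω) (hU : IsOpen U) (hUΩ : U ⊆ Ω)
    {α : E N → ℝ} (hαc : ContinuousOn α U) (hα : ∀ᵐ x ∂(μ Ω), x ∈ U → ‖W1p.grad q x‖ ≤ α x) :
    ∃ g : E N → ℝ, ContinuousOn g U ∧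
      ∀ᵐ x ∂(volume : Measure (E N)), x ∈ U → g x = W1p.fn q x := by
  set u := Ω.indicator (W1p.fn q) with hu
  set v := Ω.indicator (W1p.grad q) with hv
  have hul : LocallyIntegrable u volume :=
    ((memLp_indicator_iff_restrict hΩ.measurableSet).2 (W1p.memLp_fn q)).locallyIntegrable Fact.out
  have hvα : ∀ᵐ x ∂(volume : Measure (E N)), x ∈ U → ‖v x‖ ≤ α x := by
    filter_upwards [(ae_restrict_iff' hΩ.measurableSet).1 hα] with x hx hxU
    rw [hv, indicator_of_mem (hUΩ hxU)]
    exact hx (hUΩ hxU) hxU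
  -- A has full measure, hence is dense in U. The values of u on A are limits of smooth functions
  -- and inherit their Lipschitz bounds.
  set A : Set (E N) := {x | Tendsto (fun n => moll n u x) atTop (𝓝 (u x))} with hA
  have hAae : ∀ᵐ x ∂(volume : Measure (E N)), x ∈ A := ae_tendsto_moll hul
  obtain ⟨g, hgc, hg⟩ := exists_continuousOn_extension (f := u)
    (subset_closure_of_ae hU (hAae.mono fun x hx _ => hx)) (fun x₀ hx₀ => by
      obtain ⟨R, hR, hRU⟩ := nhds_basis_closedBall.mem_iff.1 (hU.mem_nhds hx₀)
      obtain ⟨M, hM⟩ := (isCompact_closedBall x₀ R).bddAbove_image (hαc.mono hRU)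
      refine ⟨ball x₀ (R / 2), ball_mem_nhds _ (by positivity), ?_⟩
      have hR2 : 0 < R / 2 := by positivity
      have hlip : LipschitzOnWith M.toNNReal u (A ∩ ball x₀ (R / 2)) := by
        refine LipschitzOnWith.of_dist_le_mul fun x hx y hy => ?_
        rw [dist_eq_norm, dist_eq_norm]
        refine le_of_tendsto ((hx.1.sub hy.1).norm) ?_
        filter_upwards [eventually_one_div_lt hR2] with n hn
        have hball : ∀ z ∈ ball x₀ (R / 2), closedBall z (1 / ((n : ℝ) + 1)) ⊆ closedBall x₀ R :=
          fun z hz => closedBall_subset_closedBall' (by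
            rw [mem_ball] at hz
            linarith)
        -- Mean value inequality on the half ball. With scale below R / 2 the mollified gradient
        -- there only sees the closed R-ball, where α ≤ M.
        refine (convex_ball x₀ (R / 2)).norm_image_sub_le_of_norm_hasFDerivWithin_le
          (f := moll n u) (f' := fun z => InnerProductSpace.toDual ℝ (E N) (moll n v z))
          (fun z hz => ?_) (fun z hz => ?_) hy.2 hx.2
        · have := (W1p.isWeakGradient q).hasGradientAt_moll hΩ.measurableSet Fact.out
            (W1p.memLp_fn q) (W1p.memLp_grad q) (((hball z hz).trans hRU).trans hUΩ)
          exact this.hasFDerivAt.hasFDerivWithinAt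
        · rw [LinearIsometryEquiv.norm_map]
          refine norm_moll_le_of_ball ?_
          filter_upwards [hvα] with t ht htb
          have htR := hball z hz (ball_subset_closedBall htb)
          exact ((ht (hRU htR)).trans (hM (mem_image_of_mem _ htR))).trans (Real.le_coe_toNNReal M)
      exact hlip.uniformContinuousOn)
  refine ⟨g, hgc, ?_⟩
  filter_upwards [hAae] with x hx hxU
  rw [hg x ⟨hxU, hx⟩, hu, indicator_of_mem (hUΩ hxU)]

end ContinuousVersion

/-! ### Smoothing that loses at most a factor 1 + δ in the constraint. -/

section Bounds

variable {N : ℕ} {Ω U : Set (E N)} {p : ℝ≥0∞} [Fact (1 ≤ p)]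

lemma continuous_smul_of_tsupport_subset {F : Type*} [NormedAddCommGroup F] [NormedSpace ℝ F]
    (hU : IsOpen U) {c : E N → F} (hc : Continuous c) (hcU : tsupport c ⊆ U) {f : E N → ℝ}
    (hf : ContinuousOn f U) : Continuous (fun x => f x • c x) := by
  refine continuous_of_tsupport fun x hx => ?_
  have hxU : x ∈ U := hcU (tsupport_smul_subset_right f c hx)
  exact (hf.continuousAt (hU.mem_nhds hxU)).smul hc.continuousAt

/-- A pointwise bound by `ψ α` is almost preserved by mollification. -/
lemma eventually_norm_moll_le {F : Type*} [NormedAddCommGroup F] [NormedSpace ℝ F]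
    (hU : IsOpen U) {α : E N → ℝ} (hαc : ContinuousOn α U)
    (hα0 : ∀ x ∈ U, 0 < α x) {ψ : E N → ℝ} (hψ : IsCcInfty U ψ) {h : E N → F}
    (hh : ∀ᵐ x ∂(volume : Measure (E N)), ‖h x‖ ≤ α x * ψ x) {c : ℝ} (hc : 0 < c) :
    ∀ᶠ n : ℕ in atTop, ∀ x ∈ U, ‖moll n h x‖ ≤ α x * ψ x + c * α x := by
  have hcont : Continuous (fun x => α x * ψ x) :=
    continuous_smul_of_tsupport_subset hU hψ.contDiff.continuous hψ.tsupport_subset hαc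
  have hsupp : HasCompactSupport (fun x => α x * ψ x) := hψ.hasCompactSupport.mul_left
  have hts : tsupport (fun x => α x * ψ x) ⊆ U :=
    (tsupport_mul_subset_right (f := α) (g := ψ)).trans hψ.tsupport_subset
  filter_upwards [eventually_norm_moll_sub_le_weight (β := fun x => c * α x) hcont hsupp hU hts
    (continuousOn_const.mul hαc)
    fun x hx => mul_pos hc (hα0 x hx)] with n hn x hx
  have h1 := norm_moll_le n hcont.locallyIntegrable hh x
  have h2 := le_of_abs_le (hn x hx)
  linarith

variable {K : ℕ → Set (E N)} {ψ : ℕ → E N → ℝ}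

/-- The piece with index j may lose δ 2^(-j-1) times the bound, and these losses add up to at most
δ. -/
lemma IsPartition.sum_le (P : IsPartition U K ψ) {a δ : ℝ} (ha : 0 ≤ a) (hδ : 0 ≤ δ) (m : ℕ)
    (x : E N) : ∑ j ∈ Finset.range m, (a * ψ j x + δ / 2 / 2 ^ j * a) ≤ (1 + δ) * a := by
  rw [Finset.sum_add_distrib, ← Finset.mul_sum, ← Finset.sum_mul]
  have h1 := mul_le_mul_of_nonneg_left (P.sum_le_one m x) ha
  have h2 : ∑ j ∈ Finset.range m, δ / 2 / 2 ^ j ≤ δ :=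
    sum_le_hasSum _ (fun j _ => by positivity) (hasSum_geometric_two' δ)
  have h3 := mul_le_mul_of_nonneg_right h2 ha
  linarith

/-- Smoothing in `U` that almost preserves a pointwise bound on the function. -/
theorem W1p.exists_smoothing_fn_le (q : W1p Ω p) (hp : p ≠ ⊤) (hΩ : IsOpen Ω) (hU : IsOpen U)
    (hUΩ : U ⊆ Ω) {Γ : Set (E N)} (hΓ : Γ ⊆ frontier Ω) {α : E N → ℝ} (hαc : ContinuousOn α U)
    (hα0 : ∀ x ∈ U, 0 < α x) (hq : ∀ᵐ x ∂(μ Ω), x ∈ U → |W1p.fn q x| ≤ α x)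
    {δ η : ℝ} (hδ : 0 < δ) (hη : 0 < η) :
    ∃ (q' : W1p Ω p) (g : E N → ℝ), q' - q ∈ W1pOff Ω Γ p ∧ ‖q' - q‖ ≤ η ∧
      ContDiffOn ℝ ∞ g U ∧ W1p.fn q' =ᵐ[μ Ω] g ∧
      (∀ᵐ x ∂(μ Ω), x ∉ U → W1p.fn q' x = W1p.fn q x) ∧
      ∀ᵐ x ∂(μ Ω), x ∈ U → |W1p.fn q' x| ≤ (1 + δ) * α x := by
  obtain ⟨K, ψ, P⟩ := exists_isPartition hU
  -- The scale condition handed to `W1p.exists_smoothing`: the j-th mollified piece must stay below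
  -- its share of (1 + δ) α.
  have hC : ∀ j, ∀ᶠ n : ℕ in atTop, ∀ x ∈ U, ‖moll n (fun z => ψ j z * W1p.fn q z) x‖
      ≤ α x * ψ j x + δ / 2 / 2 ^ j * α x := by
    intro j
    refine eventually_norm_moll_le hU hαc hα0 (P.isCcInfty' j) ?_ (by positivity)
    filter_upwards [(ae_restrict_iff' hΩ.measurableSet).1 hq] with x hx
    by_cases hxU : x ∈ U
    · rw [norm_mul, Real.norm_of_nonneg (P.nonneg j x), mul_comm]
      exact mul_le_mul_of_nonneg_right (hx (hUΩ hxU) hxU) (P.nonneg j x)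
    · rw [image_eq_zero_of_notMem_tsupport fun h => hxU ((P.isCcInfty' j).tsupport_subset h)]
      simp
  obtain ⟨r, q', g, hr, h1, h2, h3, h4, h5, h6⟩ :=
    W1p.exists_smoothing q hp hΩ hU hUΩ hΓ P hη hC
  refine ⟨q', g, h1, h2, h3, h4, h5.mono fun x hx hxU => (hx hxU).1, ?_⟩
  filter_upwards [h6] with x hx hxU
  obtain ⟨m, hm, -⟩ := hx hxU
  rw [hm]
  exact (Finset.abs_sum_le_sum_abs _ _).trans ((Finset.sum_le_sum fun j _ => hr j x hxU).trans
    (P.sum_le (hα0 x hxU).le hδ.le m x))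

/-- Smoothing in `U` that almost preserves a pointwise bound on the gradient. -/
theorem W1p.exists_smoothing_grad_le (q : W1p Ω p) (hp : p ≠ ⊤) (hΩ : IsOpen Ω) (hU : IsOpen U)
    (hUΩ : U ⊆ Ω) {Γ : Set (E N)} (hΓ : Γ ⊆ frontier Ω) {α : E N → ℝ} (hαc : ContinuousOn α U)
    (hα0 : ∀ x ∈ U, 0 < α x) (hq : ∀ᵐ x ∂(μ Ω), x ∈ U → ‖W1p.grad q x‖ ≤ α x)
    {δ η : ℝ} (hδ : 0 < δ) (hη : 0 < η) :
    ∃ (q' : W1p Ω p) (g : E N → ℝ), q' - q ∈ W1pOff Ω Γ p ∧ ‖q' - q‖ ≤ η ∧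
      ContDiffOn ℝ ∞ g U ∧ W1p.fn q' =ᵐ[μ Ω] g ∧
      (∀ᵐ x ∂(μ Ω), x ∉ U → W1p.grad q' x = W1p.grad q x) ∧
      ∀ᵐ x ∂(μ Ω), x ∈ U → ‖W1p.grad q' x‖ ≤ (1 + δ) * α x := by
  obtain ⟨K, ψ, P⟩ := exists_isPartition hU
  obtain ⟨u, huc, hu⟩ := W1p.exists_continuousOn q hΩ hU hUΩ hαc hq
  -- The term q ∇ψ_j is not bounded by α, but its mollification is close to u ∇ψ_j. Subtracting the
  -- latter costs nothing in the end because the ∇ψ_j sum to zero.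
  have hC : ∀ j, ∀ᶠ n : ℕ in atTop, ∀ x ∈ U,
      ‖moll n (W1p.prodGrad q (ψ j)) x - u x • gradient (ψ j) x‖
        ≤ α x * ψ j x + δ / 2 / 2 ^ j * α x := by
    intro j
    have hψ := P.isCcInfty' j
    have hψΩ := hψ.mono hUΩ
    have hψ0 : ∀ x, x ∉ U → x ∉ tsupport (ψ j) := fun x hx h => hx (hψ.tsupport_subset h)
    -- Half of the j-th loss is reserved for ψ_j ∇q and the other half for u ∇ψ_j.
    have b1 : ∀ᶠ n : ℕ in atTop, ∀ x ∈ U, ‖moll n (fun z => ψ j z • W1p.grad q z) x‖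
        ≤ α x * ψ j x + δ / 2 / 2 ^ j / 2 * α x := by
      refine eventually_norm_moll_le hU hαc hα0 hψ ?_ (by positivity)
      filter_upwards [(ae_restrict_iff' hΩ.measurableSet).1 hq] with x hx
      by_cases hxU : x ∈ U
      · rw [norm_smul, Real.norm_of_nonneg (P.nonneg j x), mul_comm]
        exact mul_le_mul_of_nonneg_right (hx (hUΩ hxU) hxU) (P.nonneg j x)
      · rw [image_eq_zero_of_notMem_tsupport (hψ0 x hxU)]
        simp
    have hgs : tsupport (gradient (ψ j)) ⊆ U :=
      (tsupport_gradient_subset _).trans hψ.tsupport_subset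
    have hcont : Continuous (fun x => u x • gradient (ψ j) x) :=
      continuous_smul_of_tsupport_subset hU (continuous_gradient hψ.contDiff) hgs huc
    have hus : tsupport (fun x => u x • gradient (ψ j) x) ⊆ tsupport (gradient (ψ j)) :=
      tsupport_smul_subset_right u (gradient (ψ j))
    have hcs : HasCompactSupport (fun x => u x • gradient (ψ j) x) :=
      (hasCompactSupport_gradient hψ.hasCompactSupport).isCompact.of_isClosed_subset
        (isClosed_tsupport _) hus
    have hβ : ContinuousOn (fun x => δ / 2 / 2 ^ j / 2 * α x) U := continuousOn_const.mul hαc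
    have b2 := eventually_norm_moll_sub_le_weight (β := fun x => δ / 2 / 2 ^ j / 2 * α x)
      hcont hcs hU (hus.trans hgs) hβ
      fun x hx => mul_pos (by positivity) (hα0 x hx)
    have hm : MemLp (fun z => ψ j z • W1p.grad q z) p (μ Ω) :=
      memLp_bdd_smul hψ.contDiff.continuous hψ.bdd (W1p.memLp_grad q)
    have hm' : MemLp (fun z => ψ j z • W1p.grad q z) p volume :=
      memLp_volume_of_support_subset hΩ.measurableSet hm fun x hx => by
        rw [image_eq_zero_of_notMem_tsupport fun h => hx (hψΩ.tsupport_subset h), zero_smul]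
    have hl1 : LocallyIntegrable (fun z => ψ j z • W1p.grad q z) volume :=
      hm'.locallyIntegrable Fact.out
    filter_upwards [b1, b2] with n h1 h2 x hx
    have hdec : moll n (W1p.prodGrad q (ψ j)) x
        = moll n (fun z => ψ j z • W1p.grad q z) x
          + moll n (fun z => u z • gradient (ψ j) z) x := by
      rw [← moll_add n hl1 hcont.locallyIntegrable]
      refine congrFun (moll_congr_ae n ?_) x
      filter_upwards [hu] with z hz
      by_cases hzU : z ∈ U
      · rw [W1p.prodGrad, hz hzU]
      · rw [W1p.prodGrad, gradient_eq_zero_of_notMem (hψ0 z hzU), smul_zero, smul_zero]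
    rw [hdec, add_sub_assoc]
    refine (norm_add_le _ _).trans ?_
    have := add_le_add (h1 x hx) (h2 x hx)
    linarith
  obtain ⟨r, q', g, hr, h1, h2, h3, h4, h5, h6⟩ :=
    W1p.exists_smoothing q hp hΩ hU hUΩ hΓ P hη hC
  refine ⟨q', g, h1, h2, h3, h4, h5.mono fun x hx hxU => (hx hxU).2, ?_⟩
  filter_upwards [h6] with x hx hxU
  obtain ⟨m, -, hm, -, hz⟩ := hx hxU
  -- Here Σ ∇ψ_j = 0 is used to insert the terms u ∇ψ_j.
  have : W1p.grad q' x = ∑ j ∈ Finset.range m,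
      (moll (r j) (W1p.prodGrad q (ψ j)) x - u x • gradient (ψ j) x) := by
    rw [Finset.sum_sub_distrib, ← Finset.smul_sum, hz, smul_zero, sub_zero, hm]
  rw [this]
  exact (norm_sum_le _ _).trans ((Finset.sum_le_sum fun j _ => hr j x hxU).trans
    (P.sum_le (hα0 x hxU).le hδ.le m x))

end Bounds

/-! ### Convergence criteria in L^p. -/

section LpConvergence

variable {X F : Type*} [MeasurableSpace X] [NormedAddCommGroup F] {m : Measure X} {p : ℝ≥0∞}

/-- Dominated convergence in `L^p`. -/
lemma tendsto_eLpNorm_of_dominated (hp1 : 1 ≤ p) (hp : p ≠ ⊤) {f : ℕ → X → F} {b : X → ℝ}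
    (hb : MemLp b p m) (hf : ∀ n, AEStronglyMeasurable (f n) m)
    (hbound : ∀ n, ∀ᵐ x ∂m, ‖f n x‖ ≤ b x)
    (hlim : ∀ᵐ x ∂m, Tendsto (fun n => f n x) atTop (𝓝 0)) :
    Tendsto (fun n => eLpNorm (f n) p m) atTop (𝓝 0) := by
  have hp0 : p ≠ 0 := (zero_lt_one.trans_le hp1).ne'
  have hr : 0 < p.toReal := ENNReal.toReal_pos hp0 hp
  have h1 : Tendsto (fun n => ∫⁻ x, ‖f n x‖ₑ ^ p.toReal ∂m) atTop (𝓝 (∫⁻ _, 0 ∂m)) := by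
    refine tendsto_lintegral_of_dominated_convergence' (fun x => ‖b x‖ₑ ^ p.toReal)
      (fun n => (hf n).enorm.pow_const _) (fun n => ?_)
      (lintegral_rpow_enorm_lt_top_of_eLpNorm_lt_top hp0 hp hb.2).ne ?_
    · filter_upwards [hbound n] with x hx
      refine ENNReal.rpow_le_rpow ?_ hr.le
      rw [← ofReal_norm, ← ofReal_norm]
      exact ENNReal.ofReal_le_ofReal (hx.trans (le_abs_self _))
    · filter_upwards [hlim] with x hx
      have := (hx.enorm).ennrpow_const p.toReal
      rwa [enorm_zero, ENNReal.zero_rpow_of_pos hr] at this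
  rw [lintegral_zero] at h1
  have h2 := h1.ennrpow_const (1 / p.toReal)
  rw [ENNReal.zero_rpow_of_pos (by positivity)] at h2
  exact h2.congr fun n => (eLpNorm_eq_lintegral_rpow_enorm_toReal hp0 hp).symm

lemma tendsto_eLpNorm_of_le_mul {G : Type*} [NormedAddCommGroup G] {ι : Type*} {l : Filter ι}
    {f : ι → X → F} {g : ι → X → G} {C : ℝ} (h : ∀ i, ∀ᵐ x ∂m, ‖g i x‖ ≤ C * ‖f i x‖)
    (hf : Tendsto (fun i => eLpNorm (f i) p m) l (𝓝 0)) :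
    Tendsto (fun i => eLpNorm (g i) p m) l (𝓝 0) := by
  have h1 := ENNReal.Tendsto.const_mul (a := ENNReal.ofReal C) hf (Or.inr ENNReal.ofReal_ne_top)
  rw [mul_zero] at h1
  exact tendsto_of_tendsto_of_tendsto_of_le_of_le tendsto_const_nhds h1 (fun _ => zero_le)
    fun i => eLpNorm_le_mul_eLpNorm_of_ae_le_mul (h i) p

lemma tendsto_eLpNorm_add (hp1 : 1 ≤ p) {ι : Type*} {l : Filter ι} {f g : ι → X → F}
    (hfm : ∀ i, AEStronglyMeasurable (f i) m) (hgm : ∀ i, AEStronglyMeasurable (g i) m)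
    (hf : Tendsto (fun i => eLpNorm (f i) p m) l (𝓝 0))
    (hg : Tendsto (fun i => eLpNorm (g i) p m) l (𝓝 0)) :
    Tendsto (fun i => eLpNorm (f i + g i) p m) l (𝓝 0) := by
  have h1 := hf.add hg
  rw [add_zero] at h1
  exact tendsto_of_tendsto_of_tendsto_of_le_of_le tendsto_const_nhds h1 (fun _ => zero_le)
    fun i => eLpNorm_add_le (hfm i) (hgm i) hp1

end LpConvergence

/-! ### The chain rule in W^{1,p}_Γ. -/

section ChainRule

variable {N : ℕ} {Ω Γ : Set (E N)} {p : ℝ≥0∞}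

lemma gradient_comp {S : ℝ → ℝ} (hS : ContDiff ℝ ∞ S) {w : E N → ℝ} {x : E N}
    (hw : DifferentiableAt ℝ w x) :
    gradient (fun y => S (w y)) x = deriv S (w x) • gradient w x := by
  have h1 : HasDerivAt S (deriv S (w x)) (w x) :=
    (hS.contDiffAt.differentiableAt (by simp)).hasDerivAt
  have h2 := h1.comp_hasFDerivAt x hw.hasFDerivAt
  have h3 : HasFDerivAt (fun y => S (w y)) (deriv S (w x) • fderiv ℝ w x) x := h2
  rw [gradient, h3.fderiv, map_smul, gradient]

lemma lipschitz_of_deriv_le {S : ℝ → ℝ} (hS : ContDiff ℝ ∞ S) {C : ℝ} (hC : ∀ t, |deriv S t| ≤ C)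
    (s t : ℝ) : |S s - S t| ≤ C * |s - t| :=
  convex_univ.norm_image_sub_le_of_norm_deriv_le
    (fun x _ => hS.contDiffAt.differentiableAt (by simp)) (fun x _ => hC x) (mem_univ t)
    (mem_univ s)

lemma memLp_comp {S : ℝ → ℝ} (hS : ContDiff ℝ ∞ S) (hS0 : S 0 = 0) {C : ℝ}
    (hC : ∀ t, |deriv S t| ≤ C) {m : Measure (E N)} {u : E N → ℝ} (hu : MemLp u p m) :
    MemLp (fun x => S (u x)) p m := by
  refine hu.of_le_mul (c := C) (hS.continuous.comp_aestronglyMeasurable hu.aestronglyMeasurable)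
    (Eventually.of_forall fun x => ?_)
  simpa [hS0] using lipschitz_of_deriv_le hS hC (u x) 0

lemma continuous_deriv_of_contDiff {S : ℝ → ℝ} (hS : ContDiff ℝ ∞ S) : Continuous (deriv S) :=
  hS.continuous_deriv (by simp)

lemma memLp_deriv_smul {S : ℝ → ℝ} (hS : ContDiff ℝ ∞ S) {C : ℝ}
    (hC : ∀ t, |deriv S t| ≤ C) {m : Measure (E N)} {u : E N → ℝ} {v : E N → E N}
    (hu : AEStronglyMeasurable u m) (hv : MemLp v p m) :
    MemLp (fun x => deriv S (u x) • v x) p m := by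
  refine hv.of_le_mul (c := C) (((continuous_deriv_of_contDiff hS).comp_aestronglyMeasurable
    hu).smul hv.aestronglyMeasurable) (Eventually.of_forall fun x => ?_)
  rw [norm_smul]
  exact mul_le_mul_of_nonneg_right (hC _) (norm_nonneg _)

variable [Fact (1 ≤ p)]

/-- The chain rule for smooth elements. -/
lemma exists_comp_of_mem_smoothOff (hΩ : IsOpen Ω) {q : W1p Ω p} (hq : q ∈ smoothOff Ω Γ p)
    {S : ℝ → ℝ} (hS : ContDiff ℝ ∞ S) (hS0 : S 0 = 0) {C : ℝ} (hC : ∀ t, |deriv S t| ≤ C) :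
    ∃ q' ∈ smoothOff Ω Γ p, W1p.fn q' =ᵐ[μ Ω] (fun x => S (W1p.fn q x)) ∧
      W1p.grad q' =ᵐ[μ Ω] fun x => deriv S (W1p.fn q x) • W1p.grad q x := by
  obtain ⟨w, hw, hwΓ, hqw'⟩ := hq
  have hqw : W1p.fn q =ᵐ[μ Ω] w := hqw'
  have hgw : W1p.grad q =ᵐ[μ Ω] gradient w := by
    have hc : ContinuousOn (gradient w) Ω :=
      (InnerProductSpace.toDual ℝ (E N)).symm.continuous.comp_continuousOn
        (hw.continuousOn_fderiv_of_isOpen hΩ (by simp))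
    exact IsWeakGradient.ae_unique hΩ (locallyIntegrableOn_of_memLp Fact.out (W1p.memLp_grad q))
      (hc.locallyIntegrableOn hΩ.measurableSet)
      ((W1p.isWeakGradient q).congr hqw EventuallyEq.rfl) (isWeakGradient_of_contDiffOn hΩ hw)
  have hSw : ContDiffOn ℝ ∞ (fun x => S (w x)) Ω := hS.comp_contDiffOn hw
  have hfn : (fun x => S (w x)) =ᵐ[μ Ω] fun x => S (W1p.fn q x) := by
    filter_upwards [hqw] with x hx
    rw [hx]
  have hgr : gradient (fun x => S (w x)) =ᵐ[μ Ω]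
      fun x => deriv S (W1p.fn q x) • W1p.grad q x := by
    filter_upwards [hqw, hgw, ae_restrict_mem hΩ.measurableSet] with x h1 h2 h3
    rw [gradient_comp hS ((hw.contDiffAt (hΩ.mem_nhds h3)).differentiableAt (by simp)), h1, h2]
  refine ⟨W1p.mk (memLp_comp hS hS0 hC (W1p.memLp_fn q))
    (memLp_deriv_smul hS hC (W1p.memLp_fn q).aestronglyMeasurable (W1p.memLp_grad q))
    ((isWeakGradient_of_contDiffOn hΩ hSw).congr hfn hgr), ?_, W1p.fn_mk _ _ _, W1p.grad_mk _ _ _⟩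
  refine ⟨fun x => S (w x), hSw, ?_, (W1p.fn_mk _ _ _).trans hfn.symm⟩
  -- Since S 0 = 0, composition does not enlarge the support, so the condition on Γ survives.
  rw [← subset_empty_iff, ← hwΓ]
  refine inter_subset_inter_left _ (closure_mono ?_)
  rintro x ⟨hx, hne⟩
  refine ⟨hx, fun h0 => hne ?_⟩
  change S (w x) = 0
  rw [h0, hS0]

lemma isClosed_W1pOff : IsClosed (W1pOff Ω Γ p : Set (W1p Ω p)) :=
  (smoothOff Ω Γ p).isClosed_topologicalClosure

/-- Limits in `L^p` of functions and gradients stay in `W^{1,p}_Γ(Ω)`. -/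
lemma exists_limit_mem_W1pOff {ι : Type*} {l : Filter ι} [l.NeBot] {Q : ι → W1p Ω p}
    (hQ : ∀ i, Q i ∈ W1pOff Ω Γ p) {u : E N → ℝ} {v : E N → E N} (hu : MemLp u p (μ Ω))
    (hv : MemLp v p (μ Ω)) (h1 : Tendsto (fun i => eLpNorm (W1p.fn (Q i) - u) p (μ Ω)) l (𝓝 0))
    (h2 : Tendsto (fun i => eLpNorm (W1p.grad (Q i) - v) p (μ Ω)) l (𝓝 0)) :
    ∃ q ∈ W1pOff Ω Γ p, W1p.fn q =ᵐ[μ Ω] u ∧ W1p.grad q =ᵐ[μ Ω] v ∧ Tendsto Q l (𝓝 q) := by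
  have t : Tendsto (fun i => (Q i).1) l (𝓝 (hu.toLp u, hv.toLp v)) := by
    rw [Prod.tendsto_iff, Lp.tendsto_Lp_iff_tendsto_eLpNorm', Lp.tendsto_Lp_iff_tendsto_eLpNorm']
    exact ⟨h1.congr fun i => eLpNorm_congr_ae (EventuallyEq.rfl.sub hu.coeFn_toLp.symm),
      h2.congr fun i => eLpNorm_congr_ae (EventuallyEq.rfl.sub hv.coeFn_toLp.symm)⟩
  have hm : (hu.toLp u, hv.toLp v) ∈ W1p Ω p :=
    isClosed_W1p.mem_of_tendsto t (Eventually.of_forall fun i => (Q i).2)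
  have ht : Tendsto Q l (𝓝 (⟨_, hm⟩ : W1p Ω p)) := tendsto_subtype_rng.2 t
  exact ⟨⟨_, hm⟩, isClosed_W1pOff.mem_of_tendsto ht (Eventually.of_forall hQ),
    hu.coeFn_toLp, hv.coeFn_toLp, ht⟩

/-- The chain rule in `W^{1,p}_Γ(Ω)`. -/
lemma exists_comp_of_mem_W1pOff (hΩ : IsOpen Ω) (hp : p ≠ ⊤) {q : W1p Ω p}
    (hq : q ∈ W1pOff Ω Γ p) {S : ℝ → ℝ} (hS : ContDiff ℝ ∞ S) (hS0 : S 0 = 0) {C : ℝ}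
    (hC : ∀ t, |deriv S t| ≤ C) :
    ∃ q' ∈ W1pOff Ω Γ p, W1p.fn q' =ᵐ[μ Ω] (fun x => S (W1p.fn q x)) ∧
      W1p.grad q' =ᵐ[μ Ω] fun x => deriv S (W1p.fn q x) • W1p.grad q x := by
  have hq' : q ∈ closure (smoothOff Ω Γ p : Set (W1p Ω p)) := hq
  obtain ⟨Q₀, hQ₀, hlim₀⟩ := mem_closure_iff_seq_limit.1 hq'
  have hfst : Tendsto (fun n => (Q₀ n).1.1) atTop (𝓝 q.1.1) :=
    ((continuous_fst.comp continuous_subtype_val).tendsto q).comp hlim₀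
  -- A.e. convergence is needed for S'(u_n) → S'(u), which enters the dominated convergence argument
  -- for the gradients.
  obtain ⟨ns, hns, hae⟩ := (tendstoInMeasure_of_tendsto_Lp hfst).exists_seq_tendsto_ae
  set Q : ℕ → W1p Ω p := fun n => Q₀ (ns n) with hQdef
  have hlim : Tendsto Q atTop (𝓝 q) := hlim₀.comp hns.tendsto_atTop
  obtain ⟨hl1, hl2⟩ := W1p.tendsto_iff.1 hlim
  have hex := fun n => exists_comp_of_mem_smoothOff hΩ (hQ₀ (ns n)) hS hS0 hC
  choose R hR hR1 hR2 using hex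
  have hum : ∀ q : W1p Ω p, AEStronglyMeasurable (W1p.fn q) (μ Ω) := fun q =>
    (W1p.memLp_fn q).aestronglyMeasurable
  have hvm : ∀ q : W1p Ω p, AEStronglyMeasurable (W1p.grad q) (μ Ω) := fun q =>
    (W1p.memLp_grad q).aestronglyMeasurable
  have hdc := continuous_deriv_of_contDiff hS
  have hdm : ∀ q : W1p Ω p, AEStronglyMeasurable (fun x => deriv S (W1p.fn q x)) (μ Ω) := fun q =>
    hdc.comp_aestronglyMeasurable (hum q)
  have t1 : Tendsto (fun n => eLpNorm (W1p.fn (R n) - fun x => S (W1p.fn q x)) p (μ Ω)) atTop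
      (𝓝 0) := by
    refine tendsto_eLpNorm_of_le_mul (C := C) (fun n => ?_) hl1
    filter_upwards [hR1 n] with x hx
    rw [Pi.sub_apply, hx]
    exact lipschitz_of_deriv_le hS hC _ _
  -- Split S'(u_n)∇u_n − S'(u)∇u into S'(u_n)(∇u_n − ∇u), where S' is bounded, and (S'(u_n) −
  -- S'(u))∇u, which is dominated.
  have t2 : Tendsto (fun n => eLpNorm (W1p.grad (R n) -
      fun x => deriv S (W1p.fn q x) • W1p.grad q x) p (μ Ω)) atTop (𝓝 0) := by
    have s1 : Tendsto (fun n => eLpNorm (fun x => deriv S (W1p.fn (Q n) x) •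
        (W1p.grad (Q n) x - W1p.grad q x)) p (μ Ω)) atTop (𝓝 0) := by
      refine tendsto_eLpNorm_of_le_mul (C := C) (fun n => Eventually.of_forall fun x => ?_) hl2
      rw [norm_smul]
      exact mul_le_mul_of_nonneg_right (hC _) (norm_nonneg _)
    have s2 : Tendsto (fun n => eLpNorm (fun x => (deriv S (W1p.fn (Q n) x) -
        deriv S (W1p.fn q x)) • W1p.grad q x) p (μ Ω)) atTop (𝓝 0) := by
      refine tendsto_eLpNorm_of_dominated Fact.out hp (b := fun x => (C + C) * ‖W1p.grad q x‖)
        ((W1p.memLp_grad q).norm.const_mul (C + C))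
        (fun n => ((hdm (Q n)).sub (hdm q)).smul (hvm q))
        (fun n => Eventually.of_forall fun x => ?_) ?_
      · rw [norm_smul]
        refine mul_le_mul_of_nonneg_right ?_ (norm_nonneg _)
        exact (norm_sub_le _ _).trans (add_le_add (hC _) (hC _))
      · filter_upwards [hae] with x hx
        have h1 : Tendsto (fun n => deriv S (W1p.fn (Q n) x)) atTop
            (𝓝 (deriv S (W1p.fn q x))) := (hdc.tendsto _).comp hx
        have h2 := (h1.sub_const (deriv S (W1p.fn q x))).smul_const (W1p.grad q x)
        rwa [sub_self, zero_smul] at h2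
    have := tendsto_eLpNorm_add Fact.out
      (fun n => (hdm (Q n)).smul ((hvm (Q n)).sub (hvm q)))
      (fun n => ((hdm (Q n)).sub (hdm q)).smul (hvm q)) s1 s2
    refine this.congr fun n => eLpNorm_congr_ae ?_
    filter_upwards [hR2 n] with x hx
    simp only [Pi.add_apply, Pi.sub_apply, hx, smul_sub, sub_smul]
    abel
  obtain ⟨q', hm, e1, e2, -⟩ := exists_limit_mem_W1pOff
    (fun n => (smoothOff Ω Γ p).le_topologicalClosure (hR n))
    (memLp_comp hS hS0 hC (W1p.memLp_fn q)) (memLp_deriv_smul hS hC (hum q) (W1p.memLp_grad q))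
    t1 t2
  exact ⟨q', hm, e1, e2⟩

end ChainRule

/-! ### Removing the small values of a Sobolev function. -/

section Truncation

variable {N : ℕ} {Ω Γ : Set (E N)} {p : ℝ≥0∞} [Fact (1 ≤ p)]

/-- A bump function on the line. -/
def lineBump : ContDiffBump (0 : ℝ) where
  rIn := 1
  rOut := 2
  rIn_pos := one_pos
  rIn_lt_rOut := one_lt_two

/-- The part of `t` at scale `1 / (n + 1)`. -/
def smallPart (n : ℕ) (t : ℝ) : ℝ := t * lineBump (((n : ℝ) + 1) * t)

lemma lineBump_contDiff : ContDiff ℝ ∞ lineBump := lineBump.contDiff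

lemma contDiff_smallPart (n : ℕ) : ContDiff ℝ ∞ (smallPart n) :=
  contDiff_id.mul (lineBump_contDiff.comp (contDiff_const.mul contDiff_id))

lemma smallPart_zero (n : ℕ) : smallPart n 0 = 0 := by simp [smallPart]

lemma abs_smallPart_le (n : ℕ) (t : ℝ) : |smallPart n t| ≤ |t| := by
  rw [smallPart, abs_mul, abs_of_nonneg lineBump.nonneg]
  exact mul_le_of_le_one_right (abs_nonneg _) lineBump.le_one

lemma abs_sub_smallPart_le (n : ℕ) (t : ℝ) : |t - smallPart n t| ≤ |t| := by
  have : t - smallPart n t = t * (1 - lineBump (((n : ℝ) + 1) * t)) := by rw [smallPart]; ring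
  have h0 := lineBump.nonneg (x := ((n : ℝ) + 1) * t)
  have h1 := lineBump.le_one (x := ((n : ℝ) + 1) * t)
  rw [this, abs_mul, abs_of_nonneg (by linarith : 0 ≤ 1 - lineBump (((n : ℝ) + 1) * t))]
  exact mul_le_of_le_one_right (abs_nonneg _) (by linarith)

lemma smallPart_eq_self {n : ℕ} {t : ℝ} (h : |t| ≤ 1 / ((n : ℝ) + 1)) : smallPart n t = t := by
  have hn : (0 : ℝ) < (n : ℝ) + 1 := by positivity
  rw [smallPart, lineBump.one_of_mem_closedBall, mul_one]
  rw [mem_closedBall_zero_iff, Real.norm_eq_abs, abs_mul, abs_of_pos hn]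
  rw [le_div_iff₀ hn] at h
  change _ ≤ (1 : ℝ)
  linarith

/-- The profile of the derivative of `smallPart`. -/
def smallPartDeriv (s : ℝ) : ℝ := lineBump s + s * deriv lineBump s

/-- The derivative is a rescaling of one fixed profile, so its bound does not depend on n. -/
lemma deriv_smallPart (n : ℕ) (t : ℝ) :
    deriv (smallPart n) t = smallPartDeriv (((n : ℝ) + 1) * t) := by
  have h1 : HasDerivAt lineBump (deriv lineBump (((n : ℝ) + 1) * t)) (((n : ℝ) + 1) * t) :=
    (lineBump_contDiff.contDiffAt.differentiableAt (by simp)).hasDerivAt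
  have h2 : HasDerivAt (fun t : ℝ => ((n : ℝ) + 1) * t) ((n : ℝ) + 1) t := by
    simpa using (hasDerivAt_id t).const_mul ((n : ℝ) + 1)
  have h3 : HasDerivAt (fun t => lineBump (((n : ℝ) + 1) * t))
    (deriv lineBump (((n : ℝ) + 1) * t) * ((n : ℝ) + 1)) t := h1.comp t h2
  have h4 : HasDerivAt (smallPart n) _ t := (hasDerivAt_id t).mul h3
  rw [h4.deriv, smallPartDeriv]
  simp only [id]
  ring

lemma exists_abs_smallPartDeriv_le : ∃ C, ∀ s, |smallPartDeriv s| ≤ C := by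
  have hc : Continuous smallPartDeriv := lineBump_contDiff.continuous.add
    (continuous_id.mul (continuous_deriv_of_contDiff lineBump_contDiff))
  have hs : HasCompactSupport smallPartDeriv :=
    lineBump.hasCompactSupport.add lineBump.hasCompactSupport.deriv.mul_left
  exact hs.exists_bound_of_continuous hc

lemma smallPartDeriv_zero : smallPartDeriv 0 = 1 := by
  rw [smallPartDeriv, zero_mul, add_zero]
  exact lineBump.one_of_mem_closedBall (mem_closedBall_self one_pos.le)

lemma smallPartDeriv_of_lt {s : ℝ} (h : 2 < |s|) : smallPartDeriv s = 0 := by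
  have hs : s ∉ tsupport lineBump := by
    rw [lineBump.tsupport_eq, mem_closedBall_zero_iff, Real.norm_eq_abs, not_le]
    exact h
  rw [smallPartDeriv, image_eq_zero_of_notMem_tsupport hs,
    Function.notMem_support.1 fun h' => hs (support_deriv_subset h'), mul_zero, add_zero]

lemma tendsto_smallPart (t : ℝ) : Tendsto (fun n => smallPart n t) atTop (𝓝 0) := by
  by_cases ht : t = 0
  · simp [ht, smallPart_zero]
  · refine tendsto_const_nhds.congr' ?_
    filter_upwards [(tendsto_natCast_atTop_atTop (R := ℝ)).eventually_gt_atTop (2 / |t|)] with n hn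
    have ht' : 0 < |t| := abs_pos.2 ht
    have hn0 : (0 : ℝ) < (n : ℝ) + 1 := by positivity
    rw [smallPart, lineBump.zero_of_le_dist, mul_zero]
    rw [dist_zero_right, Real.norm_eq_abs, abs_mul, abs_of_pos hn0]
    change (2 : ℝ) ≤ _
    rw [div_lt_iff₀ ht'] at hn
    nlinarith

lemma tendsto_smallPartDeriv (t : ℝ) :
    Tendsto (fun n : ℕ => smallPartDeriv (((n : ℝ) + 1) * t)) atTop
      (𝓝 (({0} : Set ℝ).indicator 1 t)) := by
  by_cases ht : t = 0
  · simp [ht, smallPartDeriv_zero]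
  · rw [indicator_of_notMem (by simpa using ht)]
    refine tendsto_const_nhds.congr' ?_
    filter_upwards [(tendsto_natCast_atTop_atTop (R := ℝ)).eventually_gt_atTop (2 / |t|)] with n hn
    have ht' : 0 < |t| := abs_pos.2 ht
    have hn0 : (0 : ℝ) < (n : ℝ) + 1 := by positivity
    rw [smallPartDeriv_of_lt]
    rw [abs_mul, abs_of_pos hn0]
    rw [div_lt_iff₀ ht'] at hn
    nlinarith

/-- Elements of `W^{1,p}_Γ(Ω)` are limits of smooth truncations. -/
lemma exists_truncation (hΩ : IsOpen Ω) (hp : p ≠ ⊤) {q : W1p Ω p} (hq : q ∈ W1pOff Ω Γ p)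
    {ε : ℝ} (hε : 0 < ε) :
    ∃ q' ∈ W1pOff Ω Γ p, ‖q' - q‖ < ε ∧ ∃ (S : ℝ → ℝ) (c : ℝ), 0 < c ∧ ContDiff ℝ ∞ S ∧
      (∀ t, |t| ≤ c → S t = 0) ∧ (∀ t, |S t| ≤ |t|) ∧
      W1p.fn q' =ᵐ[μ Ω] fun x => S (W1p.fn q x) := by
  obtain ⟨C, hC⟩ := exists_abs_smallPartDeriv_le
  have hC' : ∀ n t, |deriv (smallPart n) t| ≤ C := fun n t => by
    rw [deriv_smallPart]
    exact hC _
  have hex := fun n : ℕ => exists_comp_of_mem_W1pOff hΩ hp hq (contDiff_smallPart n)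
    (smallPart_zero n) (hC' n)
  choose Q hQ hQ1 hQ2 using hex
  have hum := (W1p.memLp_fn q).aestronglyMeasurable
  have hvm := (W1p.memLp_grad q).aestronglyMeasurable
  -- The pointwise limit of the gradients of the small parts: ∇u on {u = 0} and zero elsewhere.
  set v₀ : E N → E N := fun x => ({0} : Set ℝ).indicator (1 : ℝ → ℝ) (W1p.fn q x) • W1p.grad q x
    with hv₀
  have hind : ∀ t : ℝ, |({0} : Set ℝ).indicator (1 : ℝ → ℝ) t| ≤ 1 := fun t => by
    by_cases ht : t ∈ ({0} : Set ℝ)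
    · rw [indicator_of_mem ht]; simp
    · rw [indicator_of_notMem ht]; simp
  have hindm : AEStronglyMeasurable
      (fun x => ({0} : Set ℝ).indicator (1 : ℝ → ℝ) (W1p.fn q x)) (μ Ω) :=
    ((measurable_one.indicator (measurableSet_singleton 0)).comp_aemeasurable
      hum.aemeasurable).aestronglyMeasurable
  have hv₀m : MemLp v₀ p (μ Ω) := by
    refine (W1p.memLp_grad q).of_le_mul (c := 1) (hindm.smul hvm)
      (Eventually.of_forall fun x => ?_)
    rw [norm_smul]
    exact mul_le_mul_of_nonneg_right (hind _) (norm_nonneg _)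
  have t1 : Tendsto (fun n => eLpNorm (W1p.fn (Q n) - 0) p (μ Ω)) atTop (𝓝 0) := by
    refine tendsto_eLpNorm_of_dominated Fact.out hp (W1p.memLp_fn q).norm
      (fun n => (W1p.memLp_fn (Q n)).aestronglyMeasurable.sub aestronglyMeasurable_zero)
      (fun n => ?_) ?_
    · filter_upwards [hQ1 n] with x hx
      rw [sub_zero, hx]
      exact abs_smallPart_le n _
    · filter_upwards [ae_all_iff.2 hQ1] with x hx
      simp only [sub_zero, hx]
      exact tendsto_smallPart _
  have t2 : Tendsto (fun n => eLpNorm (W1p.grad (Q n) - v₀) p (μ Ω)) atTop (𝓝 0) := by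
    refine tendsto_eLpNorm_of_dominated Fact.out hp
      (b := fun x => (C + 1) * ‖W1p.grad q x‖) ((W1p.memLp_grad q).norm.const_mul (C + 1))
      (fun n => (W1p.memLp_grad (Q n)).aestronglyMeasurable.sub hv₀m.aestronglyMeasurable)
      (fun n => ?_) ?_
    · filter_upwards [hQ2 n] with x hx
      rw [Pi.sub_apply, hx, hv₀, ← sub_smul, norm_smul]
      exact mul_le_mul_of_nonneg_right ((norm_sub_le _ _).trans (add_le_add (hC' n _) (hind _)))
        (norm_nonneg _)
    · filter_upwards [ae_all_iff.2 hQ2] with x hx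
      simp only [Pi.sub_apply, hx, hv₀, deriv_smallPart]
      have := ((tendsto_smallPartDeriv (W1p.fn q x)).smul_const (W1p.grad q x)).sub_const
        (({0} : Set ℝ).indicator (1 : ℝ → ℝ) (W1p.fn q x) • W1p.grad q x)
      rwa [sub_self] at this
  obtain ⟨q₀, -, e1, -, hlim⟩ := exists_limit_mem_W1pOff hQ MemLp.zero' hv₀m t1 t2
  -- The small parts converge to an element whose function is zero, and uniqueness of weak gradients
  -- makes that element zero. That ∇u vanishes a.e. on {u = 0} is therefore not needed in advance.
  have hq₀ : q₀ = 0 := W1p.ext_of_fn hΩ (e1.trans (Lp.coeFn_zero ℝ p (μ Ω)).symm)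
  rw [hq₀] at hlim
  obtain ⟨n, hn⟩ := (Metric.tendsto_nhds.1 hlim ε hε).exists
  rw [dist_zero_right] at hn
  refine ⟨q - Q n, sub_mem hq (hQ n), ?_, fun t => t - smallPart n t, 1 / ((n : ℝ) + 1),
    by positivity, contDiff_id.sub (contDiff_smallPart n), fun t ht => ?_,
    abs_sub_smallPart_le n, ?_⟩
  · rwa [sub_sub_cancel_left, norm_neg]
  · change t - smallPart n t = 0
    rw [smallPart_eq_self ht, sub_self]
  · filter_upwards [W1p.fn_sub q (Q n), hQ1 n] with x h1 h2
    rw [h1, h2]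

end Truncation

/-! ### Cutoff at infinity. -/

section Cutoff

variable {N : ℕ} {Ω Γ : Set (E N)} {p : ℝ≥0∞} [Fact (1 ≤ p)]

lemma W1p.mul_mem_smoothOff {q : W1p Ω p} (hq : q ∈ smoothOff Ω Γ p) {ψ : E N → ℝ}
    (hψ : ContDiff ℝ ∞ ψ) (hb : ∃ C, ∀ x, ‖ψ x‖ ≤ C) (hb' : ∃ C, ∀ x, ‖gradient ψ x‖ ≤ C) :
    W1p.mul q ψ hψ hb hb' ∈ smoothOff Ω Γ p := by
  obtain ⟨w, hw, hwΓ, hqw⟩ := hq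
  refine ⟨fun x => ψ x * w x, hψ.contDiffOn.mul hw, ?_, (W1p.fn_mul q hψ hb hb').trans ?_⟩
  · rw [← subset_empty_iff, ← hwΓ]
    exact inter_subset_inter_left _ (closure_mono fun x hx => ⟨hx.1, right_ne_zero_of_mul hx.2⟩)
  · filter_upwards [hqw] with x hx
    exact congrArg (ψ x * ·) hx

/-- Multiplication by ψ is continuous on W^{1,p} and preserves `smoothOff`, hence also its closure.
No support condition on ψ is required. -/
lemma W1p.mul_mem_W1pOff {q : W1p Ω p} (hq : q ∈ W1pOff Ω Γ p) {ψ : E N → ℝ}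
    (hψ : ContDiff ℝ ∞ ψ) (hb : ∃ C, ∀ x, ‖ψ x‖ ≤ C) (hb' : ∃ C, ∀ x, ‖gradient ψ x‖ ≤ C) :
    W1p.mul q ψ hψ hb hb' ∈ W1pOff Ω Γ p := by
  have hq' : q ∈ closure (smoothOff Ω Γ p : Set (W1p Ω p)) := hq
  obtain ⟨Q, hQ, hlim⟩ := mem_closure_iff_seq_limit.1 hq'
  obtain ⟨hl1, hl2⟩ := W1p.tendsto_iff.1 hlim
  obtain ⟨C, hC⟩ := hb
  obtain ⟨C', hC'⟩ := hb'
  have hum : ∀ q : W1p Ω p, AEStronglyMeasurable (W1p.fn q) (μ Ω) := fun q =>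
    (W1p.memLp_fn q).aestronglyMeasurable
  have hvm : ∀ q : W1p Ω p, AEStronglyMeasurable (W1p.grad q) (μ Ω) := fun q =>
    (W1p.memLp_grad q).aestronglyMeasurable
  have t1 : Tendsto (fun n => eLpNorm ((fun x => ψ x * W1p.fn (Q n) x) -
      fun x => ψ x * W1p.fn q x) p (μ Ω)) atTop (𝓝 0) := by
    refine tendsto_eLpNorm_of_le_mul (C := C) (fun n => Eventually.of_forall fun x => ?_) hl1
    rw [Pi.sub_apply, ← mul_sub, norm_mul]
    exact mul_le_mul_of_nonneg_right (hC x) (norm_nonneg _)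
  have s1 : Tendsto (fun n => eLpNorm (fun x => ψ x • (W1p.grad (Q n) x - W1p.grad q x)) p (μ Ω))
      atTop (𝓝 0) := by
    refine tendsto_eLpNorm_of_le_mul (C := C) (fun n => Eventually.of_forall fun x => ?_) hl2
    rw [norm_smul]
    exact mul_le_mul_of_nonneg_right (hC x) (norm_nonneg _)
  have s2 : Tendsto (fun n => eLpNorm (fun x => (W1p.fn (Q n) x - W1p.fn q x) • gradient ψ x) p
      (μ Ω)) atTop (𝓝 0) := by
    refine tendsto_eLpNorm_of_le_mul (C := C') (fun n => Eventually.of_forall fun x => ?_) hl1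
    rw [norm_smul, mul_comm]
    exact mul_le_mul_of_nonneg_right (hC' x) (norm_nonneg _)
  have t2 : Tendsto (fun n => eLpNorm (W1p.prodGrad (Q n) ψ - W1p.prodGrad q ψ) p (μ Ω)) atTop
      (𝓝 0) := by
    refine (tendsto_eLpNorm_add Fact.out
      (fun n => hψ.continuous.aestronglyMeasurable.smul ((hvm (Q n)).sub (hvm q)))
      (fun n => ((hum (Q n)).sub (hum q)).smul (continuous_gradient hψ).aestronglyMeasurable)
      s1 s2).congr fun n => ?_
    congr 1
    funext x
    change ψ x • (W1p.grad (Q n) x - W1p.grad q x) + (W1p.fn (Q n) x - W1p.fn q x) • gradient ψ x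
      = (ψ x • W1p.grad (Q n) x + W1p.fn (Q n) x • gradient ψ x)
        - (ψ x • W1p.grad q x + W1p.fn q x • gradient ψ x)
    rw [smul_sub, sub_smul]
    abel
  have ht : Tendsto (fun n => W1p.mul (Q n) ψ hψ ⟨C, hC⟩ ⟨C', hC'⟩) atTop
      (𝓝 (W1p.mul q ψ hψ ⟨C, hC⟩ ⟨C', hC'⟩)) :=
    W1p.tendsto_of_eLpNorm (fun n => W1p.fn_mul _ _ _ _) (fun n => W1p.grad_mul _ _ _ _)
      (W1p.fn_mul _ _ _ _) (W1p.grad_mul _ _ _ _) t1 t2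
  exact isClosed_W1pOff.mem_of_tendsto ht (Eventually.of_forall fun n =>
    (smoothOff Ω Γ p).le_topologicalClosure (W1p.mul_mem_smoothOff (hQ n) hψ _ _))

/-- A bump function at the origin. -/
def spaceBump (N : ℕ) : ContDiffBump (0 : E N) where
  rIn := 1
  rOut := 2
  rIn_pos := one_pos
  rIn_lt_rOut := one_lt_two

/-- A cutoff function that equals one on the ball of radius `n + 1`. -/
def cutoff (N n : ℕ) (x : E N) : ℝ := spaceBump N (((n : ℝ) + 1)⁻¹ • x)

lemma contDiff_spaceBump (N : ℕ) : ContDiff ℝ ∞ (spaceBump N) := (spaceBump N).contDiff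

lemma contDiff_cutoff (N n : ℕ) : ContDiff ℝ ∞ (cutoff N n) :=
  have h : ContDiff ℝ ∞ fun x : E N => ((n : ℝ) + 1)⁻¹ • x := contDiff_id.const_smul _
  (contDiff_spaceBump N).comp h

lemma cutoff_nonneg (n : ℕ) (x : E N) : 0 ≤ cutoff N n x := (spaceBump N).nonneg

lemma cutoff_le_one (n : ℕ) (x : E N) : cutoff N n x ≤ 1 := (spaceBump N).le_one

lemma norm_cutoff_le (n : ℕ) (x : E N) : ‖cutoff N n x‖ ≤ 1 := by
  rw [Real.norm_of_nonneg (cutoff_nonneg n x)]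
  exact cutoff_le_one n x

lemma cutoff_eq_zero {n : ℕ} {x : E N} (h : 2 * ((n : ℝ) + 1) < ‖x‖) : cutoff N n x = 0 := by
  have hn : (0 : ℝ) < (n : ℝ) + 1 := by positivity
  refine (spaceBump N).zero_of_le_dist ?_
  change (2 : ℝ) ≤ _
  rw [dist_zero_right, norm_smul, Real.norm_of_nonneg (by positivity), inv_mul_eq_div,
    le_div_iff₀ hn]
  exact h.le

lemma tendsto_cutoff (x : E N) : Tendsto (fun n => cutoff N n x) atTop (𝓝 1) := by
  refine tendsto_const_nhds.congr' ?_
  filter_upwards [(tendsto_natCast_atTop_atTop (R := ℝ)).eventually_ge_atTop ‖x‖] with n hn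
  have hn0 : (0 : ℝ) < (n : ℝ) + 1 := by positivity
  refine ((spaceBump N).one_of_mem_closedBall ?_).symm
  rw [mem_closedBall_zero_iff, norm_smul, Real.norm_of_nonneg (by positivity), inv_mul_eq_div,
    div_le_iff₀ hn0]
  change _ ≤ (1 : ℝ) * _
  linarith

lemma gradient_cutoff (n : ℕ) (x : E N) :
    gradient (cutoff N n) x
      = ((n : ℝ) + 1)⁻¹ • gradient (spaceBump N) (((n : ℝ) + 1)⁻¹ • x) := by
  have h1 : HasFDerivAt (spaceBump N) (fderiv ℝ (spaceBump N) (((n : ℝ) + 1)⁻¹ • x))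
      (((n : ℝ) + 1)⁻¹ • x) :=
    ((contDiff_spaceBump N).contDiffAt.differentiableAt (by simp)).hasFDerivAt
  have h2 : HasFDerivAt (fun x : E N => ((n : ℝ) + 1)⁻¹ • x)
      (((n : ℝ) + 1)⁻¹ • ContinuousLinearMap.id ℝ (E N)) x :=
    (((n : ℝ) + 1)⁻¹ • ContinuousLinearMap.id ℝ (E N)).hasFDerivAt
  have h3 : HasFDerivAt (cutoff N n) _ x := h1.comp x h2
  rw [gradient, h3.fderiv, ContinuousLinearMap.comp_smul, ContinuousLinearMap.comp_id, map_smul,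
    gradient]

lemma exists_norm_gradient_cutoff_le (N : ℕ) :
    ∃ C, 0 ≤ C ∧ ∀ n x, ‖gradient (cutoff N n) x‖ ≤ ((n : ℝ) + 1)⁻¹ * C := by
  obtain ⟨C, hC⟩ := (hasCompactSupport_gradient
    (spaceBump N).hasCompactSupport).exists_bound_of_continuous
      (continuous_gradient (contDiff_spaceBump N))
  refine ⟨C, (norm_nonneg _).trans (hC 0), fun n x => ?_⟩
  rw [gradient_cutoff, norm_smul, Real.norm_of_nonneg (by positivity)]
  exact mul_le_mul_of_nonneg_left (hC _) (by positivity)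

/-- Elements of `W^{1,p}_Γ(Ω)` are limits of their cutoffs at infinity. -/
lemma exists_cutoff (hp : p ≠ ⊤) {q : W1p Ω p} (hq : q ∈ W1pOff Ω Γ p) {ε : ℝ} (hε : 0 < ε) :
    ∃ q' ∈ W1pOff Ω Γ p, ‖q' - q‖ < ε ∧ ∃ (χ : E N → ℝ) (R : ℝ), ContDiff ℝ ∞ χ ∧
      (∀ x, ‖χ x‖ ≤ 1) ∧ (∀ x, R < ‖x‖ → χ x = 0) ∧
      W1p.fn q' =ᵐ[μ Ω] fun x => χ x * W1p.fn q x := by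
  obtain ⟨C, hC0, hC⟩ := exists_norm_gradient_cutoff_le N
  have hinv : ∀ n : ℕ, ((n : ℝ) + 1)⁻¹ ≤ 1 := fun n =>
    inv_le_one_of_one_le₀ (by linarith [(Nat.cast_nonneg n : (0 : ℝ) ≤ n)])
  have hC1 : ∀ n x, ‖gradient (cutoff N n) x‖ ≤ C := fun n x =>
    (hC n x).trans (mul_le_of_le_one_left hC0 (hinv n))
  have hb : ∀ n, ∃ C, ∀ x, ‖cutoff N n x‖ ≤ C := fun n => ⟨1, norm_cutoff_le n⟩
  have hb' : ∀ n, ∃ C, ∀ x, ‖gradient (cutoff N n) x‖ ≤ C := fun n => ⟨C, hC1 n⟩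
  set Q : ℕ → W1p Ω p := fun n => W1p.mul q (cutoff N n) (contDiff_cutoff N n) (hb n) (hb' n)
    with hQ
  have hum := (W1p.memLp_fn q).aestronglyMeasurable
  have hvm := (W1p.memLp_grad q).aestronglyMeasurable
  have hcm : ∀ n, AEStronglyMeasurable (cutoff N n) (μ Ω) := fun n =>
    (contDiff_cutoff N n).continuous.aestronglyMeasurable
  have hgm : ∀ n, AEStronglyMeasurable (gradient (cutoff N n)) (μ Ω) := fun n =>
    (continuous_gradient (contDiff_cutoff N n)).aestronglyMeasurable
  have hone : ∀ n x, ‖cutoff N n x - 1‖ ≤ 1 := fun n x => by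
    rw [Real.norm_eq_abs, abs_le]
    constructor <;> linarith [cutoff_nonneg n x, cutoff_le_one n x]
  have t1 : Tendsto (fun n => eLpNorm ((fun x => cutoff N n x * W1p.fn q x) - W1p.fn q) p (μ Ω))
      atTop (𝓝 0) := by
    refine tendsto_eLpNorm_of_dominated Fact.out hp (W1p.memLp_fn q).norm
      (fun n => ((hcm n).mul hum).sub hum) (fun n => Eventually.of_forall fun x => ?_)
      (Eventually.of_forall fun x => ?_)
    · rw [Pi.sub_apply, ← sub_one_mul, norm_mul]
      exact mul_le_of_le_one_left (norm_nonneg _) (hone n x)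
    · have := ((tendsto_cutoff x).mul_const (W1p.fn q x)).sub_const (W1p.fn q x)
      rwa [one_mul, sub_self] at this
  have t2 : Tendsto (fun n => eLpNorm (W1p.prodGrad q (cutoff N n) - W1p.grad q) p (μ Ω)) atTop
      (𝓝 0) := by
    refine tendsto_eLpNorm_of_dominated Fact.out hp
      (b := fun x => ‖W1p.grad q x‖ + C * ‖W1p.fn q x‖)
      ((W1p.memLp_grad q).norm.add ((W1p.memLp_fn q).norm.const_mul C))
      (fun n => (((hcm n).smul hvm).add (hum.smul (hgm n))).sub hvm)
      (fun n => Eventually.of_forall fun x => ?_) (Eventually.of_forall fun x => ?_)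
    · have : (W1p.prodGrad q (cutoff N n) - W1p.grad q) x = (cutoff N n x - 1) • W1p.grad q x
          + W1p.fn q x • gradient (cutoff N n) x := by
        rw [Pi.sub_apply, W1p.prodGrad, sub_smul, one_smul]
        abel
      rw [this]
      refine (norm_add_le _ _).trans (add_le_add ?_ ?_)
      · rw [norm_smul]
        exact mul_le_of_le_one_left (norm_nonneg _) (hone n x)
      · rw [norm_smul, mul_comm]
        exact mul_le_mul_of_nonneg_right (hC1 n x) (norm_nonneg _)
    -- Spreading the bump over distance n + 1 divides its gradient by n + 1.
    · have hg : Tendsto (fun n => gradient (cutoff N n) x) atTop (𝓝 0) := by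
        refine squeeze_zero_norm (fun n => hC n x) ?_
        have := (tendsto_one_div_add_atTop_nhds_zero_nat (𝕜 := ℝ)).mul_const C
        simpa only [one_div, zero_mul] using this
      have h2 := (((tendsto_cutoff x).smul_const (W1p.grad q x)).add
        (hg.const_smul (W1p.fn q x))).sub_const (W1p.grad q x)
      rwa [one_smul, smul_zero, add_zero, sub_self] at h2
  have ht : Tendsto Q atTop (𝓝 q) :=
    W1p.tendsto_of_eLpNorm (fun n => W1p.fn_mul _ _ _ _) (fun n => W1p.grad_mul _ _ _ _)
      EventuallyEq.rfl EventuallyEq.rfl t1 t2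
  obtain ⟨n, hn⟩ := (Metric.tendsto_nhds.1 ht ε hε).exists
  rw [dist_eq_norm] at hn
  exact ⟨Q n, W1p.mul_mem_W1pOff hq _ _ _, hn, cutoff N n, 2 * ((n : ℝ) + 1), contDiff_cutoff N n,
    norm_cutoff_le n, fun x hx => cutoff_eq_zero hx, W1p.fn_mul _ _ _ _⟩

end Cutoff

/-! ### Closedness of the constraint sets, and the set where α is positive. -/

section ConstraintSets

variable {N : ℕ} {Ω Γ : Set (E N)} {p : ℝ≥0∞} [Fact (1 ≤ p)]

lemma isClosed_setOf_ae_norm_le {X F : Type*} [MeasurableSpace X] [NormedAddCommGroup F]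
    {m : Measure X} (α : X → ℝ) : IsClosed {u : Lp F p m | ∀ᵐ x ∂m, ‖u x‖ ≤ α x} := by
  refine IsSeqClosed.isClosed fun U u hU hlim => ?_
  obtain ⟨ns, -, hae⟩ := (tendstoInMeasure_of_tendsto_Lp hlim).exists_seq_tendsto_ae
  have hU' : ∀ n, ∀ᵐ x ∂m, ‖U n x‖ ≤ α x := hU
  change ∀ᵐ x ∂m, ‖u x‖ ≤ α x
  filter_upwards [hae, ae_all_iff.2 hU'] with x hx hb
  exact le_of_tendsto hx.norm (Eventually.of_forall fun i => hb _)

lemma isClosed_KLp (α : E N → ℝ) : IsClosed (KLp Ω p α) := isClosed_setOf_ae_norm_le α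

lemma isClosed_KSob (α : E N → ℝ) : IsClosed (KSob Ω Γ p α) :=
  (isClosed_KLp α).preimage (continuous_fst.comp (continuous_subtype_val.comp
    (continuous_subtype_val : Continuous fun u : W1pOff Ω Γ p => u.1)))

lemma isClosed_KGrad (α : E N → ℝ) : IsClosed (KGrad Ω Γ p α) :=
  (isClosed_setOf_ae_norm_le (F := E N) α).preimage
    (continuous_snd.comp (continuous_subtype_val.comp
      (continuous_subtype_val : Continuous fun u : W1pOff Ω Γ p => u.1)))

variable {α : E N → ℝ}

lemma isOpen_diff_zeroSet (hΩ : IsOpen Ω) (hα : ContinuousOn α (closure Ω)) :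
    IsOpen (Ω \ zeroSet Ω α) := by
  have : Ω \ zeroSet Ω α = Ω ∩ α ⁻¹' {0}ᶜ := by
    ext x
    exact ⟨fun h => ⟨h.1, fun h0 => h.2 ⟨subset_closure h.1, h0⟩⟩,
      fun h => ⟨h.1, fun h0 => h.2 h0.2⟩⟩
  rw [this]
  exact (hα.mono subset_closure).isOpen_inter_preimage hΩ isOpen_compl_singleton

lemma pos_of_mem_diff_zeroSet (hα0 : ∀ x ∈ closure Ω, 0 ≤ α x) :
    ∀ x ∈ Ω \ zeroSet Ω α, 0 < α x := fun x hx =>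
  (hα0 x (subset_closure hx.1)).lt_of_ne fun h => hx.2 ⟨subset_closure hx.1, h.symm⟩

lemma eq_zero_of_notMem_diff_zeroSet {x : E N} (hx : x ∈ Ω) (h : x ∉ Ω \ zeroSet Ω α) :
    α x = 0 := by
  by_contra hne
  exact h ⟨hx, fun h0 => hne h0.2⟩

/-- Sets of full measure in U are dense in U, so continuity upgrades the inequality. The class C_Δ^∞
is defined pointwise, so an a.e. bound on the representative would not suffice. -/
lemma forall_le_of_ae_le {U : Set (E N)} (hU : IsOpen U) {f g : E N → ℝ} (hf : ContinuousOn f U)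
    (hg : ContinuousOn g U) (h : ∀ᵐ x ∂(volume : Measure (E N)), x ∈ U → f x ≤ g x) :
    ∀ x ∈ U, f x ≤ g x := by
  intro x hx
  by_contra hlt
  rw [not_le] at hlt
  have h1 : ∀ᶠ y in 𝓝 x, g y < f y :=
    (hg.continuousAt (hU.mem_nhds hx)).eventually_lt (hf.continuousAt (hU.mem_nhds hx)) hlt
  have hA : ∀ᵐ y ∂(volume : Measure (E N)), y ∈ U → y ∈ {y | f y ≤ g y} := h
  obtain ⟨y, hy1, hy2⟩ :=
    mem_closure_iff_nhds.1 (subset_closure_of_ae hU hA hx) _ h1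
  have hy1' : g y < f y := hy1
  have hy2' : f y ≤ g y := hy2
  exact hy1'.not_ge hy2'

/-- The price of dividing by 1 + δ to restore the constraint: 1 − 1/(1 + δ) ≤ δ and ‖y‖ ≤ ‖x‖ + 1.
-/
lemma norm_inv_smul_sub_le {V : Type*} [NormedAddCommGroup V] [NormedSpace ℝ V] {x y : V}
    {δ η : ℝ} (hδ : 0 < δ) (hη : η ≤ 1) (h : ‖y - x‖ ≤ η) :
    ‖(1 + δ)⁻¹ • y - x‖ ≤ η + δ * (‖x‖ + 1) := by
  have hy : ‖y‖ ≤ ‖x‖ + 1 := by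
    have := norm_le_norm_add_norm_sub' y x
    linarith
  have hinv : (1 + δ)⁻¹ ≤ 1 := inv_le_one_of_one_le₀ (by linarith)
  have hpos : 0 < (1 + δ)⁻¹ := by positivity
  have hd : (1 + δ)⁻¹ • y - x = (y - x) - (1 - (1 + δ)⁻¹) • y := by
    rw [sub_smul, one_smul]; abel
  have he : 1 - (1 + δ)⁻¹ ≤ δ := by
    have : (1 + δ)⁻¹ * (1 + δ) = 1 := inv_mul_cancel₀ (by positivity)
    nlinarith
  rw [hd]
  refine (norm_sub_le _ _).trans (add_le_add h ?_)
  rw [norm_smul, Real.norm_of_nonneg (by linarith)]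
  exact mul_le_mul he hy (norm_nonneg _) hδ.le

lemma exists_scale (M : ℝ) (hM : 0 ≤ M) {ε : ℝ} (hε : 0 < ε) :
    ∃ δ η : ℝ, 0 < δ ∧ 0 < η ∧ η ≤ 1 ∧ η + δ * (M + 1) < ε := by
  refine ⟨ε / 4 / (M + 1), min (ε / 4) 1, by positivity, by positivity, min_le_right _ _, ?_⟩
  rw [div_mul_cancel₀ _ (by positivity)]
  have := min_le_left (ε / 4) 1
  linarith

lemma inv_mul_le_of_le {δ a b : ℝ} (hδ : 0 < δ) (h : a ≤ (1 + δ) * b) : (1 + δ)⁻¹ * a ≤ b := by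
  rwa [inv_mul_le_iff₀ (by positivity)]

lemma W1p.fn_smul (c : ℝ) (q : W1p Ω p) : W1p.fn (c • q) =ᵐ[μ Ω] fun x => c * W1p.fn q x :=
  Lp.coeFn_smul c q.1.1

lemma W1p.grad_smul (c : ℝ) (q : W1p Ω p) :
    W1p.grad (c • q) =ᵐ[μ Ω] fun x => c • W1p.grad q x :=
  Lp.coeFn_smul c q.1.2

end ConstraintSets

/-! ### Density in the three constraint sets. -/

section Density

variable {N : ℕ} {Ω Γ : Set (E N)} {p : ℝ≥0∞} [Fact (1 ≤ p)] {α : E N → ℝ}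

lemma mem_closure_of_norm_lt {s : Set (W1pOff Ω Γ p)} {q : W1p Ω p} (hq : q ∈ W1pOff Ω Γ p)
    (h : ∀ ε > 0, ∃ (q' : W1p Ω p) (hq' : q' ∈ W1pOff Ω Γ p),
      (⟨q', hq'⟩ : W1pOff Ω Γ p) ∈ s ∧ ‖q' - q‖ < ε) :
    (⟨q, hq⟩ : W1pOff Ω Γ p) ∈ closure s := by
  rw [Metric.mem_closure_iff]
  intro ε hε
  obtain ⟨q', hq', hs, hn⟩ := h ε hε
  refine ⟨⟨q', hq'⟩, hs, ?_⟩
  rw [← dist_eq_norm, dist_comm] at hn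
  exact hn

lemma KGrad_subset_closure (hp : p ≠ ⊤) (hΩ : IsOpen Ω) (hαc : ContinuousOn α (closure Ω))
    (hα0 : ∀ x ∈ closure Ω, 0 ≤ α x) (hΓ : Γ ⊆ frontier Ω) :
    KGrad Ω Γ p α ⊆ closure (KGrad Ω Γ p α ∩ CInftyOffSob Ω Γ (zeroSet Ω α) p) := by
  rintro ⟨q, hqΓ⟩ hq
  have hq' : ∀ᵐ x ∂(μ Ω), ‖W1p.grad q x‖ ≤ α x := hq
  refine mem_closure_of_norm_lt hqΓ fun ε hε => ?_
  obtain ⟨δ, η, hδ, hη, hη1, hsum⟩ := exists_scale ‖q‖ (norm_nonneg _) hε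
  obtain ⟨q', g, h1, h2, h3, h4, h5, h6⟩ := W1p.exists_smoothing_grad_le q hp hΩ
    (isOpen_diff_zeroSet hΩ hαc) sdiff_subset hΓ (hαc.mono (sdiff_subset.trans subset_closure))
    (pos_of_mem_diff_zeroSet hα0) (hq'.mono fun x hx _ => hx) hδ hη
  have hmem : (1 + δ)⁻¹ • q' ∈ W1pOff Ω Γ p := by
    refine Submodule.smul_mem _ _ ?_
    have := add_mem h1 hqΓ
    rwa [sub_add_cancel] at this
  have hgrad : ∀ᵐ x ∂(μ Ω), ‖W1p.grad ((1 + δ)⁻¹ • q') x‖ ≤ α x := by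
    filter_upwards [W1p.grad_smul (1 + δ)⁻¹ q', h5, h6, hq', ae_restrict_mem hΩ.measurableSet]
      with x e a b c hx
    rw [e, norm_smul, Real.norm_of_nonneg (by positivity)]
    refine inv_mul_le_of_le hδ ?_
    -- On the zero set the smoothing left the gradient unchanged, and there it is a.e. zero by the
    -- constraint.
    by_cases hxU : x ∈ Ω \ zeroSet Ω α
    · exact b hxU
    · rw [a hxU, eq_zero_of_notMem_diff_zeroSet hx hxU, mul_zero]
      rwa [eq_zero_of_notMem_diff_zeroSet hx hxU] at c
  have hfn : W1p.fn ((1 + δ)⁻¹ • q') =ᵐ[μ Ω] fun x => (1 + δ)⁻¹ * g x := by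
    filter_upwards [W1p.fn_smul (1 + δ)⁻¹ q', h4] with x a b
    rw [a, b]
  exact ⟨_, hmem, ⟨hgrad, _, contDiffOn_const.mul h3, hfn⟩,
    (norm_inv_smul_sub_le hδ hη1 h2).trans_lt hsum⟩

lemma isCompact_superlevel (hαc : ContinuousOn α (closure Ω)) (c R : ℝ) :
    IsCompact (closure Ω ∩ α ⁻¹' Ici c ∩ closedBall (0 : E N) R) :=
  (isCompact_closedBall _ _).inter_left (hαc.preimage_isClosed_of_isClosed isClosed_closure
    isClosed_Ici)

-- Where the function is nonzero one has c < |g| ≤ α and |x| ≤ R. It therefore vanishes on Ω ∖ Δ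
-- outside one compact set, which avoids Δ and serves for every ε.
open Classical in
lemma isCInftyVanishing_cutoff (hαc : ContinuousOn α (closure Ω)) {g χ : E N → ℝ} {S : ℝ → ℝ}
    {c R : ℝ} (hc : 0 < c) (hg : ContDiffOn ℝ ∞ g (Ω \ zeroSet Ω α))
    (hgα : ∀ x ∈ Ω \ zeroSet Ω α, |g x| ≤ α x) (hS : ContDiff ℝ ∞ S)
    (hSc : ∀ t, |t| ≤ c → S t = 0) (hχ : ContDiff ℝ ∞ χ) (hχR : ∀ x, R < ‖x‖ → χ x = 0) :
    IsCInftyVanishing Ω (zeroSet Ω α)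
      fun x => if x ∈ Ω \ zeroSet Ω α then χ x * S (g x) else 0 where
  contDiffOn := (hχ.contDiffOn.mul (hS.comp_contDiffOn hg)).congr fun _ hx => if_pos hx
  eq_zero x hx := if_neg fun h => h.2 hx.2
  small ε hε := by
    refine ⟨closure Ω ∩ α ⁻¹' Ici c ∩ closedBall 0 R, isCompact_superlevel hαc c R, ?_, ?_⟩
    · rintro x ⟨⟨hx1, hx2⟩, -⟩
      refine ⟨hx1, fun h0 => ?_⟩
      have hcx : c ≤ α x := hx2
      rw [h0.2] at hcx
      exact hc.not_ge hcx
    · rintro x ⟨hxU, hxC⟩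
      have : χ x * S (g x) = 0 := by
        by_cases hxR : R < ‖x‖
        · rw [hχR x hxR, zero_mul]
        · rw [hSc, mul_zero]
          refine (hgα x hxU).trans ?_
          by_contra hlt
          refine hxC ⟨⟨subset_closure hxU.1, ?_⟩, ?_⟩
          · exact (not_le.1 hlt).le
          · rw [mem_closedBall_zero_iff]
            exact not_lt.1 hxR
      rw [if_pos hxU, this, abs_zero]
      exact hε.le

/-- Elements of `W^{1,p}_Γ(Ω)` bounded by `α` are limits of such elements that are smooth off the
zero set of `α`. -/
lemma exists_smooth_fn_le (hp : p ≠ ⊤) (hΩ : IsOpen Ω) (hαc : ContinuousOn α (closure Ω))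
    (hα0 : ∀ x ∈ closure Ω, 0 ≤ α x) (hΓ : Γ ⊆ frontier Ω) {q : W1p Ω p}
    (hqΓ : q ∈ W1pOff Ω Γ p) (hq : ∀ᵐ x ∂(μ Ω), |W1p.fn q x| ≤ α x) {ε : ℝ} (hε : 0 < ε) :
    ∃ q' ∈ W1pOff Ω Γ p, ‖q' - q‖ < ε ∧ (∀ᵐ x ∂(μ Ω), |W1p.fn q' x| ≤ α x) ∧
      ∃ g : E N → ℝ, ContDiffOn ℝ ∞ g (Ω \ zeroSet Ω α) ∧ W1p.fn q' =ᵐ[μ Ω] g ∧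
        ∀ x ∈ Ω \ zeroSet Ω α, |g x| ≤ α x := by
  have hU := isOpen_diff_zeroSet hΩ hαc
  have hαU : ContinuousOn α (Ω \ zeroSet Ω α) := hαc.mono (sdiff_subset.trans subset_closure)
  obtain ⟨δ, η, hδ, hη, hη1, hsum⟩ := exists_scale ‖q‖ (norm_nonneg _) hε
  obtain ⟨q₁, g, h1, h2, h3, h4, h5, h6⟩ := W1p.exists_smoothing_fn_le q hp hΩ
    hU sdiff_subset hΓ hαU (pos_of_mem_diff_zeroSet hα0) (hq.mono fun x hx _ => hx) hδ hη
  have hmem : (1 + δ)⁻¹ • q₁ ∈ W1pOff Ω Γ p := by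
    refine Submodule.smul_mem _ _ ?_
    have := add_mem h1 hqΓ
    rwa [sub_add_cancel] at this
  have hgs : ContDiffOn ℝ ∞ (fun x => (1 + δ)⁻¹ * g x) (Ω \ zeroSet Ω α) :=
    contDiffOn_const.mul h3
  have hfn : W1p.fn ((1 + δ)⁻¹ • q₁) =ᵐ[μ Ω] fun x => (1 + δ)⁻¹ * g x := by
    filter_upwards [W1p.fn_smul (1 + δ)⁻¹ q₁, h4] with x a b
    rw [a, b]
  have hb : ∀ᵐ x ∂(μ Ω), |W1p.fn ((1 + δ)⁻¹ • q₁) x| ≤ α x := by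
    filter_upwards [W1p.fn_smul (1 + δ)⁻¹ q₁, h5, h6, hq, ae_restrict_mem hΩ.measurableSet]
      with x e a b c hx
    rw [e, abs_mul, abs_of_pos (by positivity : 0 < (1 + δ)⁻¹)]
    refine inv_mul_le_of_le hδ ?_
    by_cases hxU : x ∈ Ω \ zeroSet Ω α
    · exact b hxU
    · rw [a hxU, eq_zero_of_notMem_diff_zeroSet hx hxU, mul_zero]
      rwa [eq_zero_of_notMem_diff_zeroSet hx hxU] at c
  refine ⟨_, hmem, (norm_inv_smul_sub_le hδ hη1 h2).trans_lt hsum, hb, _, hgs, hfn, ?_⟩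
  refine forall_le_of_ae_le hU hgs.continuousOn.abs hαU ?_
  have : ∀ᵐ x ∂(μ Ω), |(1 + δ)⁻¹ * g x| ≤ α x := by
    filter_upwards [hfn, hb] with x a b
    rwa [← a]
  filter_upwards [(ae_restrict_iff' hΩ.measurableSet).1 this] with x hx hxU
  exact hx hxU.1

/-- Smoothing off Δ, truncation of small values and cutoff at infinity are applied in turn, at costs
ε/2, ε/4 and ε/4. The last two do not increase the absolute value, so the constraint persists. -/
lemma KSob_subset_closure (hp : p ≠ ⊤) (hΩ : IsOpen Ω) (hαc : ContinuousOn α (closure Ω))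
    (hα0 : ∀ x ∈ closure Ω, 0 ≤ α x) (hΓ : Γ ⊆ frontier Ω) :
    KSob Ω Γ p α ⊆ closure (KSob Ω Γ p α ∩ CInftyVanishingSob Ω Γ (zeroSet Ω α) p) := by
  classical
  rintro ⟨q, hqΓ⟩ hq
  refine mem_closure_of_norm_lt hqΓ fun ε hε => ?_
  obtain ⟨q₂, hmem₂, hn₂, hb₂, g, hg, hfn₂, hgα⟩ :=
    exists_smooth_fn_le hp hΩ hαc hα0 hΓ hqΓ hq (half_pos hε)
  obtain ⟨q₃, hmem₃, hn₃, S, c, hc, hS, hSc, hSle, hfn₃⟩ :=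
    exists_truncation hΩ hp hmem₂ (by positivity : 0 < ε / 4)
  obtain ⟨q₄, hmem₄, hn₄, χ, R, hχ, hχ1, hχR, hfn₄⟩ :=
    exists_cutoff hp hmem₃ (by positivity : 0 < ε / 4)
  have hS0 : S 0 = 0 := hSc 0 (by simpa using hc.le)
  have hfn : W1p.fn q₄ =ᵐ[μ Ω] fun x => χ x * S (W1p.fn q₂ x) := by
    filter_upwards [hfn₃, hfn₄] with x a b
    rw [b, a]
  have hb₄ : ∀ᵐ x ∂(μ Ω), |W1p.fn q₄ x| ≤ α x := by
    filter_upwards [hfn, hb₂] with x a b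
    rw [a, abs_mul]
    exact (mul_le_of_le_one_left (abs_nonneg _) (hχ1 x)).trans ((hSle _).trans b)
  have hrep : W1p.fn q₄ =ᵐ[μ Ω] fun x => if x ∈ Ω \ zeroSet Ω α then χ x * S (g x) else 0 := by
    filter_upwards [hfn, hfn₂, hb₂, ae_restrict_mem hΩ.measurableSet] with x a b b' hx
    rw [a]
    split_ifs with hxU
    · rw [b]
    -- On the zero set the constraint forces q₂ = 0 a.e., and S 0 = 0 matches the prescribed value
    -- 0.
    · rw [eq_zero_of_notMem_diff_zeroSet hx hxU] at b'
      rw [abs_nonpos_iff.1 b', hS0, mul_zero]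
  refine ⟨q₄, hmem₄, ⟨hb₄, _, isCInftyVanishing_cutoff hαc hc hg hgα hS hSc hχ hχR, hrep⟩, ?_⟩
  have hdec : q₄ - q = (q₄ - q₃) + ((q₃ - q₂) + (q₂ - q)) := by abel
  rw [hdec]
  have := norm_add_le (q₄ - q₃) ((q₃ - q₂) + (q₂ - q))
  have := norm_add_le (q₃ - q₂) (q₂ - q)
  linarith

/-- Partial sums χ m of the partition satisfy χ m f → f in L^p, because f vanishes a.e. on Ω ∩ Δ.
Each χ m f is supported compactly in U, so a single mollification stays below (1 + δ) α and yields a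
test function. -/
lemma KLp_subset_closure (hp : p ≠ ⊤) (hΩ : IsOpen Ω) (hαc : ContinuousOn α (closure Ω))
    (hα0 : ∀ x ∈ closure Ω, 0 ≤ α x) :
    KLp Ω p α ⊆ closure (KLp Ω p α ∩ CcInftyLp Ω p) := by
  intro f hf
  have hf' : ∀ᵐ x ∂(μ Ω), |f x| ≤ α x := hf
  rw [Metric.mem_closure_iff]
  intro ε hε
  have hU := isOpen_diff_zeroSet hΩ hαc
  have hαU : ContinuousOn α (Ω \ zeroSet Ω α) := hαc.mono (sdiff_subset.trans subset_closure)
  obtain ⟨δ, η, hδ, hη, hη1, hsum⟩ := exists_scale ‖f‖ (norm_nonneg _) hε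
  obtain ⟨K, ψ, P⟩ := exists_isPartition hU
  set χ : ℕ → E N → ℝ := fun m x => ∑ j ∈ Finset.range m, ψ j x with hχ
  have hχcc : ∀ m, IsCcInfty (Ω \ zeroSet Ω α) (χ m) := P.isCcInfty_sum
  have hχ0 : ∀ m x, 0 ≤ χ m x := fun m x => Finset.sum_nonneg fun j _ => P.nonneg j x
  have hfm := Lp.memLp f
  have t1 : Tendsto (fun m => eLpNorm (fun x => χ m x * f x - f x) p (μ Ω)) atTop (𝓝 0) := by
    refine tendsto_eLpNorm_of_dominated Fact.out hp hfm.norm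
      (fun m => ((hχcc m).contDiff.continuous.aestronglyMeasurable.mul
        hfm.aestronglyMeasurable).sub hfm.aestronglyMeasurable)
      (fun m => Eventually.of_forall fun x => ?_) ?_
    · rw [← sub_one_mul, norm_mul]
      refine mul_le_of_le_one_left (norm_nonneg _) ?_
      rw [Real.norm_eq_abs, abs_le]
      constructor <;> linarith [hχ0 m x, P.sum_le_one m x]
    · filter_upwards [hf', ae_restrict_mem hΩ.measurableSet] with x hx hxΩ
      by_cases hxU : x ∈ Ω \ zeroSet Ω α
      · obtain ⟨n, hn⟩ := P.exists_mem hxU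
        refine tendsto_const_nhds.congr' ?_
        filter_upwards [eventually_ge_atTop n] with m hm
        have : χ m x = 1 := (P.sum_eq_one m x (P.monotone hm hn)).self_of_nhds
        rw [this, one_mul, sub_self]
      · rw [eq_zero_of_notMem_diff_zeroSet hxΩ hxU] at hx
        simp [abs_nonpos_iff.1 hx]
  have hη2 : 0 < ENNReal.ofReal (η / 2) := by simpa using hη
  obtain ⟨m, hm⟩ := (t1.eventually (gt_mem_nhds hη2)).exists
  have hcc := (hχcc m).mono (sdiff_subset : Ω \ zeroSet Ω α ⊆ Ω)
  have hmΩ : MemLp (fun x => χ m x * f x) p (μ Ω) :=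
    memLp_bdd_smul hcc.contDiff.continuous hcc.bdd hfm
  have hmv : MemLp (fun x => χ m x * f x) p volume :=
    memLp_volume_of_support_subset hΩ.measurableSet hmΩ fun x hx => by
      rw [image_eq_zero_of_notMem_tsupport fun h => hx (hcc.tsupport_subset h), zero_mul]
  have t2 := tendsto_eLpNorm_restrict (Ω := Ω) (tendsto_eLpNorm_moll_sub Fact.out hp hmv)
  have hbd : ∀ᵐ x ∂(volume : Measure (E N)), ‖χ m x * f x‖ ≤ α x * χ m x := by
    filter_upwards [(ae_restrict_iff' hΩ.measurableSet).1 hf'] with x hx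
    by_cases hxU : x ∈ Ω \ zeroSet Ω α
    · rw [norm_mul, Real.norm_of_nonneg (hχ0 m x), mul_comm]
      exact mul_le_mul_of_nonneg_right (hx hxU.1) (hχ0 m x)
    · rw [image_eq_zero_of_notMem_tsupport fun h => hxU ((hχcc m).tsupport_subset h)]
      simp
  have hcs : HasCompactSupport fun x => χ m x * f x := hcc.hasCompactSupport.mul_right
  -- One scale is chosen for three demands: L^p distance, the bound by α χ m + δ α, and support in
  -- U.
  obtain ⟨n, hn1, hn2, hn3⟩ := ((t2.eventually (gt_mem_nhds hη2)).and
    ((eventually_norm_moll_le hU hαU (pos_of_mem_diff_zeroSet hα0) (hχcc m) hbd hδ).and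
    (eventually_isCcInfty_moll hcs (hmv.locallyIntegrable Fact.out) hU
      ((tsupport_mul_fn_subset _ _).trans (hχcc m).tsupport_subset)))).exists
  have hn3' := hn3.mono (sdiff_subset : Ω \ zeroSet Ω α ⊆ Ω)
  set F := moll n fun x => χ m x * f x with hF
  have hFm : MemLp F p (μ Ω) := hn3'.memLp
  have hdist : ‖hFm.toLp F - f‖ ≤ η := by
    rw [Lp.norm_def]
    refine ENNReal.toReal_le_of_le_ofReal hη.le ?_
    have he : ⇑(hFm.toLp F - f) =ᵐ[μ Ω] (F - fun x => χ m x * f x) +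
        fun x => χ m x * f x - f x := by
      filter_upwards [Lp.coeFn_sub (hFm.toLp F) f, hFm.coeFn_toLp] with x a b
      rw [a, Pi.sub_apply, b]
      simp
    rw [eLpNorm_congr_ae he]
    refine (eLpNorm_add_le (hFm.sub hmΩ).aestronglyMeasurable
      (hmΩ.sub hfm).aestronglyMeasurable Fact.out).trans ?_
    refine (add_le_add hn1.le hm.le).trans ?_
    rw [← ENNReal.ofReal_add (by positivity) (by positivity), add_halves]
  refine ⟨(1 + δ)⁻¹ • hFm.toLp F, ⟨?_, fun x => (1 + δ)⁻¹ * F x, ⟨?_, ?_, ?_⟩, ?_⟩, ?_⟩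
  · change ∀ᵐ x ∂(μ Ω), |((1 + δ)⁻¹ • hFm.toLp F : LpReal Ω p) x| ≤ α x
    filter_upwards [Lp.coeFn_smul (1 + δ)⁻¹ (hFm.toLp F), hFm.coeFn_toLp,
      ae_restrict_mem hΩ.measurableSet] with x a b hx
    rw [a, Pi.smul_apply, b, smul_eq_mul, abs_mul, abs_of_pos (by positivity : 0 < (1 + δ)⁻¹)]
    refine inv_mul_le_of_le hδ ?_
    by_cases hxU : x ∈ Ω \ zeroSet Ω α
    · have h1 := hn2 x hxU
      have h2 := mul_le_mul_of_nonneg_left (P.sum_le_one m x) (hα0 x (subset_closure hx))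
      rw [Real.norm_eq_abs] at h1
      have h2' : α x * χ m x ≤ α x * 1 := h2
      linarith
    · rw [image_eq_zero_of_notMem_tsupport fun h => hxU (hn3.tsupport_subset h), abs_zero]
      exact mul_nonneg (by positivity) (hα0 x (subset_closure hx))
  · exact contDiff_const.mul hn3.contDiff
  · exact hn3.hasCompactSupport.mul_left
  · exact (tsupport_mul_subset_right (f := fun _ => (1 + δ)⁻¹) (g := F)).trans hn3'.tsupport_subset
  · filter_upwards [Lp.coeFn_smul (1 + δ)⁻¹ (hFm.toLp F), hFm.coeFn_toLp] with x a b
    rw [a, Pi.smul_apply, b, smul_eq_mul]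
  · rw [dist_comm, dist_eq_norm]
    exact (norm_inv_smul_sub_le hδ hη1 hdist).trans_lt hsum

end Density

end ConvexDensity

end

open ConvexDensity in
theorem theorem6p1 (N : ℕ) (Ω : Set (E N)) (hΩ : IsOpen Ω)
    (α : E N → ℝ) (hαc : ContinuousOn α (closure Ω)) (hα0 : ∀ x ∈ closure Ω, 0 ≤ α x)
    (p : ℝ≥0∞) [Fact (1 ≤ p)] (hp1 : 1 < p) (hp2 : p < ⊤) :
    closure (KLp Ω p α ∩ CcInftyLp Ω p) = KLp Ω p α ∧
    (∀ Γ : Set (E N), Γ ⊆ frontier Ω →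
      closure (KSob Ω Γ p α ∩ CInftyVanishingSob Ω Γ (zeroSet Ω α) p) = KSob Ω Γ p α) ∧
    (∀ Γ : Set (E N), Γ ⊆ frontier Ω →
      closure (KGrad Ω Γ p α ∩ CInftyOffSob Ω Γ (zeroSet Ω α) p) = KGrad Ω Γ p α) := by
  refine ⟨?_, fun Γ hΓ => ?_, fun Γ hΓ => ?_⟩
  · exact subset_antisymm (closure_minimal inter_subset_left (isClosed_KLp α))
      (KLp_subset_closure hp2.ne hΩ hαc hα0)
  · exact subset_antisymm (closure_minimal inter_subset_left (isClosed_KSob α))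
      (KSob_subset_closure hp2.ne hΩ hαc hα0 hΓ)
  · exact subset_antisymm (closure_minimal inter_subset_left (isClosed_KGrad α))
      (KGrad_subset_closure hp2.ne hΩ hαc hα0 hΓ)
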